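/- **Notation.** Fix an integer $q\ge 2$ and let $A=\{0,\dots,q-1\}$. For $w\in A^{\mathbb N}$ let $L_n(w)$ be the set of factors of length $n$ of $w$, $p_w(n)=|L_n(w)|$ and $E(w)=\lim_{n\to\infty}\frac1n\log p_w(n)$. For $Y\subset A^N$ and $1\le n\le N$ let $L_n(Y)$ be the set of factors of length $n$ of words of $Y$, and $q_n(Y)=|L_n(Y)|$. For $f:\mathbb N\to\mathbb R^+$ put $E_W(f)=\sup\{E(w): w\in A^{\mathbb N},\ p_w(n)\le f(n)\ \forall n\in\mathbb N\}$ and $E_0(f)=\liminf_{n\to\infty}\frac1n\log f(n)$. Say that $f$ satisfies $(\mathcal C^*)$ if $f(n+1)>f(n)\ge n+1$ and $f(n+n')\le f(n)f(n')$ for all $n,n'\in\mathbb N$. For $\varepsilon\in{]0,1[}$, $E_0=E_0(f)$ and $n_0\in\mathbb N$ put $$\delta=\frac{E_0\,\varepsilon}{105(4+2E_0)},\qquad K=\lceil\delta^{-1}\rceil+1,\qquad n_{t+1}=\Big\lceil\exp\big(K((1+\delta)^2E_0n_t+E_0)\big)\Big\rceil\quad(t\ge0),\qquad N=n_K .$$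 Call $n_0$ admissible if $n_0\ge K$, $n_0\ge \frac{4K^2}{420^3E_0}$ and $$\frac{\log f(n)}{n}<\Big(1+\frac\delta2\Big)E_0\quad\text{for every integer } n\in[n_0,2n_0-1].\qquad(*)$$ **Theorem.** Let $f$ satisfy $(\mathcal C^*)$ and let $\varepsilon\in{]0,1[}$. 1. For every $n_0\ge1$, condition $(*)$ is equivalent to the same inequality for all integers $n\ge n_0$. If $E_0(f)>0$, every sufficiently large $n_0$ is admissible (and an admissible $n_0$ exists only if $E_0(f)>0$). 2. Let $n_0$ be admissible. Among the non-empty sets $Y\subset A^N$ with $q_n(Y)\le f(n)$ for all $1\le n\le N$ there is one that maximizes $\min_{1\le n\le N}\frac{\log q_n(Y)}{n}$. For every such maximizing $Y$ there is an integer $0\le r<K$ with $$\frac{\log q_{n_r}(Y)}{n_r}<(1+\delta)\,\frac{\log q_{n_{r+1}}(Y)}{n_{r+1}},$$ and for every such $Y$ and every such $r$ the number $h=\frac{\log q_{n_r}(Y)}{n_r}$ satisfies $$(1-\varepsilon)h\le E_W(f)\le h .$$ 3. This is effective: $N$ is computed by an algorithm from $\varepsilon,E_0(f),n_0$, and there is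 one algorithm, independent of $q$, $f$, $\varepsilon$ and $n_0$, which for every such $q$, $f$, $\varepsilon$ and every admissible $n_0$ returns, from the input $q,\varepsilon,E_0(f),n_0,f(1),\dots,f(N)$, one of the numbers $h$ described in 2. Here an algorithm is a terminating program on natural numbers, real numbers, pairs and lists, with loops over natural numbers and over lists, whose operations on reals are the exact operations $+,-,\cdot,/,\exp,\log$, conversion of natural numbers to reals, rounding up to a natural number, and branching on a comparison $x<y$. -/

import Mathlib

open Filter Topology

noncomputable section

namespace WordEntropy

/-- `L_n(w)`: the factors of length `n` of the infinite word `w` over the alphabet `{0,…,q-1}`. -/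
def factors {q : ℕ} (w : ℕ → Fin q) (n : ℕ) : Set (Fin n → Fin q) :=
  {u | ∃ i : ℕ, ∀ j : Fin n, u j = w (i + j)}

/-- The complexity function `p_w(n) = |L_n(w)|`. -/
def complexity {q : ℕ} (w : ℕ → Fin q) (n : ℕ) : ℕ := (factors w n).ncard

/-- The entropy `E(w) = lim (1/n) log p_w(n)`; the limit exists, see `entropy_tendsto`. -/
def entropy {q : ℕ} (w : ℕ → Fin q) : ℝ :=
  limUnder atTop fun n : ℕ => Real.log (complexity w n) / n

theorem complexity_pos {q : ℕ} (w : ℕ → Fin q) (n : ℕ) : 0 < complexity w n :=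
  (Set.ncard_pos (Set.toFinite _)).2 ⟨fun j => w (0 + j), 0, fun _ => rfl⟩

theorem complexity_add_le {q : ℕ} (w : ℕ → Fin q) (m n : ℕ) :
    complexity w (m + n) ≤ complexity w m * complexity w n := by
  unfold complexity
  rw [← Set.ncard_prod]
  refine Set.ncard_le_ncard_of_injOn
    (fun u => (fun j : Fin m => u (Fin.castAdd n j), fun j : Fin n => u (Fin.natAdd m j)))
    ?_ ?_ (Set.toFinite _)
  · rintro u ⟨i, hi⟩
    refine ⟨⟨i, fun j => ?_⟩, ⟨i + m, fun j => ?_⟩⟩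
    · simp [hi]
    · simp [hi, add_assoc]
  · intro u _ v _ huv
    simp only [Prod.mk.injEq] at huv
    funext j
    refine Fin.addCases (fun k => ?_) (fun k => ?_) j
    · exact congrFun huv.1 k
    · exact congrFun huv.2 k

theorem entropy_tendsto {q : ℕ} (w : ℕ → Fin q) :
    Tendsto (fun n : ℕ => Real.log (complexity w n) / n) atTop (𝓝 (entropy w)) := by
  have hs : Subadditive fun n : ℕ => Real.log (complexity w n) := by
    intro m n
    have hm : (complexity w m : ℝ) ≠ 0 := by exact_mod_cast (complexity_pos w m).ne'
    have hn : (complexity w n : ℝ) ≠ 0 := by exact_mod_cast (complexity_pos w n).ne'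
    rw [← Real.log_mul hm hn]
    refine Real.log_le_log (by exact_mod_cast complexity_pos w (m + n)) ?_
    exact_mod_cast complexity_add_le w m n
  refine tendsto_nhds_limUnder ⟨hs.lim, hs.tendsto_lim ⟨0, ?_⟩⟩
  rintro _ ⟨n, rfl⟩
  exact div_nonneg (Real.log_natCast_nonneg _) n.cast_nonneg

/-- `W(f)`: the infinite words over `{0,…,q-1}` whose complexity function is bounded by `f`. -/
def wordsBelow (q : ℕ) (f : ℕ → ℝ) : Set (ℕ → Fin q) :=
  {w | ∀ n, (complexity w n : ℝ) ≤ f n}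

/-- The word entropy `E_W(f) = sup {E(w) : w ∈ W(f)}`. -/
def wordEntropy (q : ℕ) (f : ℕ → ℝ) : ℝ := sSup (entropy '' wordsBelow q f)

/-- The lower exponential growth rate `E_0(f) = liminf (1/n) log f(n)`. -/
def growthRate (f : ℕ → ℝ) : ℝ := liminf (fun n : ℕ => Real.log (f n) / n) atTop

/-- The conditions `(C*)`. -/
structure CStar (f : ℕ → ℝ) : Prop where
  lt_succ : ∀ n, f n < f (n + 1)
  succ_le : ∀ n : ℕ, (n : ℝ) + 1 ≤ f n
  add_le : ∀ n n', f (n + n') ≤ f n * f n'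

/-! ### The parameters; `E` stands for the value `E_0(f)` -/

/-- `δ = E ε / (105 (4 + 2 E))`. -/
def delta (ε E : ℝ) : ℝ := E * ε / (105 * (4 + 2 * E))

/-- `K = ⌈δ⁻¹⌉ + 1`. -/
def K (ε E : ℝ) : ℕ := ⌈(delta ε E)⁻¹⌉₊ + 1

/-- The lengths `n_0, n_1, n_2, …` with
`n_{t+1} = exp (K ((1 + δ)² E n_t + E))`, rounded up to an integer. -/
def scale (ε E : ℝ) (n₀ : ℕ) : ℕ → ℕ
  | 0 => n₀
  | t + 1 => ⌈Real.exp (K ε E * ((1 + delta ε E) ^ 2 * E * scale ε E n₀ t + E))⌉₊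

/-- `N = n_K`. -/
def horizon (ε E : ℝ) (n₀ : ℕ) : ℕ := scale ε E n₀ (K ε E)

/-- The conditions on the starting length `n_0`. -/
structure Admissible (f : ℕ → ℝ) (ε : ℝ) (n₀ : ℕ) : Prop where
  K_le : K ε (growthRate f) ≤ n₀
  bound_le : 4 * (K ε (growthRate f) : ℝ) ^ 2 / (420 ^ 3 * growthRate f) ≤ n₀
  log_lt : ∀ n ∈ Set.Icc n₀ (2 * n₀ - 1),
    Real.log (f n) / n < (1 + delta ε (growthRate f) / 2) * growthRate f

/-! ### The optimization problem -/

/-- `L_n(Y)`: the factors of length `n` of the words of a set `Y` of words of length `N`. -/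
def blockFactors {q N : ℕ} (Y : Set (Fin N → Fin q)) (n : ℕ) : Set (Fin n → Fin q) :=
  {u | ∃ y ∈ Y, ∃ (i : ℕ) (h : i + n ≤ N), ∀ j : Fin n, u j = y ⟨i + j, by omega⟩}

/-- `(log q_n(Y)) / n`, where `q_n(Y) = |L_n(Y)|`. -/
def rate {q N : ℕ} (Y : Set (Fin N → Fin q)) (n : ℕ) : ℝ :=
  Real.log ((blockFactors Y n).ncard) / n

/-- The competing sets `Y ⊆ A^N`: `|L_n(Y)| ≤ f(n)` for `1 ≤ n ≤ N`. The empty set, for which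
`log |L_n(Y)|` has no meaning, is left out. -/
def Feasible {q N : ℕ} (f : ℕ → ℝ) (Y : Set (Fin N → Fin q)) : Prop :=
  Y.Nonempty ∧ ∀ n ∈ Set.Icc 1 N, ((blockFactors Y n).ncard : ℝ) ≤ f n

/-- `min_{1 ≤ n ≤ N} (log q_n(Y)) / n`. -/
def minRate {q N : ℕ} (Y : Set (Fin N → Fin q)) : ℝ := sInf (rate Y '' Set.Icc 1 N)

/-- `Y` maximizes `min_{1 ≤ n ≤ N} (log q_n(Y)) / n` among the competing sets. -/
def Optimal {q N : ℕ} (f : ℕ → ℝ) (Y : Set (Fin N → Fin q)) : Prop :=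
  Feasible f Y ∧ ∀ Y' : Set (Fin N → Fin q), Feasible f Y' → minRate Y' ≤ minRate Y

/-- `r < K` is a suitable index for `Y`:
`(log q_{n_r}) / n_r < (1 + δ) (log q_{n_{r+1}}) / n_{r+1}`. -/
def Suitable {q N : ℕ} (ε E : ℝ) (n₀ : ℕ) (Y : Set (Fin N → Fin q)) (r : ℕ) : Prop :=
  r < K ε E ∧
    rate Y (scale ε E n₀ r) < (1 + delta ε E) * rate Y (scale ε E n₀ (r + 1))

/-! ### Algorithms on natural numbers, real numbers and lists -/

/-- The functions computed by a (terminating) program in exact real arithmetic. The basic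
instructions are pairing, zero and successor on `ℕ`, `nil` and `cons` on lists, the arithmetic
operations, `exp` and `log` on `ℝ`, the coercion `ℕ → ℝ`, the rounding `ℝ → ℕ`, and branching on a
comparison `<` of two real numbers; programs are combined by composition, by loops over a natural
number and by loops over a list. In particular all natural number constants are available, but no
other real constants than those obtained from them. -/
inductive ExactComputable : {α β : Type} → (α → β) → Prop
  | id {α : Type} : ExactComputable fun a : α => a
  | comp {α β γ : Type} {g : β → γ} {f : α → β} :
      ExactComputable g → ExactComputable f → ExactComputable fun a => g (f a)
  | fst {α β : Type} : ExactComputable fun p : α × β => p.1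
  | snd {α β : Type} : ExactComputable fun p : α × β => p.2
  | pair {α β γ : Type} {f : α → β} {g : α → γ} :
      ExactComputable f → ExactComputable g → ExactComputable fun a => (f a, g a)
  | zero {α : Type} : ExactComputable fun _ : α => (0 : ℕ)
  | succ : ExactComputable fun n : ℕ => n + 1
  | natLoop {α β : Type} {f : α → β} {g : α × ℕ × β → β} :
      ExactComputable f → ExactComputable g →
      ExactComputable fun p : α × ℕ =>
        Nat.rec (motive := fun _ => β) (f p.1) (fun n b => g (p.1, n, b)) p.2
  | nil {α β : Type} : ExactComputable fun _ : α => ([] : List β)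
  | cons {β : Type} : ExactComputable fun p : β × List β => p.1 :: p.2
  | listLoop {α β γ : Type} {f : α → β} {g : α × γ × β → β} :
      ExactComputable f → ExactComputable g →
      ExactComputable fun p : α × List γ => p.2.foldr (fun c b => g (p.1, c, b)) (f p.1)
  | natCast : ExactComputable fun n : ℕ => (n : ℝ)
  | ceil : ExactComputable fun x : ℝ => ⌈x⌉₊
  | add : ExactComputable fun p : ℝ × ℝ => p.1 + p.2
  | sub : ExactComputable fun p : ℝ × ℝ => p.1 - p.2
  | mul : ExactComputable fun p : ℝ × ℝ => p.1 * p.2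
  | div : ExactComputable fun p : ℝ × ℝ => p.1 / p.2
  | exp : ExactComputable Real.exp
  | log : ExactComputable Real.log
  | ifLt {α β : Type} {x y : α → ℝ} {f g : α → β} :
      ExactComputable x → ExactComputable y → ExactComputable f → ExactComputable g →
      ExactComputable fun a => if x a < y a then f a else g a

end WordEntropy

end

/-! The upper bound is soft. For `w` in `W(f)` the factors of length `N` form a competing set, and
by subadditivity of `log p_w` all its rates are at least `E(w)`. So `E(w)` is at most the optimal
minimum, hence at most every rate of an optimal `Y` (`Optimal.wordEntropy_le`).

For the lower bound the finite set `Y` has to be turned into an infinite word. Suppose `E_0 < log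
q`. Some competing set has minimal rate at least `E_0/2` (`exists_feasible_half`), so the rates of
`Y` at `n_0, …, n_K` lie between `E_0/2` and `(1 + δ/2) E_0`; as `(1 + δ)^K ≥ e`, they cannot drop
`K` times by a factor `1 + δ`, and a suitable `r` exists. With `n = n_r`, `M = n_{r+1}` and `Λ` the
language of factors of `Y`, there are at most about `exp (h t)` words of every length `t ≤ M`, and
at length `M`, which is exponentially larger than `n`, nearly that many.

Then some `u` of length `ℓ = (K - 10) n` has more than `exp ((1 - 3δ) h T)` first returns of one
length `T` (`Source.exists_firstReturns`). Otherwise a renewal argument (`returns_le_exp`) bounds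
all returns to each `u` by `exp ((1 - 2δ) h i)`, and cutting words at the last occurrence of their
initial factor (`coveredBy_le_exp`) transfers this bound to all words of length `M`; the error
factor is harmless because the number of words of length `ℓ` is small against `M`. This contradicts
the choice of `r`.

First returns to `u` can be concatenated freely. Once their first and last `R` letters are fixed,
the words of length `m ≤ R` created across a junction are no more numerous than the words of `Λ`
with `u` strictly inside, and the latter do not occur within a single return
(`LoopFamily.ncard_range_seg_le`). So the complexity stays below `f` up to `R`. Beyond `R` it
suffices to be a little below `exp (E_0 R)` at `R`, because `f(m) ≥ exp (E_0 m)` and complexity is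
submultiplicative; this is achieved by drawing the aligned blocks of length `d` from a random subset
(`exists_block_selection`). All losses are multiples of `δ`, and `δ` is chosen so that they add up
to at most `ε h` (`Regime.total_cost`, `Source.exists_word`).

If `E_0 ≥ log q`, then `f(n) ≥ q^n` and every quantity equals `log q`. The algorithm codes the
subsets of `A^N` by natural numbers and searches through all of them (`approximation_spec`). -/

open Filter Topology

noncomputable section

namespace WordEntropy

/-! ### Counting the words of a language through returns to a word -/

section Languages

variable {A : Type*}

/-- The words of length `n` of a language. -/
def level (Λ : Set (List A)) (n : ℕ) : Set (List A) := {v | v ∈ Λ ∧ v.length = n}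

/-- A language that contains every factor of each of its words. -/
def FactorClosed (Λ : Set (List A)) : Prop := ∀ ⦃u v⦄, v ∈ Λ → u <:+: v → u ∈ Λ

/-- The words that start and end with an occurrence of `u`, at distance `T`. -/
def returns (Λ : Set (List A)) (u : List A) (T : ℕ) : Set (List A) :=
  {v | v ∈ Λ ∧ v.length = T + u.length ∧ u <+: v ∧ u <+: v.drop T}

/-- The words in which `u` occurs exactly at the start and, at distance `T`, at the end. -/
def firstReturns (Λ : Set (List A)) (u : List A) (T : ℕ) : Set (List A) :=
  {v | v ∈ returns Λ u T ∧ ∀ i, 0 < i → i < T → ¬ u <+: v.drop i}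

/-- The words of length `t + ℓ` all of whose factors of length `ℓ` are in `U`. -/
def coveredBy (Λ : Set (List A)) (ℓ : ℕ) (U : Finset (List A)) (t : ℕ) : Set (List A) :=
  {v | v ∈ Λ ∧ v.length = t + ℓ ∧ ∀ i ≤ t, (v.drop i).take ℓ ∈ U}

theorem drop_take_infix (v : List A) (i n : ℕ) : (v.drop i).take n <:+: v :=
  (List.take_prefix _ _).isInfix.trans (List.drop_suffix _ _).isInfix

theorem take_eq_of_prefix {u v : List A} (h : u <+: v) {i : ℕ} (hi : i ≤ u.length) :
    v.take i = u.take i := by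
  obtain ⟨t, rfl⟩ := h
  rw [List.take_append_of_le_length hi]

theorem eq_of_prefix_of_length {u v : List A} (h : u <+: v) (hl : v.length ≤ u.length) :
    v = u := (h.eq_of_length_le hl).symm

theorem prefix_iff_take {u v : List A} : u <+: v ↔ v.take u.length = u := by
  rw [List.prefix_iff_eq_take, eq_comm]

/-- The two occurrences of `u` overlap or touch, so together they prescribe every letter. -/
theorem returns_ncard_le_one (Λ : Set (List A)) (u : List A) {T : ℕ} (hT : T ≤ u.length) :
    (returns Λ u T).ncard ≤ 1 := by
  have : returns Λ u T ⊆ {u.take T ++ u} := by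
    rintro v ⟨_, hl, h0, h1⟩
    have h2 : v.drop T = u := eq_of_prefix_of_length h1 (by simp [hl])
    rw [Set.mem_singleton_iff, ← take_eq_of_prefix h0 hT, ← h2]
    simp
  exact (Set.ncard_le_ncard this).trans (by simp)

variable [Finite A]

theorem finite_of_length {S : Set (List A)} (n : ℕ) (h : ∀ v ∈ S, v.length = n) : S.Finite :=
  (List.finite_length_eq A n).subset h

theorem level_finite (Λ : Set (List A)) (n : ℕ) : (level Λ n).Finite :=
  finite_of_length n fun _ h => h.2

theorem returns_finite (Λ : Set (List A)) (u : List A) (T : ℕ) : (returns Λ u T).Finite :=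
  finite_of_length _ fun _ h => h.2.1

theorem firstReturns_finite (Λ : Set (List A)) (u : List A) (T : ℕ) :
    (firstReturns Λ u T).Finite :=
  finite_of_length _ fun _ h => h.1.2.1

theorem level_add_le {Λ : Set (List A)} (hΛ : FactorClosed Λ) (a b : ℕ) :
    (level Λ (a + b)).ncard ≤ (level Λ a).ncard * (level Λ b).ncard := by
  rw [← Set.ncard_prod]
  refine Set.ncard_le_ncard_of_injOn (fun v => (v.take a, v.drop a)) ?_ ?_
    ((level_finite _ _).prod (level_finite _ _))
  · rintro v ⟨hv, hl⟩
    refine ⟨⟨hΛ hv (List.take_prefix _ _).isInfix, by simp [hl]⟩,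
      ⟨hΛ hv (List.drop_suffix _ _).isInfix, by simp [hl]⟩⟩
  · intro v _ w _ h
    simp only [Prod.mk.injEq] at h
    rw [← List.take_append_drop a v, ← List.take_append_drop a w, h.1, h.2]

theorem returns_ncard_le_level {Λ : Set (List A)} (hΛ : FactorClosed Λ) (u : List A) {T : ℕ}
    (hT : u.length ≤ T) : (returns Λ u T).ncard ≤ (level Λ (T - u.length)).ncard := by
  refine Set.ncard_le_ncard_of_injOn (fun v => (v.drop u.length).take (T - u.length)) ?_ ?_
    (level_finite _ _)
  · rintro v ⟨hv, hl, -, -⟩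
    exact ⟨hΛ hv (drop_take_infix _ _ _), by simp [hl]⟩
  · rintro v ⟨_, hl, h0, h1⟩ w ⟨_, hl', h0', h1'⟩ h
    have key : ∀ v : List A, v.length = T + u.length → u <+: v → u <+: v.drop T →
        v = u ++ ((v.drop u.length).take (T - u.length) ++ u) := by
      intro v hl h0 h1
      have h2 : v.drop T = u := eq_of_prefix_of_length h1 (by simp [hl])
      have h3 : v.take u.length = u := prefix_iff_take.1 h0
      have h4 : (v.drop u.length).drop (T - u.length) = u := by
        rw [List.drop_drop, Nat.add_sub_cancel' hT, h2]
      conv_lhs => rw [← List.take_append_drop u.length v, h3,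
        ← List.take_append_drop (T - u.length) (v.drop u.length), h4]
    rw [key v hl h0 h1, key w hl' h0' h1']
    simp only at h
    rw [h]

/-- Cut at the last occurrence `a` of `u` before position `ℓ` and at the first occurrence `b` from
`ℓ` on. Between them lies a first return, after `b` a return, and the first `a < ℓ` letters are
those of `u`. Since every cut advances by `b ≥ ℓ`, the factor `ℓ` for the choice of `a` is paid only
once per `ℓ` letters, even if `u` overlaps itself. -/
theorem returns_split {Λ : Set (List A)} (hΛ : FactorClosed Λ) {u : List A}
    (hu : 0 < u.length) {i : ℕ} (hi : u.length ≤ i) :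
    (returns Λ u i).ncard ≤ ∑ a ∈ Finset.range u.length, ∑ b ∈ Finset.Icc u.length i,
      (firstReturns Λ u (b - a)).ncard * (returns Λ u (i - b)).ncard := by
  classical
  set ℓ := u.length with hℓ
  let piece : ℕ × ℕ → Set (List A) := fun p => {v | v ∈ returns Λ u i ∧ u <+: v.drop p.1 ∧
    u <+: v.drop p.2 ∧ ∀ j, p.1 < j → j < p.2 → ¬ u <+: v.drop j}
  rw [← Finset.sum_product']
  have hsub : returns Λ u i ⊆ ⋃ p ∈ Finset.range ℓ ×ˢ Finset.Icc ℓ i, piece p := by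
    intro v hv
    have hex : ∃ b, ℓ ≤ b ∧ u <+: v.drop b := ⟨i, hi, hv.2.2.2⟩
    have h0 : u <+: v.drop 0 := by simpa using hv.2.2.1
    refine Set.mem_iUnion₂.2 ⟨(Nat.findGreatest (fun j => u <+: v.drop j) (ℓ - 1), Nat.find hex),
      ?_, hv, ?_, (Nat.find_spec hex).2, ?_⟩
    · simp only [Finset.mem_product, Finset.mem_range, Finset.mem_Icc]
      refine ⟨?_, (Nat.find_spec hex).1, Nat.find_min' hex ⟨hi, hv.2.2.2⟩⟩
      have := Nat.findGreatest_le (P := fun j => u <+: v.drop j) (ℓ - 1)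
      omega
    · exact Nat.findGreatest_spec (P := fun j => u <+: v.drop j) (Nat.zero_le _) h0
    · intro j hj hj' hju
      rcases lt_or_ge j ℓ with h | h
      · exact Nat.findGreatest_is_greatest hj (by omega) hju
      · exact Nat.find_min hex hj' ⟨h, hju⟩
  refine (Set.ncard_le_ncard hsub ?_).trans ((Finset.set_ncard_biUnion_le _ _).trans
    (Finset.sum_le_sum fun p hp => ?_))
  · refine Set.Finite.biUnion (Finset.finite_toSet _) fun p _ => (returns_finite Λ u i).subset ?_
    exact fun v hv => hv.1
  · obtain ⟨a, b⟩ := p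
    simp only [Finset.mem_product, Finset.mem_range, Finset.mem_Icc] at hp
    obtain ⟨ha, hb, hbi⟩ := hp
    rw [← Set.ncard_prod]
    refine Set.ncard_le_ncard_of_injOn (fun v => ((v.drop a).take (b - a + ℓ), v.drop b)) ?_ ?_
      ((firstReturns_finite _ _ _).prod (returns_finite _ _ _))
    · rintro v ⟨⟨hv, hl, h0, h1⟩, hua, hub, hno⟩
      have hdd : ∀ j, ((v.drop a).take (b - a + ℓ)).drop j
          = (v.drop (a + j)).take (b - a + ℓ - j) := by
        intro j; rw [List.drop_take, List.drop_drop]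
      refine ⟨⟨⟨hΛ hv (drop_take_infix _ _ _), ?_, ?_, ?_⟩, ?_⟩,
        ⟨hΛ hv (List.drop_suffix _ _).isInfix, ?_, hub, ?_⟩⟩
      · simp [hl]; omega
      · exact List.prefix_take_iff.2 ⟨hua, by omega⟩
      · rw [hdd, List.prefix_take_iff]
        refine ⟨?_, by omega⟩
        rwa [show a + (b - a) = b by omega]
      · intro j hj hj' hp
        rw [hdd, List.prefix_take_iff] at hp
        exact hno _ (by simp; omega) (by simp; omega) hp.1
      · simp [hl]; omega
      · rw [List.drop_drop]
        rwa [show b + (i - b) = i by omega]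
    · rintro v ⟨⟨_, hl, h0, h1⟩, -, -, -⟩ w ⟨⟨_, hl', h0', h1'⟩, -, -, -⟩ h
      simp only [Prod.mk.injEq] at h
      have key : ∀ v : List A, u <+: v →
          v = u.take a ++ (((v.drop a).take (b - a + ℓ)).take (b - a) ++ v.drop b) := by
        intro v h0
        rw [List.take_take, min_eq_left (by omega), ← take_eq_of_prefix h0 ha.le]
        conv_lhs => rw [← List.take_append_drop a v, ← List.take_append_drop (b - a) (v.drop a),
          List.drop_drop, show a + (b - a) = b by omega]
      rw [key v h0, key w h0', h.1, h.2]

/-- If the first returns to `u` are few, measured by the weights `exp (-H T)`, then so are all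
returns to `u`. -/
theorem returns_le_exp {Λ : Set (List A)} (hΛ : FactorClosed Λ) {u : List A}
    (hu : 0 < u.length) {H : ℝ} (hH : 0 ≤ H) {M : ℕ} {g : ℕ → ℝ}
    (hg : ∀ T ≤ M, ((firstReturns Λ u T).ncard : ℝ) ≤ g T)
    (hsum : ∑ a ∈ Finset.range u.length, ∑ b ∈ Finset.Icc u.length M,
      g (b - a) * Real.exp (-(H * b)) ≤ 1) {i : ℕ} (hi : i ≤ M) :
    ((returns Λ u i).ncard : ℝ) ≤ Real.exp (H * i) := by
  have hg0 : ∀ T ≤ M, 0 ≤ g T := fun T hT => (Nat.cast_nonneg _).trans (hg T hT)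
  induction i using Nat.strong_induction_on with
  | _ i ih =>
    rcases le_total i u.length with h | h
    · have h1 : ((returns Λ u i).ncard : ℝ) ≤ 1 := by
        exact_mod_cast returns_ncard_le_one Λ u h
      exact h1.trans (Real.one_le_exp (by positivity))
    · have h1 : ((returns Λ u i).ncard : ℝ) ≤ ∑ a ∈ Finset.range u.length,
          ∑ b ∈ Finset.Icc u.length i,
            ((firstReturns Λ u (b - a)).ncard : ℝ) * ((returns Λ u (i - b)).ncard : ℝ) := by
        exact_mod_cast returns_split hΛ hu h
      refine h1.trans ?_
      have h2 : ∀ a ∈ Finset.range u.length, ∑ b ∈ Finset.Icc u.length i,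
            ((firstReturns Λ u (b - a)).ncard : ℝ) * ((returns Λ u (i - b)).ncard : ℝ)
          ≤ ∑ b ∈ Finset.Icc u.length M,
            (g (b - a) * Real.exp (-(H * b))) * Real.exp (H * i) := by
        intro a _
        calc _ ≤ ∑ b ∈ Finset.Icc u.length i,
              (g (b - a) * Real.exp (-(H * b))) * Real.exp (H * i) := by
              refine Finset.sum_le_sum fun b hb => ?_
              rw [Finset.mem_Icc] at hb
              rw [mul_assoc, ← Real.exp_add]
              refine mul_le_mul (hg _ (by omega)) ?_ (by positivity) (hg0 _ (by omega))
              refine (ih (i - b) (by omega) (by omega)).trans (le_of_eq ?_)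
              rw [Nat.cast_sub hb.2]
              ring_nf
          _ ≤ _ := by
              refine Finset.sum_le_sum_of_subset_of_nonneg
                (Finset.Icc_subset_Icc_right hi) fun b hb _ => ?_
              rw [Finset.mem_Icc] at hb
              have := hg0 (b - a) (by omega)
              positivity
      refine (Finset.sum_le_sum h2).trans ?_
      simp_rw [← Finset.sum_mul]
      exact mul_le_of_le_one_left (Real.exp_pos _).le hsum

/-- Let `u` be the initial factor of length `ℓ` and cut at its last occurrence `i`. Up to there the
word is a return to `u`; from position `i + 1` on, `u` does not occur any more, so the rest is
covered by `U.erase u`. The recursion has depth at most `U.card`. -/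
theorem coveredBy_split {Λ : Set (List A)} (hΛ : FactorClosed Λ) {ℓ : ℕ} (U : Finset (List A))
    [DecidableEq A] (hU : ∀ u ∈ U, u.length = ℓ) (t : ℕ) :
    (coveredBy Λ ℓ U t).ncard ≤ ∑ u ∈ U, ((returns Λ u t).ncard + ∑ i ∈ Finset.range t,
      (returns Λ u i).ncard * (coveredBy Λ ℓ (U.erase u) (t - i - 1)).ncard) := by
  classical
  have hfin : ∀ U t, (coveredBy Λ ℓ U t).Finite := fun U t =>
    finite_of_length _ fun v hv => hv.2.1
  let piece : List A → ℕ → Set (List A) := fun u i => {v | v ∈ coveredBy Λ ℓ U t ∧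
    u <+: v ∧ u <+: v.drop i ∧ ∀ j, i < j → j ≤ t → ¬ u <+: v.drop j}
  have hsub : coveredBy Λ ℓ U t ⊆ ⋃ u ∈ U, (returns Λ u t ∪ ⋃ i ∈ Finset.range t, piece u i) := by
    intro v hv
    have hu : v.take ℓ ∈ U := by simpa using hv.2.2 0 (Nat.zero_le _)
    have hlen : (v.take ℓ).length = ℓ := hU _ hu
    have h0 : v.take ℓ <+: v.drop 0 := by simpa using List.take_prefix _ _
    have hs := Nat.findGreatest_spec (P := fun j => v.take ℓ <+: v.drop j) (Nat.zero_le t) h0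
    have hle := Nat.findGreatest_le (P := fun j => v.take ℓ <+: v.drop j) t
    have hgr := fun k => Nat.findGreatest_is_greatest (P := fun j => v.take ℓ <+: v.drop j)
      (n := t) (k := k)
    set i := Nat.findGreatest (fun j => v.take ℓ <+: v.drop j) t
    refine Set.mem_iUnion₂.2 ⟨v.take ℓ, hu, ?_⟩
    rcases hle.lt_or_eq with h | h
    · right
      exact Set.mem_iUnion₂.2 ⟨i, by simpa using h, hv, List.take_prefix _ _, hs,
        fun j hj hj' => hgr j hj hj'⟩
    · left
      refine ⟨hv.1, by rw [hlen]; exact hv.2.1, List.take_prefix _ _, h ▸ hs⟩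
  have hpf : ∀ u i, (piece u i).Finite := fun u i => (hfin U t).subset fun v hv => hv.1
  refine (Set.ncard_le_ncard hsub ?_).trans ((Finset.set_ncard_biUnion_le _ _).trans
    (Finset.sum_le_sum fun u hu => (Set.ncard_union_le _ _).trans (Nat.add_le_add_left
      ((Finset.set_ncard_biUnion_le _ _).trans (Finset.sum_le_sum fun i hi => ?_)) _)))
  · exact Set.Finite.biUnion (Finset.finite_toSet _) fun u _ => (returns_finite Λ u t).union
      (Set.Finite.biUnion (Finset.finite_toSet _) fun i _ => hpf u i)
  · rw [Finset.mem_range] at hi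
    have hul := hU u hu
    rw [← Set.ncard_prod]
    refine Set.ncard_le_ncard_of_injOn (fun v => (v.take (i + ℓ), v.drop (i + 1))) ?_ ?_
      ((returns_finite _ _ _).prod (hfin _ _))
    · rintro v ⟨⟨hv, hl, hc⟩, h0, hi', hno⟩
      refine ⟨⟨hΛ hv (List.take_prefix _ _).isInfix, ?_, ?_, ?_⟩,
        ⟨hΛ hv (List.drop_suffix _ _).isInfix, ?_, ?_⟩⟩
      · simp [hl, hul]; omega
      · exact List.prefix_take_iff.2 ⟨h0, by omega⟩
      · rw [List.drop_take]
        exact List.prefix_take_iff.2 ⟨hi', by omega⟩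
      · simp [hl]; omega
      · intro j hj
        rw [List.drop_drop, Finset.mem_erase]
        refine ⟨fun h => hno (i + 1 + j) (by omega) (by omega) ?_, hc _ (by omega)⟩
        rw [← h]
        exact List.take_prefix _ _
    · intro v hv w hw h
      simp only [Prod.mk.injEq] at h
      have hl := hv.1.2.1
      have hl' := hw.1.2.1
      -- For `ℓ = 0` the empty word occurs everywhere and there is no last occurrence before `t`.
      -- For `ℓ ≥ 1` the two pieces cover the whole word.
      rcases Nat.eq_zero_or_pos ℓ with h0 | h0
      · exact absurd (by rw [List.length_eq_zero_iff.1 (hul.trans h0)]; exact List.nil_prefix)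
          (hv.2.2.2 t hi le_rfl)
      have key : ∀ v : List A, v = (v.take (i + ℓ)).take (i + 1) ++ v.drop (i + 1) := by
        intro v
        rw [List.take_take, min_eq_left (by omega), List.take_append_drop]
      rw [key v, key w, h.1, h.2]

/-- A language with few returns to each of its words of length `ℓ` is small. -/
theorem coveredBy_le_exp {Λ : Set (List A)} (hΛ : FactorClosed Λ) {ℓ : ℕ} {H : ℝ} (hH : 0 ≤ H)
    {M C : ℕ} (hret : ∀ u, u.length = ℓ → ∀ i ≤ M, ((returns Λ u i).ncard : ℝ) ≤ Real.exp (H * i))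
    (U : Finset (List A)) (hU : ∀ u ∈ U, u.length = ℓ) (hC : U.card ≤ C) {t : ℕ} (ht : t ≤ M) :
    ((coveredBy Λ ℓ U t).ncard : ℝ) ≤ (C * (t + 1)) ^ U.card * Real.exp (H * t) := by
  classical
  generalize hk : U.card = k
  induction k generalizing U t with
  | zero =>
    rw [Finset.card_eq_zero] at hk
    subst hk
    have : coveredBy Λ ℓ (∅ : Finset (List A)) t = ∅ := by
      ext v
      simp only [coveredBy, Set.mem_ofPred_eq, Set.mem_empty_iff_false, iff_false]
      rintro ⟨-, -, h⟩
      exact Finset.notMem_empty _ (h 0 (Nat.zero_le _))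
    rw [this]
    simp only [Set.ncard_empty, Nat.cast_zero, pow_zero, one_mul]
    positivity
  | succ k ih =>
    have hC1 : (1 : ℝ) ≤ C := by exact_mod_cast (show 1 ≤ C by omega)
    have h1 : ((coveredBy Λ ℓ U t).ncard : ℝ) ≤ ∑ u ∈ U, (((returns Λ u t).ncard : ℝ) +
        ∑ i ∈ Finset.range t, ((returns Λ u i).ncard : ℝ) *
          ((coveredBy Λ ℓ (U.erase u) (t - i - 1)).ncard : ℝ)) := by
      exact_mod_cast coveredBy_split hΛ U hU t
    refine h1.trans ?_
    -- `B` bounds each term for a fixed `u`: at most `t + 1` positions of the cut and at most `C`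
    -- choices of `u` yield one more factor `C * (t + 1)`. Keeping `C` fixed while `U` shrinks makes
    -- the induction uniform.
    set B : ℝ := (C * (t + 1)) ^ k * Real.exp (H * t) with hB
    have hbase : (1 : ℝ) ≤ C * (t + 1) := one_le_mul_of_one_le_of_one_le hC1 (by simp)
    have h2 : ∀ u ∈ U, (((returns Λ u t).ncard : ℝ) +
        ∑ i ∈ Finset.range t, ((returns Λ u i).ncard : ℝ) *
          ((coveredBy Λ ℓ (U.erase u) (t - i - 1)).ncard : ℝ)) ≤ (t + 1) * B := by
      intro u hu
      have h3 : ((returns Λ u t).ncard : ℝ) ≤ B :=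
        (hret u (hU u hu) t ht).trans (le_mul_of_one_le_left (Real.exp_pos _).le
          (one_le_pow₀ hbase))
      have h4 : ∀ i ∈ Finset.range t, ((returns Λ u i).ncard : ℝ) *
          ((coveredBy Λ ℓ (U.erase u) (t - i - 1)).ncard : ℝ) ≤ B := by
        intro i hi
        rw [Finset.mem_range] at hi
        have h5 := ih (U.erase u) (fun v hv => hU v (Finset.mem_of_mem_erase hv))
          ((Finset.card_erase_le).trans hC) (t := t - i - 1) (by omega)
          (by rw [Finset.card_erase_of_mem hu]; omega)
        have h6 : ((t - i - 1 : ℕ) : ℝ) = t - i - 1 := by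
          rw [Nat.sub_sub, Nat.cast_sub (by omega)]; push_cast; ring
        have hit : (i : ℝ) + 1 ≤ t := by exact_mod_cast hi
        calc _ ≤ Real.exp (H * i) * ((C * (((t - i - 1 : ℕ) : ℝ) + 1)) ^ k *
                Real.exp (H * (t - i - 1 : ℕ))) :=
              mul_le_mul (hret u (hU u hu) i (by omega)) h5 (by positivity) (by positivity)
          _ = (C * (((t - i - 1 : ℕ) : ℝ) + 1)) ^ k * Real.exp (H * i + H * (t - i - 1 : ℕ)) := by
              rw [Real.exp_add]; ring
          _ ≤ B := by
              have h7 : (0 : ℝ) ≤ C * (t - i - 1 + 1) := mul_nonneg (by linarith) (by linarith)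
              have h8 : H * i + H * (t - i - 1) ≤ H * t := by
                have : H * i + H * (t - i - 1) = H * t - H := by ring
                linarith
              have h9 : (t : ℝ) - i - 1 + 1 ≤ t + 1 := by
                have : (0 : ℝ) ≤ i := Nat.cast_nonneg i
                linarith
              rw [h6, hB]
              gcongr
      calc _ ≤ B + ∑ i ∈ Finset.range t, B := add_le_add h3 (Finset.sum_le_sum h4)
        _ = (t + 1) * B := by simp; ring
    calc _ ≤ ∑ u ∈ U, ((t + 1) * B) := Finset.sum_le_sum h2
      _ = U.card * ((t + 1) * B) := by simp
      _ ≤ C * ((t + 1) * B) := by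
          have : (U.card : ℝ) ≤ C := by exact_mod_cast hC
          have hB0 : 0 ≤ B := by positivity
          gcongr
      _ = _ := by rw [hB]; ring

/-- All words are covered by the set of all words of length `ℓ`. The number of these appears as an
exponent of `M + 1`, which is why the scales have to grow exponentially. -/
theorem level_le_exp {Λ : Set (List A)} (hΛ : FactorClosed Λ) {ℓ : ℕ} {H : ℝ} (hH : 0 ≤ H)
    {M : ℕ} (hret : ∀ u, u.length = ℓ → ∀ i ≤ M, ((returns Λ u i).ncard : ℝ) ≤ Real.exp (H * i)) :
    ((level Λ (M + ℓ)).ncard : ℝ) ≤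
      ((level Λ ℓ).ncard * (M + 1)) ^ (level Λ ℓ).ncard * Real.exp (H * M) := by
  have hf := level_finite Λ ℓ
  have hc : hf.toFinset.card = (level Λ ℓ).ncard := (Set.ncard_eq_toFinset_card _ hf).symm
  have h := coveredBy_le_exp hΛ hH hret hf.toFinset (fun u hu => ((hf.mem_toFinset).1 hu).2)
    le_rfl (le_refl M)
  rw [hc] at h
  refine le_trans ?_ h
  refine Nat.cast_le.2 (Set.ncard_le_ncard ?_ (finite_of_length _ fun v hv => hv.2.1))
  rintro v ⟨hv, hl⟩
  refine ⟨hv, hl, fun i hi => hf.mem_toFinset.2 ⟨hΛ hv (drop_take_infix _ _ _), ?_⟩⟩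
  simp [hl]; omega

end Languages

/-! ### Random subsets -/

/-- The ratio of the binomial coefficients is the product of `(s - i) / (Q - i)` over `i < c`, and
each factor is at least `(s / 2) / Q` because `i < b ≤ s / 2`. -/
theorem choose_mul_pow_le {Q s b : ℕ} (hsQ : s ≤ Q) (hb : 2 * b ≤ s) {c : ℕ} (hc : c ≤ b) :
    (Q.choose s : ℝ) * ((s : ℝ) / (2 * Q)) ^ c ≤ ((Q - c).choose (s - c) : ℕ) := by
  induction c with
  | zero => simp
  | succ c ih =>
    have hs : (0 : ℝ) < s := by exact_mod_cast (by omega : 0 < s)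
    have hQ : (0 : ℝ) < Q := by exact_mod_cast (by omega : 0 < Q)
    have h := Nat.add_one_mul_choose_eq (Q - (c + 1)) (s - (c + 1))
    rw [show Q - (c + 1) + 1 = Q - c by omega,
      show s - (c + 1) + 1 = s - c by omega] at h
    have h' : ((Q - c : ℕ) : ℝ) * ((Q - (c + 1)).choose (s - (c + 1)) : ℕ)
      = ((Q - c).choose (s - c) : ℕ) * ((s - c : ℕ) : ℝ) := by exact_mod_cast h
    have h1 : ((Q - c : ℕ) : ℝ) ≤ Q := by exact_mod_cast Nat.sub_le _ _
    have h2 : (s : ℝ) / 2 ≤ ((s - c : ℕ) : ℝ) := by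
      rw [div_le_iff₀ two_pos]; exact_mod_cast (by omega : s ≤ (s - c) * 2)
    have ih' := ih (by omega)
    set X : ℝ := (((Q - (c + 1)).choose (s - (c + 1)) : ℕ) : ℝ)
    set Z : ℝ := (((Q - c).choose (s - c) : ℕ) : ℝ)
    have hX : 0 ≤ X := Nat.cast_nonneg _
    have hZ : 0 ≤ Z := Nat.cast_nonneg _
    calc _ = (Q.choose s : ℝ) * ((s : ℝ) / (2 * Q)) ^ c * (s / (2 * Q)) := by ring
      _ ≤ Z * (s / (2 * Q)) := by gcongr
      _ = Z * (s / 2) / Q := by field_simp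
      _ ≤ X := by
        rw [div_le_iff₀ hQ]
        calc Z * (s / 2) ≤ Z * ((s - c : ℕ) : ℝ) := by gcongr
          _ = ((Q - c : ℕ) : ℝ) * X := h'.symm
          _ ≤ Q * X := by gcongr
          _ = X * Q := mul_comm _ _

theorem card_supersets {α : Type*} [DecidableEq α] {Ω B : Finset α} (hB : B ⊆ Ω) {s : ℕ}
    (hs : B.card ≤ s) :
    (Ω.card - B.card).choose (s - B.card) ≤
      ((Finset.powersetCard s Ω).filter (B ⊆ ·)).card := by
  rw [← Finset.card_sdiff_of_subset hB, ← Finset.card_powersetCard]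
  refine Finset.card_le_card_of_injOn (fun t => t ∪ B) ?_ ?_
  · intro t ht
    simp only [Finset.mem_coe, Finset.mem_powersetCard,
      Finset.mem_filter] at ht ⊢
    have hd : Disjoint t B := (Finset.disjoint_sdiff (s := B) (t := Ω)).symm.mono_left ht.1
    refine ⟨⟨Finset.union_subset (ht.1.trans Finset.sdiff_subset) hB, ?_⟩,
      Finset.subset_union_right⟩
    rw [Finset.card_union_of_disjoint hd, ht.2]
    omega
  · intro t ht t' ht' h
    simp only [Finset.mem_coe, Finset.mem_powersetCard] at ht ht' h
    have hd : ∀ r, r ⊆ Ω \ B → (r ∪ B) \ B = r := by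
      intro r hr
      rw [Finset.union_sdiff_right]
      exact Finset.sdiff_eq_self_of_disjoint ((Finset.disjoint_sdiff (s := B)).symm.mono_left hr)
    rw [← hd t ht.1, h, hd t' ht'.1]

/-- A random `s`-element subset of `Ω` contains a given subset with at most `b ≤ s / 2` elements
with probability at least `(s / (2 |Ω|)) ^ b`. -/
theorem exists_subset_selection {α β : Type*} [DecidableEq α] (Ω : Finset α) (S : Finset β)
    (B : β → Finset α) {b s : ℕ} (hB : ∀ v ∈ S, B v ⊆ Ω) (hBb : ∀ v ∈ S, (B v).card ≤ b)
    (hb : 2 * b ≤ s) (hs : s ≤ Ω.card) :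
    ∃ D ⊆ Ω, D.card = s ∧
      (S.card : ℝ) * ((s : ℝ) / (2 * Ω.card)) ^ b ≤ (S.filter fun v => B v ⊆ D).card := by
  have hne : (Finset.powersetCard s Ω).Nonempty := Finset.powersetCard_nonempty.2 hs
  -- First moment method: counting the pairs `(v, D)` with `B v ⊆ D` in both orders gives the
  -- average of the counts over all `D`, and some `D` reaches the average.
  have hdc : ∑ D ∈ Finset.powersetCard s Ω, (S.filter fun v => B v ⊆ D).card
      = ∑ v ∈ S, ((Finset.powersetCard s Ω).filter (B v ⊆ ·)).card := by
    simp only [Finset.card_filter]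
    exact Finset.sum_comm
  have hle : ∑ D ∈ Finset.powersetCard s Ω, (S.card : ℝ) * ((s : ℝ) / (2 * Ω.card)) ^ b
      ≤ ∑ D ∈ Finset.powersetCard s Ω, ((S.filter fun v => B v ⊆ D).card : ℝ) := by
    rw [← Nat.cast_sum, hdc, Nat.cast_sum, Finset.sum_const, Finset.card_powersetCard,
      nsmul_eq_mul]
    calc _ = ∑ v ∈ S, ((Ω.card.choose s : ℕ) : ℝ) * ((s : ℝ) / (2 * Ω.card)) ^ b := by
            simp; ring
      _ ≤ _ := by
        refine Finset.sum_le_sum fun v hv => ?_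
        have h1 := choose_mul_pow_le hs hb (hBb v hv)
        have h2 : (((Ω.card - (B v).card).choose (s - (B v).card) : ℕ) : ℝ) ≤
            ((Finset.powersetCard s Ω).filter (B v ⊆ ·)).card := by
          exact_mod_cast card_supersets (hB v hv) (by have := hBb v hv; omega)
        refine le_trans ?_ (h1.trans h2)
        have h3 : (s : ℝ) / (2 * Ω.card) ≤ 1 := by
          refine div_le_one_of_le₀ ?_ (by positivity)
          exact_mod_cast (by omega : s ≤ 2 * Ω.card)
        gcongr ?_ * ?_
        exact pow_le_pow_of_le_one (by positivity) h3 (hBb v hv)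
  obtain ⟨D, hD, h⟩ := Finset.exists_le_of_sum_le hne hle
  rw [Finset.mem_powersetCard] at hD
  exact ⟨D, hD.1, hD.2, h⟩

/-! ### Infinite concatenations -/

/-- A sequence in which every finite sequence appears. -/
theorem exists_universal (X : Type*) [Countable X] [Nonempty X] :
    ∃ σ : ℕ → X, ∀ l : List X, ∃ i, ∀ (j : ℕ) (hj : j < l.length), σ (i + j) = l[j] := by
  have := Encodable.ofCountable (List X)
  obtain ⟨x₀⟩ := ‹Nonempty X›
  -- The positions `k²`, `k² + 1`, …, `k² + 2k` spell out the list coded by the first component of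
  -- `k`. The second component serves only to have a `k` that is at least the length of the list.
  refine ⟨fun i => ((Encodable.decode (α := List X) (Nat.unpair (Nat.sqrt i)).1).getD []).getD
    (i - Nat.sqrt i * Nat.sqrt i) x₀, fun l => ?_⟩
  set k := Nat.pair (Encodable.encode l) l.length with hk
  refine ⟨k * k, fun j hj => ?_⟩
  have hlk : l.length ≤ k := Nat.right_le_pair _ _
  have hs : Nat.sqrt (k * k + j) = k := Nat.sqrt_add_eq k (by omega)
  have h1 : (Nat.unpair k).1 = Encodable.encode l := by simp [hk]
  simp only [hs, h1, Encodable.encodek, Nat.add_sub_cancel_left, Option.getD_some]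
  exact List.getD_eq_getElem _ _ hj

section Segments

variable {A : Type*}

/-- The factor of length `n` of the infinite word `w` that starts at position `i`. -/
def seg (w : ℕ → A) (i n : ℕ) : List A := (List.range' i n).map w

@[simp] theorem length_seg (w : ℕ → A) (i n : ℕ) : (seg w i n).length = n := by simp [seg]

theorem getElem_seg (w : ℕ → A) (i n j : ℕ) (h : j < (seg w i n).length) :
    (seg w i n)[j] = w (i + j) := by simp [seg]

theorem seg_add (w : ℕ → A) (i a b : ℕ) : seg w i (a + b) = seg w i a ++ seg w (i + a) b := by
  rw [seg, seg, seg, ← List.map_append, List.range'_append_1]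

theorem seg_take (w : ℕ → A) (i : ℕ) {k n : ℕ} (h : k ≤ n) :
    (seg w i n).take k = seg w i k := by
  obtain ⟨m, rfl⟩ := Nat.exists_eq_add_of_le h
  rw [seg_add, List.take_left' (length_seg _ _ _)]

theorem seg_drop (w : ℕ → A) (i : ℕ) {k n : ℕ} (h : k ≤ n) :
    (seg w i n).drop k = seg w (i + k) (n - k) := by
  obtain ⟨m, rfl⟩ := Nat.exists_eq_add_of_le h
  rw [seg_add, List.drop_left' (length_seg _ _ _), Nat.add_sub_cancel_left]

theorem complexity_eq_ncard_range {q : ℕ} (w : ℕ → Fin q) (n : ℕ) :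
    complexity w n = (Set.range fun i => seg w i n).ncard := by
  unfold complexity
  rw [← Set.InjOn.ncard_image (f := fun u : Fin n → Fin q => List.ofFn u)
    (List.ofFn_injective.injOn)]
  congr 1
  ext v
  constructor
  · rintro ⟨u, ⟨i, hi⟩, rfl⟩
    refine ⟨i, List.ext_getElem (by simp) fun j _ _ => ?_⟩
    simp [getElem_seg, hi]
  · rintro ⟨i, rfl⟩
    refine ⟨fun j => w (i + j), ⟨i, fun _ => rfl⟩, List.ext_getElem (by simp) fun j _ _ => ?_⟩
    simp [getElem_seg]

/-- The concatenation of all words of a sequence of words of length `T`. -/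
def concat [Inhabited A] (T : ℕ) (σ : ℕ → List A) (n : ℕ) : A := (σ (n / T)).getD (n % T) default

theorem seg_concat [Inhabited A] {T : ℕ} (hT : 0 < T) {σ : ℕ → List A}
    (hσ : ∀ k, (σ k).length = T) (k : ℕ) : seg (concat T σ) (k * T) T = σ k := by
  refine List.ext_getElem (by simp [hσ]) fun j h1 h2 => ?_
  rw [getElem_seg, concat]
  rw [length_seg] at h1
  have h3 : (k * T + j) / T = k := by
    rw [mul_comm, Nat.mul_add_div hT, Nat.div_eq_of_lt h1, add_zero]
  have h4 : (k * T + j) % T = j := by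
    rw [mul_comm, Nat.mul_add_mod, Nat.mod_eq_of_lt h1]
  rw [h3, h4, List.getD_eq_getElem _ _ h2]

/-- The words over blocks of length `T`: all finite concatenations of words of `S` are factors
of a suitable infinite concatenation. -/
theorem exists_concat_complexity {q : ℕ} [Inhabited (Fin q)] {T : ℕ} (hT : 0 < T)
    {S : Set (List (Fin q))} (hS : S.Nonempty) (hlen : ∀ v ∈ S, v.length = T) :
    ∃ σ : ℕ → List (Fin q), (∀ k, σ k ∈ S) ∧
      ∀ k, S.ncard ^ k ≤ complexity (concat T σ) (k * T) := by
  have : Nonempty S := hS.to_subtype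
  obtain ⟨σ, hσ⟩ := exists_universal S
  have hσl : ∀ k, ((σ k : S) : List (Fin q)).length = T := fun k => hlen _ (σ k).2
  refine ⟨fun k => σ k, fun k => (σ k).2, fun k => ?_⟩
  have hSf : S.Finite := finite_of_length T hlen
  have := hSf.to_subtype
  rw [complexity_eq_ncard_range]
  choose I hI using fun g : Fin k → S => hσ (List.ofFn g)
  have hcard : S.ncard ^ k = (Set.univ : Set (Fin k → S)).ncard := by
    rw [Set.ncard_univ, Nat.card_fun, Nat.card_fin]
    rfl
  rw [hcard]
  refine Set.ncard_le_ncard_of_injOn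
    (fun g => seg (concat T fun k => (σ k : List (Fin q))) (I g * T) (k * T)) ?_ ?_ ?_
  · intro g _; exact ⟨_, rfl⟩
  · intro g _ g' _ h
    funext j
    have key : ∀ g : Fin k → S, ((seg (concat T fun k => (σ k : List (Fin q))) (I g * T)
        (k * T)).drop (j * T)).take T = (g j : List (Fin q)) := by
      intro g
      have h1 : (j + 1) * T ≤ k * T := Nat.mul_le_mul_right _ j.2
      rw [add_mul, one_mul] at h1
      rw [seg_drop _ _ (by omega), seg_take _ _ (by omega), ← add_mul,
        seg_concat hT (σ := fun k => (σ k : List (Fin q))) hσl, hI g j (by simp)]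
      simp
    exact Subtype.ext (by rw [← key g, ← key g']; simp only at h; rw [h])
  · refine finite_of_length (k * T) ?_
    rintro _ ⟨i, rfl⟩
    simp

end Segments

/-- A set of words of length `T` that start with `u`, such that in each of them, followed by `u`,
there are no further occurrences of `u`. The words agree on the first and on the last `R`
letters. -/
structure LoopFamily {A : Type*} (Λ : Set (List A)) (u : List A) (T R : ℕ) (P Q : List A)
    (S : Set (List A)) : Prop where
  pos : 0 < u.length
  le_R : u.length ≤ R
  R_le : R ≤ T
  length_eq : ∀ v ∈ S, v.length = T
  mem : ∀ v ∈ S, v ++ u ∈ firstReturns Λ u T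
  take_eq : ∀ v ∈ S, v.take R = P
  drop_eq : ∀ v ∈ S, v.drop (T - R) = Q

/-! ### Infinite words glued from first returns -/

section Gluing

variable {A : Type*} {Λ : Set (List A)} {u P Q : List A} {T R : ℕ}
  {S : Set (List A)} {σ : ℕ → List A}

/-- The words of length `m` that overlap the junction of two words of a loop family. -/
def junctions (P Q : List A) (R m : ℕ) (I : Finset ℕ) : Set (List A) :=
  (fun j => Q.drop (R - j) ++ P.take (m - j)) '' (I : Set ℕ)

/-- The words of length `m` with an occurrence of `u` that is neither at the start nor at the
end. -/
def strictlyInside (Λ : Set (List A)) (u : List A) (m : ℕ) : Set (List A) :=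
  {x | x ∈ level Λ m ∧ ∃ i, 1 ≤ i ∧ i + u.length + 1 ≤ m ∧ u <+: x.drop i}

/-- The next word also starts with `u`, so that each word of the concatenation is followed by `u`.
-/
theorem LoopFamily.seg_eq [Inhabited A] (hF : LoopFamily Λ u T R P Q S) (hσ : ∀ k, σ k ∈ S) (k : ℕ) :
    seg (concat T σ) (k * T) (T + u.length) = σ k ++ u := by
  have hT : 0 < T := hF.pos.trans_le (hF.le_R.trans hF.R_le)
  have hl : ∀ k, (σ k).length = T := fun k => hF.length_eq _ (hσ k)
  have hu : u <+: σ (k + 1) ++ u := (hF.mem _ (hσ (k + 1))).1.2.2.1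
  have hle : u.length ≤ T := hF.le_R.trans hF.R_le
  rw [seg_add, seg_concat hT hl, ← seg_take (concat T σ) (k * T + T) hle,
    show k * T + T = (k + 1) * T by ring, seg_concat hT hl]
  congr 1
  have := take_eq_of_prefix hu le_rfl
  rwa [List.take_append_of_le_length (by rw [hl]; exact hle), List.take_length] at this

/-- A factor of length `m ≤ R` of an infinite concatenation of a loop family is a factor of one of
the words, or overlaps a junction. -/
theorem LoopFamily.seg_cases [Inhabited A] (hF : LoopFamily Λ u T R P Q S) (hσ : ∀ k, σ k ∈ S) {m : ℕ}
    (hm : m ≤ R) (i : ℕ) :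
    (∃ k s, s < T ∧ s + m ≤ T + u.length ∧
      seg (concat T σ) i m = ((σ k ++ u).drop s).take m) ∨
    ∃ j ∈ Finset.Icc 1 (m - u.length - 1),
      seg (concat T σ) i m = Q.drop (R - j) ++ P.take (m - j) := by
  have hT : 0 < T := hF.pos.trans_le (hF.le_R.trans hF.R_le)
  have hl : ∀ k, (σ k).length = T := fun k => hF.length_eq _ (hσ k)
  have hRT := hF.R_le
  have hlu := hF.pos
  set k := i / T
  set s := i % T
  have hi : i = k * T + s := by rw [mul_comm]; exact (Nat.div_add_mod i T).symm
  have hs : s < T := Nat.mod_lt _ hT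
  -- Since `m ≤ R ≤ T`, the window meets at most two words. Either it ends within the `u` at the
  -- start of the second one, or it extends beyond this `u`; then it is made of the last `T - s`
  -- letters of `Q` and of initial letters of `P`, and `T - s ≤ m - |u| - 1`.
  rcases le_or_gt (s + m) (T + u.length) with h | h
  · left
    refine ⟨k, s, hs, h, ?_⟩
    rw [← hF.seg_eq hσ, seg_drop _ _ (by omega), seg_take _ _ (by omega), ← hi]
  · right
    refine ⟨T - s, by rw [Finset.mem_Icc]; omega, ?_⟩
    rw [show m = (T - s) + (m - (T - s)) by omega, seg_add]
    have h1 : seg (concat T σ) i (T - s) = Q.drop (R - (T - s)) := by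
      rw [← hF.drop_eq _ (hσ k), List.drop_drop, ← seg_concat hT hl k,
        seg_drop _ _ (by omega), hi]
      congr 1 <;> omega
    have h2 : seg (concat T σ) (i + (T - s)) (m - (T - s)) = P.take (m - (T - s)) := by
      rw [← hF.take_eq _ (hσ (k + 1)), List.take_take, min_eq_left (by omega),
        ← seg_concat hT hl (k + 1), seg_take _ _ (by omega)]
      congr 1
      rw [add_mul]
      omega
    rw [h1, h2, Nat.add_sub_cancel_left]

theorem ncard_junctions_le (P Q : List A) (R m : ℕ) (I : Finset ℕ) :
    (junctions P Q R m I).ncard ≤ I.card :=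
  (Set.ncard_image_le (Finset.finite_toSet _)).trans_eq (Set.ncard_coe_finset _)

/-- An occurrence of `u` strictly inside the window would be an occurrence in `v ++ u` strictly
between the first and the last one. -/
theorem LoopFamily.notMem_strictlyInside (hF : LoopFamily Λ u T R P Q S) {v : List A}
    (hv : v ∈ S) {s m : ℕ} (h : s + m ≤ T + u.length) :
    ((v ++ u).drop s).take m ∉ strictlyInside Λ u m := by
  rintro ⟨-, i, hi, him, hp⟩
  rw [List.drop_take, List.prefix_take_iff, List.drop_drop] at hp
  exact (hF.mem v hv).2 (s + i) (by omega) (by omega) hp.1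

variable [Finite A]

/-- In `v ++ u ++ t` take the windows in which the second `u` has offset `i`, for `1 ≤ i ≤ m - |u| -
1`. They are different, since the first occurrence of `u` in such a window is at `i`: an earlier one
would contradict that `v ++ u` is a first return. The prolongation `t` is what lets these windows be
words of `Λ`. -/
theorem LoopFamily.le_ncard_strictlyInside (hΛ : FactorClosed Λ)
    (hF : LoopFamily Λ u T R P Q S) {v t : List A} (hv : v ∈ S) (ht : t.length = R)
    (hvt : v ++ u ++ t ∈ Λ) {m : ℕ} (hm : m ≤ R) :
    m - u.length - 1 ≤ (strictlyInside Λ u m).ncard := by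
  have hRT := hF.R_le
  have hlu := hF.pos
  have hvl := hF.length_eq v hv
  have hfin : (strictlyInside Λ u m).Finite := (level_finite Λ m).subset fun x hx => hx.1
  have hcard : ((Finset.Icc 1 (m - u.length - 1) : Finset ℕ) : Set ℕ).ncard = m - u.length - 1 := by
    rw [Set.ncard_coe_finset, Nat.card_Icc]; omega
  rw [← hcard]
  have hocc : ∀ i j, i ≤ T → (((v ++ u ++ t).drop (T - i)).take m).drop j =
      ((v ++ u ++ t).drop (T - i + j)).take (m - j) := by
    intro i j _
    rw [List.drop_take, List.drop_drop]
  have hself : ∀ i, i ≤ T → i + u.length ≤ m →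
      u <+: (((v ++ u ++ t).drop (T - i)).take m).drop i := by
    intro i hi him
    rw [hocc i i hi, List.prefix_take_iff]
    refine ⟨?_, by omega⟩
    rw [show T - i + i = T by omega, List.append_assoc, ← hvl, List.drop_left]
    exact List.prefix_append _ _
  have hno : ∀ i j, i ≤ T → j < i → T - i + j ≠ 0 → i + u.length ≤ m →
      ¬ u <+: (((v ++ u ++ t).drop (T - i)).take m).drop j := by
    intro i j hi hj h0 him hp
    rw [hocc i j hi, List.prefix_take_iff] at hp
    refine (hF.mem v hv).2 (T - i + j) (by omega) (by omega) ?_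
    have h1 := hp.1
    rw [List.drop_append_of_le_length (by simp [hvl]; omega)] at h1
    exact List.prefix_of_prefix_length_le h1 (List.prefix_append _ _) (by simp [hvl]; omega)
  refine Set.ncard_le_ncard_of_injOn (fun i => ((v ++ u ++ t).drop (T - i)).take m) ?_ ?_ hfin
  · intro i hi
    simp only [Finset.coe_Icc, Set.mem_Icc] at hi
    refine ⟨⟨hΛ hvt (drop_take_infix _ _ _), ?_⟩, i, hi.1, by omega, hself i (by omega) (by omega)⟩
    simp [hvl, ht]; omega
  · intro i hi j hj h
    simp only [Finset.coe_Icc, Set.mem_Icc] at hi hj h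
    by_contra hne
    rcases Nat.lt_or_gt_of_ne hne with hlt | hlt
    · exact hno j i (by omega) hlt (by omega) (by omega) (h ▸ hself i (by omega) (by omega))
    · exact hno i j (by omega) hlt (by omega) (by omega) (h ▸ hself j (by omega) (by omega))

/-- Up to length `R`, an infinite concatenation of a loop family does not have more factors than
the language itself: the factors that overlap a junction are compensated by the words in which `u`
occurs strictly inside. -/
theorem LoopFamily.ncard_range_seg_le [Inhabited A] (hΛ : FactorClosed Λ) (hF : LoopFamily Λ u T R P Q S)
    {v t : List A} (hv : v ∈ S) (ht : t.length = R) (hvt : v ++ u ++ t ∈ Λ)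
    (hσ : ∀ k, σ k ∈ S) {m : ℕ} (hm : m ≤ R) :
    (Set.range fun i => seg (concat T σ) i m).ncard ≤ (level Λ m).ncard := by
  have hfl := level_finite Λ m
  have hsub : strictlyInside Λ u m ⊆ level Λ m := fun x hx => hx.1
  have hle := hF.le_ncard_strictlyInside hΛ hv ht hvt hm
  have hcov : (Set.range fun i => seg (concat T σ) i m) ⊆
      (level Λ m \ strictlyInside Λ u m) ∪
        junctions P Q R m (Finset.Icc 1 (m - u.length - 1)) := by
    rintro _ ⟨i, rfl⟩
    rcases hF.seg_cases hσ hm i with ⟨k, s, hs, hsm, h⟩ | ⟨j, hj, h⟩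
    · left
      simp only [h]
      refine ⟨⟨hΛ (hF.mem _ (hσ k)).1.1 (drop_take_infix _ _ _), ?_⟩,
        hF.notMem_strictlyInside (hσ k) hsm⟩
      simp [hF.length_eq _ (hσ k)]; omega
    · right
      exact ⟨j, hj, h.symm⟩
  have h1 := Set.ncard_le_ncard hcov ((hfl.subset Set.sdiff_subset).union
    ((Finset.finite_toSet _).image _))
  have h2 := Set.ncard_union_le (level Λ m \ strictlyInside Λ u m)
    (junctions P Q R m (Finset.Icc 1 (m - u.length - 1)))
  have h3 := ncard_junctions_le P Q R m (Finset.Icc 1 (m - u.length - 1))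
  rw [Nat.card_Icc] at h3
  have h4 := Set.ncard_sdiff_add_ncard_of_subset hsub hfl
  omega

/-- If the aligned blocks of length `d` in a loop family are taken from a set `D`, the infinite
concatenations have few factors of length `R`. -/
theorem LoopFamily.ncard_range_seg_le_of_blocks [Inhabited A] (hΛ : FactorClosed Λ)
    (hF : LoopFamily Λ u T R P Q S) (hσ : ∀ k, σ k ∈ S) {d : ℕ} (hd : 0 < d)
    (hdR : 2 * d + u.length ≤ R) {D : Set (List A)} (hDf : D.Finite)
    (hD : ∀ v ∈ S, ∀ i, (i + 1) * d ≤ T → (v.drop (i * d)).take d ∈ D) :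
    (Set.range fun i => seg (concat T σ) i R).ncard ≤
      R + ∑ a ∈ Finset.range d,
        (level Λ a).ncard * (D.ncard * (level Λ (R - d - a)).ncard) := by
  let W : ℕ → Set (List A) := fun a => {x | x ∈ level Λ R ∧ (x.drop a).take d ∈ D}
  have hRT := hF.R_le
  have hcov : (Set.range fun i => seg (concat T σ) i R) ⊆
      junctions P Q R R (Finset.Icc 1 (R - u.length - 1)) ∪ ⋃ a ∈ Finset.range d, W a := by
    rintro _ ⟨i, rfl⟩
    rcases hF.seg_cases hσ le_rfl i with ⟨k, s, hs, hsm, h⟩ | ⟨j, hj, h⟩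
    · right
      simp only [h]
      have hl := hF.length_eq _ (hσ k)
      -- `a` is the distance from `s` to the next multiple of `d`. As `2 * d + |u| ≤ R`, the aligned
      -- block starting there lies inside the window and ends before the final `u`, hence it is a
      -- block of `σ k`.
      set a := (d - s % d) % d with ha
      have had : a < d := Nat.mod_lt _ hd
      obtain ⟨c, hc⟩ : ∃ c, s + a = c * d := by
        have h1 : (s + a) % d = 0 := by
          rcases Nat.eq_zero_or_pos (s % d) with h0 | h0
          · rw [ha, h0, Nat.sub_zero, Nat.mod_self, add_zero, h0]
          · have h2 := Nat.mod_lt s hd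
            have h3 : a = d - s % d := by rw [ha]; exact Nat.mod_eq_of_lt (by omega)
            have h4 := Nat.div_add_mod s d
            have h5 : s + a = d * (s / d) + d := by omega
            rw [h5, Nat.mul_add_mod_self_left, Nat.mod_self]
        obtain ⟨c, hc⟩ := Nat.dvd_of_mod_eq_zero h1
        exact ⟨c, by rw [hc, mul_comm]⟩
      refine Set.mem_iUnion₂.2 ⟨a, Finset.mem_range.2 had,
        ⟨hΛ (hF.mem _ (hσ k)).1.1 (drop_take_infix _ _ _), by simp [hl]; omega⟩, ?_⟩
      have hcT : (c + 1) * d ≤ T := by rw [add_mul, one_mul, ← hc]; omega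
      have h6 := hD _ (hσ k) c hcT
      rw [List.drop_take, List.drop_drop, List.take_take, min_eq_left (by omega), hc,
        List.drop_append_of_le_length (by rw [hl]; omega),
        List.take_append_of_le_length]
      · exact h6
      · rw [List.length_drop, hl]
        rw [add_mul] at hcT
        omega
    · left
      exact ⟨j, hj, h.symm⟩
  have hWf : ∀ a, (W a).Finite := fun a => (level_finite Λ R).subset fun x hx => hx.1
  have h1 := Set.ncard_le_ncard hcov (((Finset.finite_toSet _).image _).union
    (Set.Finite.biUnion (Finset.finite_toSet _) fun a _ => hWf a))
  refine h1.trans ((Set.ncard_union_le _ _).trans (add_le_add ?_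
    ((Finset.set_ncard_biUnion_le _ _).trans (Finset.sum_le_sum fun a ha => ?_))))
  · refine (ncard_junctions_le P Q R R _).trans ?_
    rw [Nat.card_Icc]; omega
  · rw [Finset.mem_range] at ha
    rw [← Set.ncard_prod, ← Set.ncard_prod]
    refine Set.ncard_le_ncard_of_injOn
      (fun x => (x.take a, ((x.drop a).take d, x.drop (a + d)))) ?_ ?_
      ((level_finite _ _).prod (hDf.prod (level_finite _ _)))
    · rintro x ⟨⟨hx, hl⟩, hxD⟩
      exact ⟨⟨hΛ hx (List.take_prefix _ _).isInfix, by simp [hl]; omega⟩, hxD,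
        hΛ hx (List.drop_suffix _ _).isInfix, by simp [hl]; omega⟩
    · intro x _ y _ h
      simp only [Prod.mk.injEq] at h
      have key : ∀ x : List A, x = x.take a ++ ((x.drop a).take d ++ x.drop (a + d)) := by
        intro x
        rw [← List.drop_drop, List.take_append_drop, List.take_append_drop]
      rw [key x, key y, h.1, h.2.1, h.2.2]

end Gluing

/-! ### The numerical regime of the construction -/

/-- The relations between the parameters: `E` is the growth rate of `f`, `h` the rate at the length
`n`, and `M` the next length. -/
structure Regime (E ε δ h : ℝ) (K n M : ℕ) : Prop where
  E_pos : 0 < E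
  δ_pos : 0 < δ
  εE : ε * E = 105 * (4 + 2 * E) * δ
  δ_le : 210 * δ ≤ 1
  δK_ge : 1 + δ ≤ δ * K
  δK_le : δ * K ≤ 1 + 2 * δ
  EK : 420 ≤ E * K
  K_le : K ≤ n
  quad : 4 * (K : ℝ) ^ 2 ≤ 420 ^ 3 * (E * n)
  M_ge : Real.exp (K * ((1 + δ) ^ 2 * E * n + E)) ≤ M
  M_le : (M : ℝ) ≤ Real.exp (K * ((1 + δ) ^ 2 * E * n + E)) + 1
  h_ge : E / 2 ≤ h

namespace Regime

variable {E ε δ h : ℝ} {K n M : ℕ}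

theorem K_ge (r : Regime E ε δ h K n M) : 211 ≤ K := by
  have h1 := r.δK_ge
  have h2 := r.δ_le
  have h3 := r.δ_pos
  by_contra hlt
  have h4 : (K : ℝ) ≤ 210 := by exact_mod_cast (by omega : K ≤ 210)
  nlinarith

theorem K_pos (r : Regime E ε δ h K n M) : (0 : ℝ) < K := by
  have := r.K_ge
  exact_mod_cast (by omega : 0 < K)

theorem n_pos (r : Regime E ε δ h K n M) : (0 : ℝ) < n := by
  have := r.K_ge
  have := r.K_le
  exact_mod_cast (by omega : 0 < n)

theorem h_pos (r : Regime E ε δ h K n M) : 0 < h := by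
  have := r.h_ge
  have := r.E_pos
  linarith

theorem K_le' (r : Regime E ε δ h K n M) : (K : ℝ) ≤ n := by exact_mod_cast r.K_le

theorem K_ge' (r : Regime E ε δ h K n M) : (211 : ℝ) ≤ K := by exact_mod_cast r.K_ge

theorem x_ge (r : Regime E ε δ h K n M) : 420 ≤ E * n := by
  have := r.EK
  have := r.K_le'
  have := r.E_pos
  nlinarith

theorem EK_le (r : Regime E ε δ h K n M) : E * K ≤ E * n :=
  mul_le_mul_of_nonneg_left r.K_le' r.E_pos.le

/-- For `y = E n / 20 ≥ 21`, from the twelfth term of the exponential series. The constants come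
from `quad`: it gives `K² ≤ 420³ * 20 y / 4 = 370440000 y` and, together with `EK`, `n² ≤ 105 (20
y)³ = 840000 y³`. -/
theorem pow_le_exp {y : ℝ} (hy : 21 ≤ y) : 840000 * y ^ 3 ≤ Real.exp (2 * y) ∧
    370440000 * y ≤ Real.exp (2 * y) := by
  have h0 := Real.pow_div_factorial_le_exp (2 * y) (by linarith) 12
  have h1 : (Nat.factorial 12 : ℝ) = 479001600 := by norm_num [Nat.factorial]
  rw [h1, div_le_iff₀ (by norm_num)] at h0
  have h9 : (21 : ℝ) ^ 9 ≤ y ^ 9 := by gcongr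
  have h11 : (21 : ℝ) ^ 11 ≤ y ^ 11 := by gcongr
  have hy3 : 0 < y ^ 3 := by positivity
  constructor
  · have : (2 * y) ^ 12 = 4096 * (y ^ 3 * y ^ 9) := by ring
    nlinarith
  · have : (2 * y) ^ 12 = 4096 * (y * y ^ 11) := by ring
    nlinarith

/-- Together with the next lemmas this bounds `K`, `n`, `E n` and the constant `100` by the single
quantity `exp (E n / 20)`, so that polynomial factors are handled by counting its powers. The second
condition on `n₀` is made for this. -/
theorem K_le_exp (r : Regime E ε δ h K n M) : (K : ℝ) ≤ Real.exp (E * n / 20) := by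
  have hx := r.x_ge
  have h1 := (pow_le_exp (y := E * n / 20) (by linarith)).2
  have h2 := r.quad
  refine abs_le_of_sq_le_sq' ?_ (Real.exp_pos _).le |>.2
  rw [← Real.exp_nat_mul]
  push_cast
  linarith

theorem n_le_exp (r : Regime E ε δ h K n M) : (n : ℝ) ≤ Real.exp (E * n / 20) := by
  have hx := r.x_ge
  have h1 := (pow_le_exp (y := E * n / 20) (by linarith)).1
  have h2 := r.quad
  have h3 := r.EK
  have hn := r.n_pos
  have hE := r.E_pos
  have hK := r.K_pos
  refine abs_le_of_sq_le_sq' ?_ (Real.exp_pos _).le |>.2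
  rw [← Real.exp_nat_mul]
  push_cast
  have h4 : 420 * (n : ℝ) ≤ E * n * K := by nlinarith
  have h5 : (420 * (n : ℝ)) ^ 2 ≤ (E * n * K) ^ 2 := by gcongr
  have h6 : (E * n * K) ^ 2 * 4 ≤ (E * n) ^ 2 * (420 ^ 3 * (E * n)) := by
    have : (E * n * K) ^ 2 * 4 = (E * n) ^ 2 * (4 * (K : ℝ) ^ 2) := by ring
    rw [this]
    gcongr
  nlinarith

theorem x_le_exp (r : Regime E ε δ h K n M) : E * n ≤ Real.exp (E * n / 20) := by
  have hx := r.x_ge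
  have h1 := (pow_le_exp (y := E * n / 20) (by linarith)).2
  refine abs_le_of_sq_le_sq' ?_ (Real.exp_pos _).le |>.2
  have h2 := (pow_le_exp (y := E * n / 20) (by linarith)).1
  rw [← Real.exp_nat_mul]
  push_cast
  nlinarith

theorem hundred_le_exp (r : Regime E ε δ h K n M) : 100 ≤ Real.exp (E * n / 20) :=
  (by linarith [r.x_ge] : (100 : ℝ) ≤ E * n).trans r.x_le_exp

theorem exp_le_M (r : Regime E ε δ h K n M) : Real.exp (K * (E * n)) ≤ M := by
  refine (Real.exp_le_exp.2 ?_).trans r.M_ge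
  have hx := r.x_ge
  have hδ := r.δ_pos
  have hK := r.K_pos
  have hE := r.E_pos
  have : E * n ≤ (1 + δ) ^ 2 * E * n + E := by
    have h1 : 1 ≤ (1 + δ) ^ 2 := by nlinarith
    have h2 : (1 + δ) ^ 2 * E * n = (1 + δ) ^ 2 * (E * n) := by ring
    nlinarith
  gcongr

theorem M_le_exp (r : Regime E ε δ h K n M) : (M : ℝ) ≤ Real.exp ((K + 4) * (E * n)) := by
  have hx := r.x_ge
  have hδ := r.δ_pos
  have hδ' := r.δ_le
  have hK := r.K_pos
  have hE := r.E_pos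
  have hδK := r.δK_le
  have hEK := r.EK_le
  -- The surplus over `K` is at most `2.02` from `2 δ K`, `0.01` from `δ² K`, and `1` from `E K ≤ E
  -- n`. The remaining `0.9` absorbs the rounding of `M`.
  have h1 : K * ((1 + δ) ^ 2 * E * n + E) ≤ (K + 3.1) * (E * n) := by
    have h2 : K * ((1 + δ) ^ 2 * E * n + E) =
        K * (E * n) + 2 * (δ * K) * (E * n) + δ * (δ * K) * (E * n) + E * K := by ring
    have h3 : 2 * (δ * K) * (E * n) ≤ 2.02 * (E * n) := by
      refine mul_le_mul_of_nonneg_right ?_ (by linarith)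
      linarith
    have h4 : δ * (δ * K) * (E * n) ≤ 0.01 * (E * n) := by
      refine mul_le_mul_of_nonneg_right ?_ (by linarith)
      nlinarith
    linarith
  have h2 := Real.exp_le_exp.2 h1
  have h3 : Real.exp ((K + 4) * (E * n)) =
      Real.exp ((K + 3.1) * (E * n)) * Real.exp (0.9 * (E * n)) := by
    rw [← Real.exp_add]; ring_nf
  have h4 : (2 : ℝ) ≤ Real.exp (0.9 * (E * n)) := by
    have := Real.add_one_le_exp (0.9 * (E * n))
    linarith
  have h5 : (1 : ℝ) ≤ Real.exp ((K + 3.1) * (E * n)) := Real.one_le_exp (by positivity)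
  have h6 := r.M_le
  rw [h3]
  nlinarith

theorem δh_ge (r : Regime E ε δ h K n M) : 210 ≤ δ * h * K ^ 2 := by
  have h1 := r.δK_ge
  have h2 := r.EK
  have h3 := r.h_ge
  have h4 := r.δ_pos
  have hK := r.K_pos
  have h5 : 210 ≤ h * K := by nlinarith
  have h6 : 1 ≤ δ * K := by linarith
  calc (210 : ℝ) ≤ (δ * K) * (h * K) := by nlinarith
    _ = _ := by ring

/-- Powers of `exp (E n / 20)` are absorbed by a small exponential. -/
theorem absorb (r : Regime E ε δ h K n M) {X y : ℝ} (a : ℕ)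
    (hX : X ≤ Real.exp (E * n / 20) ^ a) (hy : y ≤ -((a + 1) * (E * n / 20))) :
    X * Real.exp y ≤ 1 / 100 := by
  have h1 := r.hundred_le_exp
  calc X * Real.exp y ≤ Real.exp (E * n / 20) ^ a * Real.exp (-((a + 1) * (E * n / 20))) :=
        mul_le_mul hX (Real.exp_le_exp.2 hy) (Real.exp_pos _).le (by positivity)
    _ = (Real.exp (E * n / 20))⁻¹ := by
        rw [← Real.exp_nat_mul, ← Real.exp_add, ← Real.exp_neg]
        ring_nf
    _ ≤ 1 / 100 := by rw [one_div]; exact inv_anti₀ (by norm_num) h1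

/-- The upper bounds for the numbers of first returns at distance `T` to a word of length `ℓ`. -/
def returnBound (E δ h : ℝ) (n ℓ Tm T : ℕ) : ℝ :=
  if T < ℓ then 1 else if T < Tm then Real.exp (h * (T - ℓ) + (1 + δ / 2) * E * n)
    else Real.exp ((1 - 3 * δ) * h * T)

/-- One summand for each range of the distance `b - a`, with bounds independent of `a`. In the
middle range the exponent is `2 δ h b - h a - h ℓ + (1 + δ / 2) E n`: the gain `h ℓ`, from fixing
one copy of `u`, has to beat the loss `2 δ h b`. -/
theorem returnBound_mul_le (r : Regime E ε δ h K n M) {ℓ Tm a b : ℕ}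
    (ha : a < ℓ) (hb : ℓ ≤ b) :
    returnBound E δ h n ℓ Tm (b - a) * Real.exp (-((1 - 2 * δ) * h * b)) ≤
      (if b < 2 * ℓ then Real.exp (-((1 - 2 * δ) * h * ℓ)) else 0) +
      (if b < Tm + ℓ then
        Real.exp (2 * δ * h * (Tm + ℓ) - h * ℓ + (1 + δ / 2) * E * n) else 0) +
      (if Tm ≤ b then Real.exp (-(δ * h * b)) else 0) := by
  have hδ := r.δ_pos
  have hδ' := r.δ_le
  have hh := r.h_pos
  have hH : 0 ≤ (1 - 2 * δ) * h := mul_nonneg (by linarith) hh.le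
  have hH' : 0 ≤ (1 - 3 * δ) * h := mul_nonneg (by linarith) hh.le
  have hba : ((b - a : ℕ) : ℝ) = b - a := Nat.cast_sub (by omega)
  have ha0 : (0 : ℝ) ≤ a := Nat.cast_nonneg a
  have hbℓ : (ℓ : ℝ) ≤ b := by exact_mod_cast hb
  have p1 : 0 ≤ (if b < 2 * ℓ then Real.exp (-((1 - 2 * δ) * h * ℓ)) else 0) := by
    split_ifs <;> positivity
  have p2 : 0 ≤ (if b < Tm + ℓ then
        Real.exp (2 * δ * h * (Tm + ℓ) - h * ℓ + (1 + δ / 2) * E * n) else 0) := by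
    split_ifs <;> positivity
  have p3 : 0 ≤ (if Tm ≤ b then Real.exp (-(δ * h * b)) else 0) := by
    split_ifs <;> positivity
  unfold returnBound
  by_cases h1 : b - a < ℓ
  · rw [if_pos h1, one_mul]
    have : b < 2 * ℓ := by omega
    rw [if_pos this] at p1 ⊢
    have : Real.exp (-((1 - 2 * δ) * h * b)) ≤ Real.exp (-((1 - 2 * δ) * h * ℓ)) := by
      refine Real.exp_le_exp.2 (neg_le_neg ?_)
      gcongr
    linarith
  · rw [if_neg h1]
    by_cases h2 : b - a < Tm
    · rw [if_pos h2, ← Real.exp_add, hba]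
      have h3 : b < Tm + ℓ := by omega
      rw [if_pos h3] at p2 ⊢
      have h4 : (b : ℝ) ≤ Tm + ℓ := by exact_mod_cast h3.le
      have : Real.exp (h * (b - a - ℓ) + (1 + δ / 2) * E * n + -((1 - 2 * δ) * h * b)) ≤
          Real.exp (2 * δ * h * (Tm + ℓ) - h * ℓ + (1 + δ / 2) * E * n) := by
        refine Real.exp_le_exp.2 ?_
        have h5 : 2 * δ * h * b ≤ 2 * δ * h * (Tm + ℓ) := by gcongr
        have h6 : 0 ≤ h * a := by positivity
        nlinarith
      linarith
    · rw [if_neg h2, ← Real.exp_add, hba]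
      have h3 : Tm ≤ b := by omega
      rw [if_pos h3] at p3 ⊢
      have : Real.exp ((1 - 3 * δ) * h * (b - a) + -((1 - 2 * δ) * h * b)) ≤
          Real.exp (-(δ * h * b)) := by
        refine Real.exp_le_exp.2 ?_
        have h6 : 0 ≤ (1 - 3 * δ) * h * a := by positivity
        nlinarith
      linarith

/-- A geometric series; `exp θ ≥ 1 + θ` gives `1 / (1 - exp (-θ)) ≤ 1 + 1 / θ`. -/
theorem sum_exp_neg_le {θ : ℝ} (hθ : 0 < θ) (Tm ℓ L : ℕ) :
    ∑ b ∈ Finset.Icc ℓ L, (if Tm ≤ b then Real.exp (-(θ * b)) else 0) ≤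
      Real.exp (-(θ * Tm)) * (1 + 1 / θ) := by
  have h1 : ∑ b ∈ Finset.Icc ℓ L, (if Tm ≤ b then Real.exp (-(θ * b)) else 0) ≤
      ∑ b ∈ Finset.Ico Tm (Tm + (L + 1)), Real.exp (-(θ * b)) := by
    rw [← Finset.sum_filter]
    refine Finset.sum_le_sum_of_subset_of_nonneg ?_ fun _ _ _ => (Real.exp_pos _).le
    intro b hb
    simp only [Finset.mem_filter, Finset.mem_Icc, Finset.mem_Ico] at hb ⊢
    omega
  refine h1.trans ?_
  rw [Finset.sum_Ico_eq_sum_range, Nat.add_sub_cancel_left]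
  have h2 : ∀ i : ℕ, Real.exp (-(θ * (Tm + i : ℕ))) = Real.exp (-(θ * Tm)) * Real.exp (-θ) ^ i := by
    intro i
    rw [← Real.exp_nat_mul, ← Real.exp_add]
    push_cast
    ring_nf
  simp_rw [h2]
  rw [← Finset.mul_sum]
  have hr : Real.exp (-θ) < 1 := by rw [Real.exp_lt_one_iff]; linarith
  have h3 := (summable_geometric_of_lt_one (Real.exp_pos (-θ)).le hr).sum_le_tsum
    (Finset.range (L + 1)) (fun i _ => by positivity)
  rw [tsum_geometric_of_lt_one (Real.exp_pos (-θ)).le hr] at h3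
  refine mul_le_mul_of_nonneg_left (h3.trans ?_) (Real.exp_pos _).le
  have h4 : Real.exp (-θ) ≤ 1 / (1 + θ) := by
    rw [Real.exp_neg, ← one_div]
    exact one_div_le_one_div_of_le (by linarith) (by linarith [Real.add_one_le_exp θ])
  have h5 : θ / (1 + θ) ≤ 1 - Real.exp (-θ) := by
    have : θ / (1 + θ) = 1 - 1 / (1 + θ) := by field_simp; ring
    linarith
  calc (1 - Real.exp (-θ))⁻¹ ≤ (θ / (1 + θ))⁻¹ := inv_anti₀ (by positivity) h5
    _ = 1 + 1 / θ := by field_simp; ring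

theorem sum_ite_lt_le {c : ℝ} (hc : 0 ≤ c) (ℓ L m : ℕ) :
    ∑ b ∈ Finset.Icc ℓ L, (if b < m then c else 0) ≤ m * c := by
  rw [← Finset.sum_filter, Finset.sum_const, nsmul_eq_mul]
  have : ((Finset.Icc ℓ L).filter (· < m)).card ≤ m := by
    calc _ ≤ (Finset.range m).card := Finset.card_le_card fun b hb => by
            simp only [Finset.mem_filter] at hb
            exact Finset.mem_range.2 hb.2
      _ = m := Finset.card_range m
  gcongr

/-- This is the condition of `returns_le_exp`. The threshold `Tm` is a compromise: `2 δ h Tm`, about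
`2 h n k`, must stay well below `h ℓ`, which is about `h n K`, whence `k ≤ K / 5`; and `δ h Tm ≥ h n
k` must beat the polynomial factors, whence `k ≥ 42`. -/
theorem sum_returnBound_le (r : Regime E ε δ h K n M) {ℓ Tm k : ℕ}
    (hℓ : (ℓ : ℝ) = (K - 10) * n) (hTm : (Tm : ℝ) = K * n * k) (hk : (42 : ℝ) ≤ k)
    (hk' : (k : ℝ) ≤ K / 5) (L : ℕ) :
    ∑ a ∈ Finset.range ℓ, ∑ b ∈ Finset.Icc ℓ L,
      returnBound E δ h n ℓ Tm (b - a) * Real.exp (-((1 - 2 * δ) * h * b)) ≤ 1 := by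
  have hδ := r.δ_pos
  have hδ' := r.δ_le
  have hh := r.h_pos
  have hx := r.x_ge
  have hK := r.K_ge'
  have hn := r.n_pos
  have hE := r.E_pos
  have hKz := r.K_le_exp
  have hnz := r.n_le_exp
  have hz := r.hundred_le_exp
  have hhE := r.h_ge
  have hδh := r.δh_ge
  have hδK := r.δK_ge
  have hδK' := r.δK_le
  have hab := fun {X y : ℝ} (a : ℕ) => r.absorb (X := X) (y := y) a
  set z := Real.exp (E * n / 20) with hzdef
  have hθ : 0 < δ * h := by positivity
  have hrow : ∀ a ∈ Finset.range ℓ, ∑ b ∈ Finset.Icc ℓ L,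
      returnBound E δ h n ℓ Tm (b - a) * Real.exp (-((1 - 2 * δ) * h * b)) ≤
      (2 * ℓ : ℕ) * Real.exp (-((1 - 2 * δ) * h * ℓ)) +
      (Tm + ℓ : ℕ) * Real.exp (2 * δ * h * (Tm + ℓ) - h * ℓ + (1 + δ / 2) * E * n) +
      Real.exp (-(δ * h * Tm)) * (1 + 1 / (δ * h)) := by
    intro a ha
    refine (Finset.sum_le_sum fun b hb => r.returnBound_mul_le (Finset.mem_range.1 ha)
      (Finset.mem_Icc.1 hb).1).trans ?_
    rw [Finset.sum_add_distrib, Finset.sum_add_distrib]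
    exact add_le_add (add_le_add (sum_ite_lt_le (Real.exp_pos _).le _ _ _)
      (sum_ite_lt_le (Real.exp_pos _).le _ _ _)) (sum_exp_neg_le hθ _ _ _)
  refine (Finset.sum_le_sum hrow).trans ?_
  rw [Finset.sum_const, Finset.card_range, nsmul_eq_mul]
  push_cast
  have hz0 : 0 < z := Real.exp_pos _
  have hxE : (1 + δ / 2) * E * n ≤ 1.01 * (E * n) := by nlinarith
  have hhn : E * n / 2 ≤ h * n := by nlinarith
  have hℓz : (ℓ : ℝ) ≤ z ^ 2 := by
    rw [hℓ, sq]
    exact mul_le_mul (by linarith) hnz hn.le hz0.le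
  have hℓ0 : (0 : ℝ) ≤ ℓ := Nat.cast_nonneg _
  have hTm0 : (0 : ℝ) ≤ Tm := Nat.cast_nonneg _
  have hTz : (Tm : ℝ) + ℓ ≤ z ^ 3 := by
    rw [hTm, hℓ]
    calc (K : ℝ) * n * k + (K - 10) * n ≤ K * n * (K / 5) + K * n := by
          refine add_le_add (by gcongr) (by nlinarith)
      _ = K * n * (K / 5 + 1) := by ring
      _ ≤ K * n * K := by gcongr; linarith
      _ ≤ z * z * z := by gcongr
      _ = z ^ 3 := by ring
  -- the three contributions
  have c1 : (ℓ * (2 * ℓ)) * Real.exp (-((1 - 2 * δ) * h * ℓ)) ≤ 1 / 100 := by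
    refine hab 5 ?_ ?_
    · calc (ℓ : ℝ) * (2 * ℓ) ≤ z ^ 2 * (z * z ^ 2) := by
            gcongr; linarith
        _ = z ^ 5 := by ring
    · push_cast
      have h1 : 0.49 * (E * n) ≤ (1 - 2 * δ) * (h * n) := by nlinarith
      have h2 : (1 - 2 * δ) * h * ℓ = (K - 10) * ((1 - 2 * δ) * (h * n)) := by rw [hℓ]; ring
      have h3 : 201 * (0.49 * (E * n)) ≤ (K - 10) * ((1 - 2 * δ) * (h * n)) :=
        mul_le_mul (by linarith) h1 (by linarith) (by linarith)
      rw [h2]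
      linarith
  have c2 : (ℓ * (Tm + ℓ)) * Real.exp (2 * δ * h * (Tm + ℓ) - h * ℓ + (1 + δ / 2) * E * n)
      ≤ 1 / 100 := by
    refine hab 5 ?_ ?_
    · calc (ℓ : ℝ) * (Tm + ℓ) ≤ z ^ 2 * z ^ 3 := by gcongr
        _ = z ^ 5 := by ring
    · push_cast
      have h1 : 2 * δ * h * (Tm + ℓ) - h * ℓ =
          (h * n) * (2 * (δ * K) * k + 2 * (δ * K) - 20 * δ - K + 10) := by
        rw [hTm, hℓ]; ring
      have h2 : 2 * (δ * K) * k ≤ 2 * (1 + 2 * δ) * (K / 5) := by gcongr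
      have h3 : 2 * (1 + 2 * δ) * (K / 5) ≤ 2.02 * (K / 5) := by
        refine mul_le_mul_of_nonneg_right ?_ (by linarith); linarith
      have h4 : 2 * (δ * K) * k + 2 * (δ * K) - 20 * δ - K + 10 ≤ -100 := by linarith
      have h5 : (h * n) * (2 * (δ * K) * k + 2 * (δ * K) - 20 * δ - K + 10) ≤ (h * n) * (-100) :=
        mul_le_mul_of_nonneg_left h4 (by positivity)
      rw [h1]
      linarith
  have c3 : (ℓ * (1 + 1 / (δ * h))) * Real.exp (-(δ * h * Tm)) ≤ 1 / 100 := by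
    refine hab 5 ?_ ?_
    · have h1 : 1 / (δ * h) ≤ z ^ 2 := by
        rw [div_le_iff₀ hθ]
        calc (1 : ℝ) ≤ δ * h * K ^ 2 := by linarith
          _ ≤ δ * h * z ^ 2 := by gcongr
          _ = _ := mul_comm _ _
      have h2 : 1 + 1 / (δ * h) ≤ z ^ 3 := by nlinarith
      calc (ℓ : ℝ) * (1 + 1 / (δ * h)) ≤ z ^ 2 * z ^ 3 := by gcongr
        _ = z ^ 5 := by ring
    · push_cast
      have h1 : δ * h * Tm = (δ * K) * k * (h * n) := by rw [hTm]; ring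
      have h2 : 1 * 42 ≤ (δ * K) * k := by
        refine mul_le_mul (by linarith) hk (by norm_num) (by linarith)
      have h3 : (1 * 42) * (h * n) ≤ (δ * K) * k * (h * n) := by gcongr
      rw [h1]
      linarith
  calc _ = (ℓ * (2 * ℓ)) * Real.exp (-((1 - 2 * δ) * h * ℓ)) +
        (ℓ * (Tm + ℓ)) * Real.exp (2 * δ * h * (Tm + ℓ) - h * ℓ + (1 + δ / 2) * E * n) +
        (ℓ * (1 + 1 / (δ * h))) * Real.exp (-(δ * h * Tm)) := by ring
    _ ≤ 1 := by linarith

/-- The number of words of length `M` allowed by few returns is too small. -/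
theorem stage_cost (r : Regime E ε δ h K n M) {ℓ R : ℕ}
    (hℓ : (ℓ : ℝ) = (K - 10) * n) (hR : (R : ℝ) = 6 * K * n) :
    (1 + δ / 2) * E * R + Real.exp ((1 + δ / 2) * E * ℓ) *
      ((1 + δ / 2) * E * ℓ + Real.log M) + (1 - 2 * δ) * h * M ≤ h * M / (1 + δ) := by
  have hδ := r.δ_pos
  have hδ' := r.δ_le
  have hh := r.h_pos
  have hx := r.x_ge
  have hK := r.K_ge'
  have hKz := r.K_le_exp
  have hxz := r.x_le_exp
  have hz := r.hundred_le_exp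
  have hδh := r.δh_ge
  have hδK' := r.δK_le
  have hM := r.exp_le_M
  have hab := fun {X y : ℝ} (a : ℕ) => r.absorb (X := X) (y := y) a
  have hM0 : (0 : ℝ) < M := (Real.exp_pos _).trans_le hM
  have hlogM : Real.log M ≤ (K + 4) * (E * n) := by
    rw [Real.log_le_iff_le_exp hM0]; exact r.M_le_exp
  -- Since `1 / (1 + δ) ≥ 1 - δ`, a margin of `δ h M` over `(1 - 2δ) h M` is available for the other
  -- two terms.
  have hdiv : h * M * (1 - δ) ≤ h * M / (1 + δ) := by
    rw [le_div_iff₀ (by linarith)]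
    have : 0 < h * M := by positivity
    nlinarith [sq_nonneg δ]
  suffices hs : (1 + δ / 2) * E * R + Real.exp ((1 + δ / 2) * E * ℓ) *
      ((1 + δ / 2) * E * ℓ + Real.log M) ≤ δ * h * M by nlinarith
  have hEℓ : (1 + δ / 2) * E * ℓ ≤ (K - 9.4) * (E * n) := by
    rw [hℓ]
    have h1 : (1 + δ / 2) * E * ((K - 10) * n) = (K - 10 + (δ * K) / 2 - 5 * δ) * (E * n) := by ring
    rw [h1]
    refine mul_le_mul_of_nonneg_right ?_ (by linarith)
    linarith
  have hER : (1 + δ / 2) * E * R ≤ 7 * K * (E * n) := by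
    rw [hR]
    have h1 : (1 + δ / 2) * E * (6 * K * n) = (6 * (1 + δ / 2)) * (K * (E * n)) := by ring
    have h2 : 0 < K * (E * n) := by nlinarith
    rw [h1]
    nlinarith
  have hB1 : 1 ≤ Real.exp ((K - 9.4) * (E * n)) := by
    refine Real.one_le_exp (mul_nonneg ?_ ?_) <;> linarith
  set B := Real.exp ((K - 9.4) * (E * n)) with hB
  have h1 : (1 + δ / 2) * E * R + Real.exp ((1 + δ / 2) * E * ℓ) *
      ((1 + δ / 2) * E * ℓ + Real.log M) ≤ B * (7 * K * (E * n)) +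
      B * ((K - 9.4) * (E * n) + (K + 4) * (E * n)) := by
    have hxx : 0 ≤ 7 * K * (E * n) := by nlinarith
    have hp : 0 ≤ (1 + δ / 2) * E * ℓ + Real.log M := by
      have := r.E_pos
      have := Real.log_natCast_nonneg M
      positivity
    refine add_le_add (hER.trans ?_) (mul_le_mul (Real.exp_le_exp.2 hEℓ) (by linarith) hp (by linarith))
    exact le_mul_of_one_le_left hxx hB1
  refine h1.trans ?_
  -- Here the `10` in `ℓ = (K - 10) n` is used: `exp ((1 + δ / 2) E ℓ)`, which bounds the number of
  -- words of length `ℓ`, remains a factor `exp (9.4 E n)` below `M`.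
  have hM' : B * Real.exp (9.4 * (E * n)) ≤ M := by
    rw [hB, ← Real.exp_add]
    refine le_trans (le_of_eq ?_) hM
    ring_nf
  have h2 : (9 * K ^ 3 * (E * n)) * Real.exp (-(9.4 * (E * n))) ≤ 1 / 100 := by
    refine hab 5 ?_ (by push_cast; linarith)
    set z := Real.exp (E * n / 20)
    calc 9 * (K : ℝ) ^ 3 * (E * n) ≤ z * z ^ 3 * z := by
          have := r.K_pos
          gcongr; linarith
      _ = z ^ 5 := by ring
  have h3 : 9 * K ^ 3 * (E * n) ≤ Real.exp (9.4 * (E * n)) := by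
    rw [Real.exp_neg, ← div_eq_mul_inv, div_le_iff₀ (Real.exp_pos _)] at h2
    have := Real.exp_pos (9.4 * (E * n))
    linarith
  have hK2 : (0 : ℝ) < K ^ 2 := by have := r.K_pos; positivity
  have h4 : 9 * K * (E * n) ≤ δ * h * Real.exp (9.4 * (E * n)) := by
    have h5 : 9 * K * (E * n) * K ^ 2 ≤ δ * h * Real.exp (9.4 * (E * n)) * K ^ 2 := by
      calc 9 * K * (E * n) * K ^ 2 = 9 * K ^ 3 * (E * n) := by ring
        _ ≤ Real.exp (9.4 * (E * n)) := h3
        _ ≤ (δ * h * K ^ 2) * Real.exp (9.4 * (E * n)) :=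
            le_mul_of_one_le_left (Real.exp_pos _).le (by linarith)
        _ = _ := by ring
    exact le_of_mul_le_mul_right h5 hK2
  calc _ = B * ((9 * K - 5.4) * (E * n)) := by ring
    _ ≤ B * (9 * K * (E * n)) := by gcongr; linarith
    _ ≤ B * (δ * h * Real.exp (9.4 * (E * n))) := by gcongr
    _ = δ * h * (B * Real.exp (9.4 * (E * n))) := by ring
    _ ≤ δ * h * M := by gcongr

end Regime

namespace Regime

variable {E ε δ h : ℝ} {K n M : ℕ}

theorem E1x_le (r : Regime E ε δ h K n M) (y : ℝ) (hy : 0 ≤ y) :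
    (1 + δ / 2) * E * (y * K * n) ≤ (y * K + y * 0.505) * (E * n) := by
  have hδK := r.δK_le
  have hδ := r.δ_le
  have hx := r.x_ge
  have h1 : (1 + δ / 2) * E * (y * K * n) = (y * K + y * ((δ * K) / 2)) * (E * n) := by ring
  rw [h1]
  have : (δ * K) / 2 ≤ 0.505 := by linarith
  gcongr

/-- The right-hand side is the size `s` of the random set of blocks; random selection needs twice
the number `T / d ≤ M` of blocks in a word to be at most `s`. -/
theorem two_M_le_floor (r : Regime E ε δ h K n M) :
    2 * M ≤ ⌊Real.exp ((2 * K - 11) * (E * n))⌋₊ := by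
  refine Nat.le_floor ?_
  push_cast
  have hx := r.x_ge
  have hK := r.K_ge'
  have h1 := r.M_le_exp
  have h2 : (2 : ℝ) ≤ Real.exp (E * n) := by
    have := Real.add_one_le_exp (E * n)
    linarith
  calc 2 * (M : ℝ) ≤ Real.exp (E * n) * Real.exp ((K + 4) * (E * n)) := by gcongr
    _ = Real.exp ((K + 5) * (E * n)) := by rw [← Real.exp_add]; ring_nf
    _ ≤ _ := by
      refine Real.exp_le_exp.2 (mul_le_mul_of_nonneg_right ?_ ?_) <;> linarith

/-- There are at most `exp ((2 K + 1.01) E n)` blocks, of which about `exp ((2 K - 11) E n)` are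
kept. The quotient costs `12.01 E n`; the factor `2` and the rounding cost less than `0.05 E n`. -/
theorem density_ge (r : Regime E ε δ h K n M) {d : ℕ} (hd : (d : ℝ) = 2 * K * n) {Q : ℝ}
    (hQ : 0 < Q) (hQd : Q ≤ Real.exp ((1 + δ / 2) * E * d)) :
    Real.exp (-(12.1 * (E * n))) ≤ (⌊Real.exp ((2 * K - 11) * (E * n))⌋₊ : ℝ) / (2 * Q) := by
  have hx := r.x_ge
  have hK := r.K_ge'
  have h1 := Nat.lt_floor_add_one (Real.exp ((2 * K - 11) * (E * n)))
  have h2 : (2 : ℝ) ≤ Real.exp ((2 * K - 11) * (E * n)) := by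
    have := Real.add_one_le_exp ((2 * K - 11) * (E * n))
    nlinarith
  rw [le_div_iff₀ (by positivity)]
  have h3 : (4 : ℝ) ≤ Real.exp (0.05 * (E * n)) := by
    have := Real.add_one_le_exp (0.05 * (E * n))
    linarith
  have h4 : Real.exp ((1 + δ / 2) * E * d) ≤ Real.exp ((2 * K + 1.01) * (E * n)) := by
    refine Real.exp_le_exp.2 ?_
    rw [hd]
    refine (r.E1x_le 2 (by norm_num)).trans (le_of_eq (by ring))
  have h5 : Real.exp (-(12.1 * (E * n))) * (4 * Q) ≤ Real.exp ((2 * K - 11) * (E * n)) := by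
    calc _ ≤ Real.exp (-(12.1 * (E * n))) *
          (Real.exp (0.05 * (E * n)) * Real.exp ((2 * K + 1.01) * (E * n))) := by
          gcongr; exact hQd.trans h4
      _ = Real.exp ((2 * K - 11.04) * (E * n)) := by
          rw [← Real.exp_add, ← Real.exp_add]; ring_nf
      _ ≤ _ := by
        refine Real.exp_le_exp.2 (mul_le_mul_of_nonneg_right ?_ ?_) <;> linarith
  linarith

/-- The balance of all losses. Fixing both ends costs `2 (1 + δ / 2) E R ≤ 62 E δ T`, as `T ≥ K n k`
with `k` about `K / 5`; the blocks cost `12.1 E n` per `2 K n` letters, at most `6.05 E δ` per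
letter. Since `h ≥ E / 2` and `ε E = 105 (4 + 2 E) δ`, the sum `68.05 E δ` fits into `(ε - 3δ) h`.
-/
theorem total_cost (r : Regime E ε δ h K n M) {d R k : ℕ} {T : ℝ} (hd : (d : ℝ) = 2 * K * n)
    (hR : (R : ℝ) = 6 * K * n) (hk : (K : ℝ) / 5 - 4 / 5 ≤ k) (hT : K * n * k ≤ T) :
    (1 - ε) * h * T ≤ (1 - 3 * δ) * h * T - 2 * ((1 + δ / 2) * E * R) -
      12.1 * (E * n) * (T / d) := by
  have hx := r.x_ge
  have hK := r.K_ge'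
  have hδ := r.δ_pos
  have hδ' := r.δ_le
  have hE := r.E_pos
  have hn := r.n_pos
  have hδK := r.δK_ge
  have hhE := r.h_ge
  have hεE := r.εE
  have hk0 : (0 : ℝ) < k := by linarith
  have hT0 : 0 < T := lt_of_lt_of_le (by have := r.K_pos; positivity) hT
  have h1 : 12.1 * (E * n) * (T / d) ≤ 6.05 * (E * δ) * T := by
    rw [hd]
    have hK0 := r.K_pos
    have : 12.1 * (E * n) * (T / (2 * K * n)) = 6.05 * E * T * (1 / K) := by
      field_simp; ring
    rw [this]
    have h2 : 1 / (K : ℝ) ≤ δ := by rw [div_le_iff₀ hK0]; linarith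
    calc 6.05 * E * T * (1 / K) ≤ 6.05 * E * T * δ := by gcongr
      _ = _ := by ring
  have h2 : 2 * ((1 + δ / 2) * E * R) ≤ 62 * (E * δ) * T := by
    have h3 : 2 * ((1 + δ / 2) * E * R) ≤ 12.03 * (E * (K * n)) := by
      rw [hR]
      have : 0 < E * (K * n) := by have := r.K_pos; positivity
      nlinarith
    have h4 : 1 ≤ 5.11 * (δ * k) := by
      have : δ * ((K : ℝ) / 5 - 4 / 5) ≤ δ * k := by gcongr
      nlinarith
    have h5 : (K : ℝ) * n ≤ 5.11 * δ * T := by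
      have hKn : (0 : ℝ) ≤ K * n := by positivity
      calc (K : ℝ) * n ≤ K * n * (5.11 * (δ * k)) := le_mul_of_one_le_right hKn h4
        _ = 5.11 * δ * (K * n * k) := by ring
        _ ≤ 5.11 * δ * T := by gcongr
    have h6 : E * (K * n) ≤ E * (5.11 * δ * T) := by gcongr
    have h7 : 0 ≤ E * (δ * T) := by positivity
    nlinarith
  have h3 : 68.05 * (E * δ) ≤ (ε - 3 * δ) * h := by
    have h4 : 0 ≤ ε - 3 * δ := by
      have : 0 ≤ (ε - 3 * δ) * E := by nlinarith
      exact nonneg_of_mul_nonneg_left this hE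
    have h5 : (ε - 3 * δ) * (E / 2) ≤ (ε - 3 * δ) * h := by gcongr
    nlinarith
  have h4 : 68.05 * (E * δ) * T ≤ (ε - 3 * δ) * h * T := by gcongr
  nlinarith

/-- Counted in multiples of `E n`, the block contributes `2 K - 11` and the two remaining pieces
together at most `4 K + 4.04`. The sum lies below `6 K - 6`, whereas the right-hand side is at least
`6 K - 4.1`; the difference absorbs the factor `8 K n`. -/
theorem block_cost (r : Regime E ε δ h K n M) {d R : ℕ} (hd : (d : ℝ) = 2 * K * n)
    (hR : (R : ℝ) = 6 * K * n) :
    R + d * (Real.exp ((2 * K - 11) * (E * n)) *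
      Real.exp ((1 + δ / 2) * E * (R - d + 2 * n))) ≤
    Real.exp ((1 - δ / 2) * E * R - (1 + δ / 2) * E * n) := by
  have hx := r.x_ge
  have hK := r.K_ge'
  have hδ := r.δ_pos
  have hδ' := r.δ_le
  have hKz := r.K_le_exp
  have hnz := r.n_le_exp
  have hz := r.hundred_le_exp
  have hδK := r.δK_le
  have hn := r.n_pos
  set z := Real.exp (E * n / 20) with hzd
  have hz0 : 0 < z := Real.exp_pos _
  have hzx : z ^ 20 = Real.exp (E * n) := by
    rw [hzd, ← Real.exp_nat_mul]; push_cast; ring_nf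
  have hKn : (K : ℝ) * n ≤ z ^ 2 := by
    rw [sq]
    exact mul_le_mul hKz hnz hn.le hz0.le
  have h1 : (1 + δ / 2) * E * (R - d + 2 * n) ≤ (4 * K + 4.04) * (E * n) := by
    have h2 := r.E1x_le 4 (by norm_num)
    have h3 : (1 + δ / 2) * E * (R - d + 2 * n) =
        (1 + δ / 2) * E * (4 * K * n) + (2 + δ) * (E * n) := by rw [hR, hd]; ring
    have h4 : (2 + δ) * (E * n) ≤ 2.01 * (E * n) := by
      refine mul_le_mul_of_nonneg_right ?_ ?_ <;> linarith
    linarith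
  have h2 : (6 * K - 4.1) * (E * n) ≤ (1 - δ / 2) * E * R - (1 + δ / 2) * E * n := by
    have h3 : (1 - δ / 2) * E * R - (1 + δ / 2) * E * n =
      (6 * K - 3 * (δ * K) - 1 - δ / 2) * (E * n) := by rw [hR]; ring
    rw [h3]
    refine mul_le_mul_of_nonneg_right ?_ ?_ <;> linarith
  have h3 : Real.exp ((2 * K - 11) * (E * n)) *
      Real.exp ((1 + δ / 2) * E * (R - d + 2 * n)) ≤ Real.exp ((6 * K - 6) * (E * n)) := by
    rw [← Real.exp_add]
    refine Real.exp_le_exp.2 ?_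
    nlinarith
  have h4 : (1 : ℝ) ≤ Real.exp ((6 * K - 6) * (E * n)) := by
    refine Real.one_le_exp (mul_nonneg ?_ ?_) <;> linarith
  have h5 : (8 * (K * n : ℝ)) ≤ Real.exp (E * n) := by
    rw [← hzx]
    calc 8 * ((K : ℝ) * n) ≤ z * z ^ 2 := by gcongr; linarith
      _ = z ^ 3 := by ring
      _ ≤ z ^ 20 := pow_le_pow_right₀ (by linarith) (by norm_num)
  calc _ ≤ 6 * K * n * Real.exp ((6 * K - 6) * (E * n)) +
        2 * K * n * Real.exp ((6 * K - 6) * (E * n)) := by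
        rw [hR, hd] at *
        refine add_le_add ?_ (by gcongr)
        exact le_mul_of_one_le_right (by have := r.K_pos; positivity) h4
    _ = (8 * (K * n : ℝ)) * Real.exp ((6 * K - 6) * (E * n)) := by ring
    _ ≤ Real.exp (E * n) * Real.exp ((6 * K - 6) * (E * n)) := by gcongr
    _ = Real.exp ((6 * K - 5) * (E * n)) := by rw [← Real.exp_add]; ring_nf
    _ ≤ _ := by
      refine Real.exp_le_exp.2 (le_trans ?_ h2)
      refine mul_le_mul_of_nonneg_right ?_ ?_ <;> linarith

end Regime

/-! ### Long first returns -/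

section Returns

variable {A : Type*}

/-- The words of `Λ` that can be prolonged by `R` letters. -/
def prolongable (Λ : Set (List A)) (R : ℕ) : Set (List A) :=
  {v | ∃ t : List A, t.length = R ∧ v ++ t ∈ Λ}

theorem prolongable_subset {Λ : Set (List A)} (hΛ : FactorClosed Λ) (R : ℕ) :
    prolongable Λ R ⊆ Λ := by
  rintro v ⟨t, -, h⟩
  exact hΛ h (List.prefix_append _ _).isInfix

theorem prolongable_closed {Λ : Set (List A)} (hΛ : FactorClosed Λ) (R : ℕ) :
    FactorClosed (prolongable Λ R) := by
  rintro u v ⟨t, ht, hv⟩ ⟨a, b, rfl⟩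
  refine ⟨(b ++ t).take R, by simp [ht], hΛ hv ?_⟩
  refine List.IsInfix.trans ?_ (show u ++ (b ++ t) <:+: a ++ u ++ b ++ t from ⟨a, [], by simp⟩)
  rw [List.append_assoc] at *
  exact ((List.prefix_append_right_inj u).2 (List.take_prefix _ _)).isInfix

/-- A finite language that satisfies the bounds given by `f`, together with the two lengths `n` and
`M` at which the rates are nearly the same. -/
structure Source (f : ℕ → ℝ) (Λ : Set (List A)) (E δ h : ℝ) (n M : ℕ) : Prop where
  closed : FactorClosed Λ
  exp_le : ∀ m : ℕ, Real.exp (E * m) ≤ f m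
  count_le : ∀ m ≤ M, ((level Λ m).ncard : ℝ) ≤ f m
  le_exp : ∀ m ≥ n, f m ≤ Real.exp ((1 + δ / 2) * E * m)
  le_exp_of_le : ∀ m ≤ n, f m ≤ Real.exp ((1 + δ / 2) * E * n)
  count_n : ((level Λ n).ncard : ℝ) = Real.exp (h * n)
  count_M : Real.exp (h * M / (1 + δ)) < (level Λ M).ncard

theorem Source.f_le {f : ℕ → ℝ} {Λ : Set (List A)} {E δ h : ℝ} {n M : ℕ} (s : Source f Λ E δ h n M) (hE : 0 ≤ E) (hδ : 0 ≤ δ) (m : ℕ) :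
    f m ≤ Real.exp ((1 + δ / 2) * E * (m + n)) := by
  have h0 : 0 ≤ (1 + δ / 2) * E := by positivity
  have hm : (0 : ℝ) ≤ m := Nat.cast_nonneg m
  have hn : (0 : ℝ) ≤ n := Nat.cast_nonneg n
  rcases le_total n m with h | h
  · refine (s.le_exp m h).trans (Real.exp_le_exp.2 ?_)
    exact mul_le_mul_of_nonneg_left (by linarith) h0
  · refine (s.le_exp_of_le m h).trans (Real.exp_le_exp.2 ?_)
    exact mul_le_mul_of_nonneg_left (by linarith) h0

variable [Finite A]

/-- Restricting to words that can be prolonged costs no more than a factor `|level Λ R|`. -/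
theorem level_le_prolongable {Λ : Set (List A)} (hΛ : FactorClosed Λ) (a R : ℕ) :
    (level Λ (a + R)).ncard ≤ (level (prolongable Λ R) a).ncard * (level Λ R).ncard := by
  rw [← Set.ncard_prod]
  refine Set.ncard_le_ncard_of_injOn (fun v => (v.take a, v.drop a)) ?_ ?_
    ((level_finite _ _).prod (level_finite _ _))
  · rintro v ⟨hv, hl⟩
    refine ⟨⟨⟨v.drop a, by simp [hl], by simpa using hv⟩, by simp [hl]⟩,
      ⟨hΛ hv (List.drop_suffix _ _).isInfix, by simp [hl]⟩⟩
  · intro v _ w _ h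
    simp only [Prod.mk.injEq] at h
    rw [← List.take_append_drop a v, ← List.take_append_drop a w, h.1, h.2]

theorem level_mono {Λ Λ' : Set (List A)} (h : Λ ⊆ Λ') (m : ℕ) :
    (level Λ m).ncard ≤ (level Λ' m).ncard :=
  Set.ncard_le_ncard (fun _ hv => ⟨h hv.1, hv.2⟩) (level_finite _ _)

theorem level_mul_add_le {Λ : Set (List A)} (hΛ : FactorClosed Λ) (c n r : ℕ) :
    (level Λ (c * n + r)).ncard ≤ (level Λ n).ncard ^ c * (level Λ r).ncard := by
  induction c with
  | zero => simp
  | succ c ih =>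
    rw [show (c + 1) * n + r = n + (c * n + r) by ring]
    refine (level_add_le hΛ _ _).trans ?_
    calc _ ≤ (level Λ n).ncard * ((level Λ n).ncard ^ c * (level Λ r).ncard) := by gcongr
      _ = _ := by ring

namespace Source

variable {f : ℕ → ℝ} {Λ : Set (List A)} {E ε δ h : ℝ} {K n M : ℕ}

/-- Cut into pieces of length `n`, each with `exp (h n)` possibilities; the remainder is shorter
than `n` and gives the additive term. -/
theorem count_le_rate (s : Source f Λ E δ h n M) (r : Regime E ε δ h K n M) {t : ℕ}
    (ht : t ≤ M) : ((level Λ t).ncard : ℝ) ≤ Real.exp (h * t + (1 + δ / 2) * E * n) := by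
  have hn : 0 < n := by exact_mod_cast r.n_pos
  have hmod := Nat.mod_lt t hn
  have h1 : ((level Λ t).ncard : ℝ) ≤
      ((level Λ n).ncard : ℝ) ^ (t / n) * ((level Λ (t % n)).ncard : ℝ) := by
    have h2 := level_mul_add_le s.closed (t / n) n (t % n)
    rw [mul_comm (t / n) n, Nat.div_add_mod] at h2
    exact_mod_cast h2
  have h3 : ((level Λ (t % n)).ncard : ℝ) ≤ Real.exp ((1 + δ / 2) * E * n) :=
    (s.count_le _ ((Nat.mod_le _ _).trans ht)).trans (s.le_exp_of_le _ hmod.le)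
  refine h1.trans ?_
  rw [s.count_n, ← Real.exp_nat_mul, Real.exp_add]
  have h4 : ((t / n : ℕ) : ℝ) * (h * n) ≤ h * t := by
    have h5 : ((t / n : ℕ) : ℝ) * n ≤ t := by exact_mod_cast Nat.div_mul_le_self t n
    have := r.h_pos
    nlinarith
  gcongr

/-- Some word of length `(K - 10) n` has many long first returns of the same length. -/
theorem exists_firstReturns (s : Source f Λ E δ h n M) (r : Regime E ε δ h K n M) {ℓ Tm R k : ℕ}
    (hℓ : (ℓ : ℝ) = (K - 10) * n) (hTm : (Tm : ℝ) = K * n * k) (hR : (R : ℝ) = 6 * K * n)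
    (hk : (42 : ℝ) ≤ k) (hk' : (k : ℝ) ≤ K / 5) (hM : R + ℓ < M) :
    ∃ u : List A, u.length = ℓ ∧ ∃ T, Tm ≤ T ∧ T + ℓ + R ≤ M ∧
      Real.exp ((1 - 3 * δ) * h * T) < (firstReturns (prolongable Λ R) u T).ncard := by
  by_contra! hcon
  have hE := r.E_pos
  have hδ := r.δ_pos
  have hδ' := r.δ_le
  have hh := r.h_pos
  have hn := r.n_pos
  have hK := r.K_ge'
  have hcl := prolongable_closed s.closed R
  have hsub := prolongable_subset s.closed R
  have hℓ0 : 0 < ℓ := by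
    have : (0 : ℝ) < ℓ := by rw [hℓ]; exact mul_pos (by linarith) hn
    exact_mod_cast this
  have hℓn : n ≤ ℓ := by
    have : (n : ℝ) ≤ ℓ := by rw [hℓ]; nlinarith
    exact_mod_cast this
  have hH : 0 ≤ (1 - 2 * δ) * h := mul_nonneg (by linarith) hh.le
  -- From words of length `M` the last `R` letters are spent on the prolongation, and `ℓ` on the
  -- final occurrence of `u`.
  set L := M - R - ℓ with hL
  -- Short distances leave one word only, medium ones are bounded by the free letters between the
  -- two copies of `u`, and long ones by the assumption to be refuted.
  have hbound : ∀ u : List A, u.length = ℓ → ∀ T ≤ L,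
      ((firstReturns (prolongable Λ R) u T).ncard : ℝ) ≤ Regime.returnBound E δ h n u.length Tm T := by
    intro u hu T hT
    have hle : ((firstReturns (prolongable Λ R) u T).ncard : ℝ) ≤
        (returns (prolongable Λ R) u T).ncard := by
      have hsubset : firstReturns (prolongable Λ R) u T ⊆ returns (prolongable Λ R) u T :=
        fun v hv => hv.1
      exact_mod_cast Set.ncard_le_ncard hsubset (returns_finite _ _ _)
    unfold Regime.returnBound
    rw [hu]
    split_ifs with h1 h2
    · refine hle.trans ?_
      exact_mod_cast returns_ncard_le_one _ u (by omega)
    · refine hle.trans ?_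
      have h3 : ((returns (prolongable Λ R) u T).ncard : ℝ) ≤
          (level Λ (T - ℓ)).ncard := by
        have := (returns_ncard_le_level hcl u (T := T) (by omega)).trans (level_mono hsub _)
        rw [hu] at this
        exact_mod_cast this
      refine h3.trans ((s.count_le_rate r (by omega)).trans (le_of_eq ?_))
      rw [Nat.cast_sub (by omega)]
    · exact hcon u hu T (by omega) (by omega)
  have hret : ∀ u : List A, u.length = ℓ → ∀ i ≤ L,
      ((returns (prolongable Λ R) u i).ncard : ℝ) ≤ Real.exp ((1 - 2 * δ) * h * i) := by
    intro u hu i hi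
    refine returns_le_exp hcl (by omega) hH (hbound u hu) ?_ hi
    rw [hu]
    exact r.sum_returnBound_le hℓ hTm hk hk' L
  have hlev := level_le_exp hcl hH hret
  have h1 : ((level Λ M).ncard : ℝ) ≤
      (level (prolongable Λ R) (L + ℓ)).ncard * (level Λ R).ncard := by
    have := level_le_prolongable s.closed (L + ℓ) R
    rw [show L + ℓ + R = M by omega] at this
    exact_mod_cast this
  have hRn : n ≤ R := by
    have : (n : ℝ) ≤ R := by rw [hR]; nlinarith
    exact_mod_cast this
  have hqR : ((level Λ R).ncard : ℝ) ≤ Real.exp ((1 + δ / 2) * E * R) :=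
    (s.count_le R (by omega)).trans (s.le_exp R hRn)
  have hqℓ : ((level (prolongable Λ R) ℓ).ncard : ℝ) ≤ Real.exp ((1 + δ / 2) * E * ℓ) :=
    (Nat.cast_le.2 (level_mono hsub ℓ)).trans ((s.count_le ℓ (by omega)).trans (s.le_exp ℓ hℓn))
  set c := (level (prolongable Λ R) ℓ).ncard with hc
  have hM0 : (1 : ℝ) ≤ M := by exact_mod_cast (by omega : 1 ≤ M)
  have hEℓ0 : 0 ≤ (1 + δ / 2) * E * ℓ := by positivity
  -- The exponent `c` is at most `exp ((1 + δ / 2) E ℓ)`, so this factor is the double exponential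
  -- that `Regime.stage_cost` compares with `exp (δ h M)`.
  have hpow : ((c : ℝ) * (L + 1)) ^ c ≤ Real.exp (Real.exp ((1 + δ / 2) * E * ℓ) *
      ((1 + δ / 2) * E * ℓ + Real.log M)) := by
    have hlogM := Real.log_nonneg hM0
    have hLM : (L : ℝ) + 1 ≤ M := by exact_mod_cast (by omega : L + 1 ≤ M)
    have h2 : (c : ℝ) * (L + 1) ≤ Real.exp ((1 + δ / 2) * E * ℓ + Real.log M) := by
      rw [Real.exp_add, Real.exp_log (by linarith)]
      gcongr
    calc _ ≤ Real.exp ((1 + δ / 2) * E * ℓ + Real.log M) ^ c := by gcongr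
      _ = Real.exp (c * ((1 + δ / 2) * E * ℓ + Real.log M)) := by rw [Real.exp_nat_mul]
      _ ≤ _ := by gcongr
  have hcost := r.stage_cost hℓ hR
  have hLM : (L : ℝ) ≤ M := by exact_mod_cast (by omega : L ≤ M)
  have hfin : ((level Λ M).ncard : ℝ) ≤ Real.exp (h * M / (1 + δ)) := by
    calc ((level Λ M).ncard : ℝ) ≤ (level (prolongable Λ R) (L + ℓ)).ncard *
          (level Λ R).ncard := h1
      _ ≤ (Real.exp (Real.exp ((1 + δ / 2) * E * ℓ) * ((1 + δ / 2) * E * ℓ + Real.log M)) *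
          Real.exp ((1 - 2 * δ) * h * M)) * Real.exp ((1 + δ / 2) * E * R) := by
          refine mul_le_mul (hlev.trans ?_) hqR (Nat.cast_nonneg _) (by positivity)
          gcongr
      _ = Real.exp ((1 + δ / 2) * E * R + Real.exp ((1 + δ / 2) * E * ℓ) *
          ((1 + δ / 2) * E * ℓ + Real.log M) + (1 - 2 * δ) * h * M) := by
          rw [← Real.exp_add, ← Real.exp_add]; ring_nf
      _ ≤ _ := Real.exp_le_exp.2 hcost
  exact absurd s.count_M (not_lt.2 hfin)

end Source

end Returns

/-! ### Thinning out a set of words -/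

section Selection

variable {A : Type*} [Finite A]

theorem exists_large_fiber {α β : Type*} {S : Set α} (hS : S.Finite) (hne : S.Nonempty)
    {F : Set β} (hF : F.Finite) (g : α → β) (hg : ∀ v ∈ S, g v ∈ F) :
    ∃ p, S.ncard ≤ {v | v ∈ S ∧ g v = p}.ncard * F.ncard := by
  classical
  have hFne : hF.toFinset.Nonempty := by
    obtain ⟨v, hv⟩ := hne
    exact ⟨g v, hF.mem_toFinset.2 (hg v hv)⟩
  have hsub : S ⊆ ⋃ p ∈ hF.toFinset, {v | v ∈ S ∧ g v = p} := fun v hv =>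
    Set.mem_iUnion₂.2 ⟨g v, hF.mem_toFinset.2 (hg v hv), hv, rfl⟩
  have h1 := (Set.ncard_le_ncard hsub (Set.Finite.biUnion (Finset.finite_toSet _)
    fun p _ => hS.subset fun v hv => hv.1)).trans (Finset.set_ncard_biUnion_le _ _)
  obtain ⟨p, -, hp⟩ := Finset.exists_max_image hF.toFinset
    (fun p => {v | v ∈ S ∧ g v = p}.ncard) hFne
  refine ⟨p, h1.trans ((Finset.sum_le_card_nsmul _ _ _ hp).trans ?_)⟩
  rw [smul_eq_mul, mul_comm, Set.ncard_eq_toFinset_card F hF]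

/-- From a set of words of length `T` one can select many words whose aligned blocks of length `d`
belong to a set with `s` elements. -/
theorem exists_block_selection {Λ : Set (List A)} {S : Set (List A)} {T d s : ℕ} (hd : 0 < d)
    (hlen : ∀ v ∈ S, v.length = T)
    (hblock : ∀ v ∈ S, ∀ i, (i + 1) * d ≤ T → (v.drop (i * d)).take d ∈ level Λ d)
    (hs : 2 * (T / d) ≤ s) {ρ : ℝ} (hρ0 : 0 ≤ ρ) (hρ1 : ρ ≤ 1)
    (hρ : 0 < (level Λ d).ncard → ρ ≤ (s : ℝ) / (2 * (level Λ d).ncard)) :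
    ∃ D : Set (List A), D.Finite ∧ D.ncard ≤ s ∧ ∃ S' ⊆ S,
      (∀ v ∈ S', ∀ i, (i + 1) * d ≤ T → (v.drop (i * d)).take d ∈ D) ∧
      (S.ncard : ℝ) * ρ ^ (T / d) ≤ S'.ncard := by
  classical
  have hΩf := level_finite Λ d
  have hSf : S.Finite := finite_of_length T hlen
  -- If there are at most `s` blocks at all, nothing has to be discarded; a subset with exactly `s`
  -- elements exists only in the other case.
  rcases le_or_gt (level Λ d).ncard s with h | h
  · refine ⟨level Λ d, hΩf, h, S, subset_rfl, hblock, ?_⟩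
    exact mul_le_of_le_one_right (Nat.cast_nonneg _) (pow_le_one₀ hρ0 hρ1)
  · have hcard : hΩf.toFinset.card = (level Λ d).ncard := (Set.ncard_eq_toFinset_card _ hΩf).symm
    have hiff : ∀ i, i < T / d ↔ (i + 1) * d ≤ T := fun i => by
      rw [← Nat.le_div_iff_mul_le hd]; exact Nat.lt_iff_add_one_le
    obtain ⟨D, -, hDs, hD⟩ := exists_subset_selection hΩf.toFinset hSf.toFinset
      (fun v => (Finset.range (T / d)).image fun i => (v.drop (i * d)).take d) (b := T / d) (s := s)
      (by
        intro v hv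
        rw [Finset.image_subset_iff]
        intro i hi
        rw [Finset.mem_range, hiff] at hi
        exact hΩf.mem_toFinset.2 (hblock v (hSf.mem_toFinset.1 hv) i hi))
      (fun v _ => Finset.card_image_le.trans (by simp)) hs (by omega)
    refine ⟨D, Finset.finite_toSet D, by rw [Set.ncard_coe_finset, hDs],
      {v | v ∈ S ∧ ∀ i, (i + 1) * d ≤ T → (v.drop (i * d)).take d ∈ D}, fun v hv => hv.1,
      fun v hv => hv.2, ?_⟩
    have hS' : ((hSf.toFinset.filter fun v => ((Finset.range (T / d)).image fun i =>
        (v.drop (i * d)).take d) ⊆ D : Finset (List A)) : Set (List A)) =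
        {v | v ∈ S ∧ ∀ i, (i + 1) * d ≤ T → (v.drop (i * d)).take d ∈ D} := by
      ext v
      simp only [Finset.coe_filter, Set.Finite.mem_toFinset, Set.mem_ofPred_eq,
        Finset.image_subset_iff, Finset.mem_range, hiff]
    rw [← hS', Set.ncard_coe_finset, Set.ncard_eq_toFinset_card S hSf]
    refine le_trans ?_ hD
    have hpos : 0 < (level Λ d).ncard := by omega
    rw [hcard]
    have := hρ hpos
    gcongr

end Selection

/-! ### An infinite word of large entropy below `f` -/

theorem complexity_mul_add_le {q : ℕ} (w : ℕ → Fin q) (c n r : ℕ) :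
    complexity w (c * n + r) ≤ complexity w n ^ c * complexity w r := by
  induction c with
  | zero => simp
  | succ c ih =>
    rw [show (c + 1) * n + r = n + (c * n + r) by ring]
    refine (complexity_add_le w _ _).trans ?_
    calc _ ≤ complexity w n * (complexity w n ^ c * complexity w r) := by gcongr
      _ = _ := by ring

theorem le_entropy_of_pow_le {q : ℕ} (w : ℕ → Fin q) {T : ℕ} (hT : 0 < T) {a : ℝ} (ha : 0 < a)
    (h : ∀ k : ℕ, a ^ k ≤ complexity w (k * T)) : Real.log a / T ≤ entropy w := by
  have hT' : (0 : ℝ) < T := by exact_mod_cast hT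
  have ht : Tendsto (fun k : ℕ => (k + 1) * T) atTop atTop :=
    tendsto_atTop_mono (fun k => by simp only [id]; nlinarith) tendsto_id
  refine ge_of_tendsto' ((entropy_tendsto w).comp ht) fun k => ?_
  have h1 := Real.log_le_log (by positivity) (h (k + 1))
  rw [Real.log_pow] at h1
  simp only [Function.comp]
  rw [div_le_div_iff₀ hT' (by positivity)]
  push_cast at h1 ⊢
  nlinarith

-- The words between consecutive occurrences of `u` are thinned out twice: to common ends of length
-- `R`, which controls the complexity up to `R`, and to few aligned blocks of length `d`, which
-- pushes it below `exp (E R)` at `R`. What remains are at least `exp ((1 - ε) h T)` words of length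
-- `T`, and a universal concatenation of them has the required entropy.
set_option maxHeartbeats 2000000 in
theorem Source.exists_word {q : ℕ} [Inhabited (Fin q)] {f : ℕ → ℝ} {Λ : Set (List (Fin q))}
    {E ε δ h : ℝ} {K n M : ℕ} (s : Source f Λ E δ h n M) (r : Regime E ε δ h K n M) :
    ∃ w ∈ wordsBelow q f, (1 - ε) * h ≤ entropy w := by
  have hE := r.E_pos
  have hδ := r.δ_pos
  have hδ' := r.δ_le
  have hh := r.h_pos
  have hn := r.n_pos
  have hK := r.K_ge'
  have hKN := r.K_ge
  have hx := r.x_ge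
  have hn' : 0 < n := by exact_mod_cast hn
  set ℓ := (K - 10) * n with hℓdef
  set d := 2 * K * n with hddef
  set R := 6 * K * n with hRdef
  set k := K / 5 with hkdef
  set Tm := K * n * k with hTmdef
  have hℓ : (ℓ : ℝ) = (K - 10) * n := by
    rw [hℓdef, Nat.cast_mul, Nat.cast_sub (by omega)]; push_cast; ring
  have hd : (d : ℝ) = 2 * K * n := by rw [hddef]; push_cast; ring
  have hR : (R : ℝ) = 6 * K * n := by rw [hRdef]; push_cast; ring
  have hTm : (Tm : ℝ) = K * n * k := by rw [hTmdef]; push_cast; ring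
  have hk : (42 : ℝ) ≤ k := by exact_mod_cast (by omega : 42 ≤ K / 5)
  have hk1 : (k : ℝ) ≤ K / 5 := by
    rw [le_div_iff₀ (by norm_num)]; exact_mod_cast (by omega : K / 5 * 5 ≤ K)
  have hk2 : (K : ℝ) / 5 - 4 / 5 ≤ k := by
    have h1 : K ≤ 5 * k + 4 := by omega
    have h2 : (K : ℝ) ≤ 5 * k + 4 := by exact_mod_cast h1
    linarith
  have hdpos : 0 < d := by positivity
  have hℓpos : 0 < ℓ := Nat.mul_pos (by omega) hn'
  have hℓR : 2 * d + ℓ ≤ R := by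
    have : ℓ ≤ K * n := Nat.mul_le_mul_right _ (by omega)
    rw [hddef, hRdef]; nlinarith
  have hRTm : R ≤ Tm := by
    have h1 : 42 ≤ k := by exact_mod_cast hk
    have : 0 < K * n := by positivity
    rw [hRdef, hTmdef]; nlinarith
  have hM : R + ℓ < M := by
    have h1 := r.exp_le_M
    have h2 : (R : ℝ) + ℓ < M := by
      have h3 := Real.quadratic_le_exp_of_nonneg (x := K * (E * n)) (by positivity)
      have h4 : 7 * (K * (n : ℝ)) ≤ (K * (E * n)) ^ 2 / 2 := by
        have h5 := r.EK
        have h6 : (K * (E * n)) ^ 2 / 2 = (E * K) * (E * n) * (K * n) / 2 := by ring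
        have h7 : 420 * 420 ≤ (E * K) * (E * n) := mul_le_mul h5 hx (by norm_num) (by linarith)
        have h8 : 0 < (K : ℝ) * n := by have := r.K_pos; positivity
        rw [h6]
        nlinarith
      have h5 : 0 ≤ K * (E * n) := by positivity
      rw [hR, hℓ]
      nlinarith
    exact_mod_cast h2
  obtain ⟨u, hu, T, hTmT, hTM, hbig⟩ := s.exists_firstReturns r hℓ hTm hR hk hk1 hM
  have hΛ := s.closed
  have hΛ' := prolongable_closed hΛ R
  have hRT : R ≤ T := hRTm.trans hTmT
  have hTpos : 0 < T := by omega
  -- the words of length `T` between two occurrences of `u`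
  set S₀ : Set (List (Fin q)) := (fun x => x.take T) '' firstReturns (prolongable Λ R) u T with hS₀
  have hmem₀ : ∀ v ∈ S₀, v.length = T ∧ v ++ u ∈ firstReturns (prolongable Λ R) u T := by
    rintro _ ⟨x, hx, rfl⟩
    have h1 : x.drop T = u := eq_of_prefix_of_length hx.1.2.2.2 (by simp [hx.1.2.1])
    refine ⟨by simp [hx.1.2.1], ?_⟩
    rw [← h1, List.take_append_drop, h1]
    exact hx
  have hcard₀ : S₀.ncard = (firstReturns (prolongable Λ R) u T).ncard := by
    refine Set.InjOn.ncard_image fun x hx y hy hxy => ?_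
    have h1 : x.drop T = u := eq_of_prefix_of_length hx.1.2.2.2 (by simp [hx.1.2.1])
    have h2 : y.drop T = u := eq_of_prefix_of_length hy.1.2.2.2 (by simp [hy.1.2.1])
    have h3 : x.take T = y.take T := hxy
    rw [← List.take_append_drop T x, ← List.take_append_drop T y, h3, h1, h2]
  have hfac₀ : ∀ v ∈ S₀, ∀ x, x <:+: v → x ∈ Λ := fun v hv x hx =>
    hΛ (prolongable_subset hΛ R (hmem₀ v hv).2.1.1) (hx.trans (List.prefix_append _ _).isInfix)
  have hS₀f : S₀.Finite := finite_of_length T fun v hv => (hmem₀ v hv).1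
  have hbig₀ : Real.exp ((1 - 3 * δ) * h * T) < S₀.ncard := by rw [hcard₀]; exact hbig
  have hS₀pos : 0 < S₀.ncard := by
    exact_mod_cast (Real.exp_pos _).trans hbig₀
  -- common beginning and end
  obtain ⟨⟨P, Q⟩, hPQ⟩ := exists_large_fiber hS₀f ((Set.ncard_pos hS₀f).1 hS₀pos)
    (F := level Λ R ×ˢ level Λ R) ((level_finite Λ R).prod (level_finite Λ R))
    (fun v => (v.take R, v.drop (T - R))) (by
      intro v hv
      have hl := (hmem₀ v hv).1
      refine ⟨⟨hfac₀ v hv _ (List.take_prefix _ _).isInfix, by simp [hl, hRT]⟩,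
        ⟨hfac₀ v hv _ (List.drop_suffix _ _).isInfix, ?_⟩⟩
      simp only [List.length_drop, hl]; omega)
  set S₁ : Set (List (Fin q)) := {v | v ∈ S₀ ∧ (v.take R, v.drop (T - R)) = (P, Q)} with hS₁
  rw [Set.ncard_prod] at hPQ
  have hRn : n ≤ R := by rw [hRdef]; nlinarith
  have hdn : n ≤ d := by rw [hddef]; nlinarith
  have hqR : ((level Λ R).ncard : ℝ) ≤ Real.exp ((1 + δ / 2) * E * R) :=
    (s.count_le R (by omega)).trans (s.le_exp R hRn)
  have hqd : ((level Λ d).ncard : ℝ) ≤ Real.exp ((1 + δ / 2) * E * d) :=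
    (s.count_le d (by omega)).trans (s.le_exp d hdn)
  have hcard₁ : Real.exp ((1 - 3 * δ) * h * T - 2 * ((1 + δ / 2) * E * R)) ≤ S₁.ncard := by
    have h1 : (S₀.ncard : ℝ) ≤ S₁.ncard * (((level Λ R).ncard : ℝ) * (level Λ R).ncard) := by
      exact_mod_cast hPQ
    have h2 : (S₀.ncard : ℝ) ≤ S₁.ncard * Real.exp (2 * ((1 + δ / 2) * E * R)) := by
      refine h1.trans ?_
      rw [two_mul, Real.exp_add]
      gcongr
    rw [Real.exp_sub, div_le_iff₀ (Real.exp_pos _)]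
    linarith
  -- the blocks of length `d`
  have hdens := fun hpos => r.density_ge hd (Q := (level Λ d).ncard) (by exact_mod_cast hpos) hqd
  have hTdM : 2 * (T / d) ≤ ⌊Real.exp ((2 * K - 11) * (E * n))⌋₊ := by
    have h1 := r.two_M_le_floor
    have h2 : T / d ≤ T := Nat.div_le_self _ _
    omega
  obtain ⟨D, hDf, hDc, S, hSS₁, hSD, hcard⟩ := exists_block_selection (Λ := Λ) (S := S₁) hdpos
    (fun v hv => (hmem₀ v hv.1).1)
    (fun v hv i hi => ⟨hfac₀ v hv.1 _ (drop_take_infix _ _ _), by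
      rw [add_mul, one_mul] at hi
      simp only [List.length_take, List.length_drop, (hmem₀ v hv.1).1]; omega⟩)
    hTdM (Real.exp_pos _).le (Real.exp_le_one_iff.2 (by linarith)) hdens
  have hlogS : (1 - ε) * h * T ≤ Real.log S.ncard ∧ 0 < S.ncard := by
    have h1 : Real.exp ((1 - 3 * δ) * h * T - 2 * ((1 + δ / 2) * E * R) -
        12.1 * (E * n) * ((T / d : ℕ) : ℝ)) ≤ S.ncard := by
      refine le_trans ?_ hcard
      rw [← Real.exp_nat_mul, sub_eq_add_neg _ (12.1 * (E * n) * ((T / d : ℕ) : ℝ)), Real.exp_add,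
        show ((T / d : ℕ) : ℝ) * -(12.1 * (E * n)) = -(12.1 * (E * n) * ((T / d : ℕ) : ℝ)) by ring]
      gcongr
    have hpos : (0 : ℝ) < S.ncard := (Real.exp_pos _).trans_le h1
    refine ⟨?_, by exact_mod_cast hpos⟩
    rw [Real.le_log_iff_exp_le hpos]
    refine (Real.exp_le_exp.2 ?_).trans h1
    have h2 := r.total_cost (T := T) hd hR hk2 (by rw [← hTm]; exact_mod_cast hTmT)
    have h3 : ((T / d : ℕ) : ℝ) ≤ (T : ℝ) / d := Nat.cast_div_le
    have h4 : 12.1 * (E * n) * ((T / d : ℕ) : ℝ) ≤ 12.1 * (E * n) * ((T : ℝ) / d) := by gcongr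
    linarith
  have hSf : S.Finite := (hS₀f.subset fun v hv => hv.1).subset hSS₁
  have hSne : S.Nonempty := (Set.ncard_pos hSf).1 hlogS.2
  have hF : LoopFamily Λ u T R P Q S :=
    { pos := by omega
      le_R := by omega
      R_le := hRT
      length_eq := fun v hv => (hmem₀ v (hSS₁ hv).1).1
      mem := fun v hv => by
        have h1 := (hmem₀ v (hSS₁ hv).1).2
        exact ⟨⟨prolongable_subset hΛ R h1.1.1, h1.1.2⟩, h1.2⟩
      take_eq := fun v hv => congrArg Prod.fst (hSS₁ hv).2
      drop_eq := fun v hv => congrArg Prod.snd (hSS₁ hv).2 }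
  obtain ⟨v₀, hv₀⟩ := hSne
  -- One prolongable word is enough: it provides the words with `u` strictly inside that compensate
  -- for the junctions.
  obtain ⟨t, ht, hvt⟩ := (hmem₀ v₀ (hSS₁ hv₀).1).2.1.1
  obtain ⟨σ, hσ, hpow⟩ := exists_concat_complexity hTpos ⟨v₀, hv₀⟩ hF.length_eq
  -- the bounds for the complexity
  have hsmall : ∀ m ≤ R, (complexity (concat T σ) m : ℝ) ≤ f m := by
    intro m hm
    refine le_trans ?_ (s.count_le m (by omega))
    rw [complexity_eq_ncard_range]
    exact_mod_cast hF.ncard_range_seg_le hΛ hv₀ ht hvt hσ hm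
  have hfle := s.f_le hE.le hδ.le
  have hatR : (complexity (concat T σ) R : ℝ) ≤
      Real.exp ((1 - δ / 2) * E * R - (1 + δ / 2) * E * n) := by
    refine le_trans ?_ (r.block_cost hd hR)
    have h1 := hF.ncard_range_seg_le_of_blocks hΛ hσ hdpos (by rw [hu]; exact hℓR) hDf hSD
    rw [← complexity_eq_ncard_range] at h1
    have h2 : (complexity (concat T σ) R : ℝ) ≤ R + ∑ a ∈ Finset.range d,
        ((level Λ a).ncard : ℝ) * ((D.ncard : ℝ) * ((level Λ (R - d - a)).ncard : ℝ)) := by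
      exact_mod_cast h1
    refine h2.trans (add_le_add le_rfl ?_)
    have hDr : (D.ncard : ℝ) ≤ Real.exp ((2 * K - 11) * (E * n)) :=
      (Nat.cast_le.2 hDc).trans (Nat.floor_le (Real.exp_pos _).le)
    have h3 : ∀ a ∈ Finset.range d,
        ((level Λ a).ncard : ℝ) * ((D.ncard : ℝ) * ((level Λ (R - d - a)).ncard : ℝ)) ≤
        Real.exp ((2 * K - 11) * (E * n)) * Real.exp ((1 + δ / 2) * E * (R - d + 2 * n)) := by
      intro a ha
      rw [Finset.mem_range] at ha
      have h4 := (s.count_le a (by omega)).trans (hfle a)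
      have h5 := (s.count_le (R - d - a) (by omega)).trans (hfle (R - d - a))
      calc _ ≤ Real.exp ((1 + δ / 2) * E * (a + n)) * (Real.exp ((2 * K - 11) * (E * n)) *
            Real.exp ((1 + δ / 2) * E * ((R - d - a : ℕ) + n))) := by gcongr
        _ = Real.exp ((2 * K - 11) * (E * n)) * (Real.exp ((1 + δ / 2) * E * (a + n)) *
            Real.exp ((1 + δ / 2) * E * ((R - d - a : ℕ) + n))) := by ring
        _ = _ := by
            rw [← Real.exp_add ((1 + δ / 2) * E * (a + n)), Nat.cast_sub (by omega),
              Nat.cast_sub (by omega)]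
            ring_nf
    refine (Finset.sum_le_card_nsmul _ _ _ h3).trans (le_of_eq ?_)
    rw [Finset.card_range, nsmul_eq_mul]
  refine ⟨concat T σ, fun m => ?_, ?_⟩
  · rcases le_total m R with hm | hm
    · exact hsmall m hm
    -- Write `m = c R + ρ`. Each of the `c ≥ 1` pieces of length `R` has a reserve `δ / 2 * E * R +
    -- (1 + δ / 2) * E * n` in the exponent, which pays for the excess `δ / 2 * E * ρ + (1 + δ / 2)
    -- * E * n` of the remainder.
    · have hRpos : 0 < R := by omega
      have h1 : 1 ≤ m / R := (Nat.one_le_div_iff hRpos).2 hm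
      have h2 := complexity_mul_add_le (concat T σ) (m / R) R (m % R)
      have h3 := Nat.div_add_mod m R
      rw [mul_comm (m / R), h3] at h2
      have h4 : (complexity (concat T σ) (m % R) : ℝ) ≤
          Real.exp ((1 + δ / 2) * E * ((m % R : ℕ) + n)) :=
        (hsmall _ (Nat.mod_lt _ hRpos).le).trans (hfle _)
      refine le_trans ?_ (s.exp_le m)
      calc (complexity (concat T σ) m : ℝ) ≤ (complexity (concat T σ) R : ℝ) ^ (m / R) *
            complexity (concat T σ) (m % R) := by exact_mod_cast h2
        _ ≤ Real.exp ((1 - δ / 2) * E * R - (1 + δ / 2) * E * n) ^ (m / R) *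
            Real.exp ((1 + δ / 2) * E * ((m % R : ℕ) + n)) := by gcongr
        _ = Real.exp ((m / R : ℕ) * ((1 - δ / 2) * E * R - (1 + δ / 2) * E * n) +
            (1 + δ / 2) * E * ((m % R : ℕ) + n)) := by rw [← Real.exp_nat_mul, ← Real.exp_add]
        _ ≤ Real.exp (E * m) := by
            refine Real.exp_le_exp.2 ?_
            have h5 : (1 : ℝ) ≤ (m / R : ℕ) := by exact_mod_cast h1
            have h6 : (m : ℝ) = R * (m / R : ℕ) + (m % R : ℕ) := by exact_mod_cast h3.symm
            have h7 : ((m % R : ℕ) : ℝ) ≤ R := by exact_mod_cast (Nat.mod_lt _ hRpos).le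
            set c : ℝ := ((m / R : ℕ) : ℝ)
            set ρ : ℝ := ((m % R : ℕ) : ℝ)
            have h8 : ρ ≤ R * c := by nlinarith [Nat.cast_nonneg (α := ℝ) R]
            have h9 : δ / 2 * E * ρ ≤ δ / 2 * E * (R * c) := by gcongr
            have h10 : (1 + δ / 2) * E * n ≤ c * ((1 + δ / 2) * E * n) :=
              le_mul_of_one_le_left (by positivity) h5
            rw [h6]
            nlinarith
  · have hTr : (0 : ℝ) < T := by exact_mod_cast hTpos
    have h1 := le_entropy_of_pow_le (concat T σ) hTpos (a := S.ncard) (by exact_mod_cast hlogS.2)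
      (fun k => by exact_mod_cast hpow k)
    refine le_trans ?_ h1
    rw [le_div_iff₀ hTr]
    exact hlogS.1

/-! ### The growth rate of `f` -/

namespace CStar

variable {f : ℕ → ℝ}

theorem one_le (hf : CStar f) (n : ℕ) : 1 ≤ f n := by
  have := hf.succ_le n
  have : (0 : ℝ) ≤ n := Nat.cast_nonneg n
  linarith

theorem pos (hf : CStar f) (n : ℕ) : 0 < f n := lt_of_lt_of_le one_pos (hf.one_le n)

theorem mono (hf : CStar f) : Monotone f := monotone_nat_of_le_succ fun n => (hf.lt_succ n).le

theorem subadditive (hf : CStar f) : Subadditive fun n : ℕ => Real.log (f n) := by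
  intro m n
  rw [← Real.log_mul (hf.pos m).ne' (hf.pos n).ne']
  exact Real.log_le_log (hf.pos _) (hf.add_le m n)

theorem log_nonneg (hf : CStar f) (n : ℕ) : 0 ≤ Real.log (f n) := Real.log_nonneg (hf.one_le n)

theorem bddBelow (hf : CStar f) : BddBelow (Set.range fun n : ℕ => Real.log (f n) / n) := by
  refine ⟨0, ?_⟩
  rintro _ ⟨n, rfl⟩
  exact div_nonneg (hf.log_nonneg n) n.cast_nonneg

theorem lim_eq (hf : CStar f) : hf.subadditive.lim = growthRate f :=
  ((hf.subadditive.tendsto_lim hf.bddBelow).liminf_eq).symm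

theorem tendsto (hf : CStar f) :
    Tendsto (fun n : ℕ => Real.log (f n) / n) atTop (𝓝 (growthRate f)) := by
  rw [← hf.lim_eq]
  exact hf.subadditive.tendsto_lim hf.bddBelow

/-- By Fekete's lemma the growth rate is the infimum of `log f(n) / n`, not only the limit. -/
theorem exp_le (hf : CStar f) (n : ℕ) : Real.exp (growthRate f * n) ≤ f n := by
  rcases Nat.eq_zero_or_pos n with rfl | hn
  · simpa using hf.one_le 0
  · have h := hf.subadditive.lim_le_div hf.bddBelow hn.ne'
    rw [hf.lim_eq, le_div_iff₀ (by exact_mod_cast hn), Real.le_log_iff_exp_le (hf.pos n)] at h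
    exact h

/-- For `n ≥ 2 n₀` split off `n₀`: both `n₀` and `n - n₀ ≥ n₀` satisfy the inequality, and `log f`
is subadditive. -/
theorem log_div_lt_iff (hf : CStar f) {n₀ : ℕ} (hn₀ : 1 ≤ n₀) (c : ℝ) :
    (∀ n ∈ Set.Icc n₀ (2 * n₀ - 1), Real.log (f n) / n < c) ↔
      ∀ n ≥ n₀, Real.log (f n) / n < c := by
  refine ⟨fun h n hn => ?_, fun h n hn => h n hn.1⟩
  induction n using Nat.strong_induction_on with
  | _ n ih =>
    rcases le_or_gt n (2 * n₀ - 1) with hle | hgt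
    · exact h n ⟨hn, hle⟩
    · have h1 := ih n₀ (by omega) le_rfl
      have h2 := ih (n - n₀) (by omega) (by omega)
      have h3 := hf.subadditive n₀ (n - n₀)
      rw [Nat.add_sub_cancel' hn] at h3
      rw [div_lt_iff₀ (by exact_mod_cast (by omega : 0 < n₀))] at h1
      rw [div_lt_iff₀ (by exact_mod_cast (by omega : 0 < n - n₀)), Nat.cast_sub hn] at h2
      rw [div_lt_iff₀ (by exact_mod_cast (by omega : 0 < n))]
      linarith

end CStar

/-! ### The parameters -/

theorem delta_pos {ε E : ℝ} (hε : 0 < ε) (hE : 0 < E) : 0 < delta ε E := by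
  unfold delta; positivity

theorem delta_mul {ε E : ℝ} (hE : 0 < E) : ε * E = 105 * (4 + 2 * E) * delta ε E := by
  unfold delta; field_simp

theorem delta_le {ε E : ℝ} (hε1 : ε < 1) (hE : 0 < E) :
    420 * delta ε E + 210 * delta ε E * E ≤ E := by
  have := delta_mul (ε := ε) hE
  nlinarith

theorem K_bounds {ε E : ℝ} (hε : 0 < ε) (hE : 0 < E) :
    1 + delta ε E ≤ delta ε E * K ε E ∧ delta ε E * K ε E ≤ 1 + 2 * delta ε E := by
  have hδ := delta_pos hε hE
  have h1 := Nat.le_ceil (delta ε E)⁻¹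
  have h2 := (Nat.ceil_lt_add_one (inv_pos.2 hδ).le).le
  unfold K
  push_cast
  have h3 : delta ε E * (delta ε E)⁻¹ = 1 := mul_inv_cancel₀ hδ.ne'
  constructor <;> nlinarith

/-- With growth rate `0` the condition `log_lt` would require `log f(n₀) < 0`. -/
theorem Admissible.growthRate_pos {f : ℕ → ℝ} (hf : CStar f) {ε : ℝ} {n₀ : ℕ}
    (h : Admissible f ε n₀) : 0 < growthRate f := by
  have h1 : 0 ≤ growthRate f := by
    rw [← hf.lim_eq]
    exact ge_of_tendsto' (hf.subadditive.tendsto_lim hf.bddBelow)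
      fun n => div_nonneg (hf.log_nonneg n) n.cast_nonneg
  rcases h1.lt_or_eq with h2 | h2
  · exact h2
  · have h3 := h.K_le
    have h4 : 1 ≤ K ε (growthRate f) := by unfold K; omega
    have h5 := h.log_lt n₀ ⟨le_rfl, by omega⟩
    rw [← h2, mul_zero] at h5
    exact absurd h5 (not_lt.2 (div_nonneg (hf.log_nonneg _) (Nat.cast_nonneg _)))

theorem eventually_admissible {f : ℕ → ℝ} (hf : CStar f) {ε : ℝ} (hε : 0 < ε)
    (hE : 0 < growthRate f) : ∀ᶠ n₀ : ℕ in atTop, Admissible f ε n₀ := by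
  have hδ := delta_pos hε hE
  have h1 : growthRate f < (1 + delta ε (growthRate f) / 2) * growthRate f := by nlinarith
  filter_upwards [eventually_ge_atTop (K ε (growthRate f)),
    tendsto_natCast_atTop_atTop.eventually_ge_atTop
      (4 * (K ε (growthRate f) : ℝ) ^ 2 / (420 ^ 3 * growthRate f)),
    eventually_forall_ge_atTop.2 (hf.tendsto.eventually_lt_const h1)] with n₀ h2 h3 h4
  exact ⟨h2, h3, fun n hn => h4 n hn.1⟩

section Scales

variable {f : ℕ → ℝ} {ε : ℝ} {n₀ : ℕ}

theorem scale_le_succ (hε : 0 < ε) (hε1 : ε < 1) {E : ℝ} (hE : 0 < E) (n₀ t : ℕ) :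
    scale ε E n₀ t ≤ scale ε E n₀ (t + 1) := by
  have hδ := delta_pos hε hE
  have h1 := delta_le hε1 hE
  have h2 := (K_bounds hε hE).1
  rw [scale]
  set m := scale ε E n₀ t
  rw [← Nat.cast_le (α := ℝ)]
  refine le_trans ?_ (Nat.le_ceil _)
  have h3 : 1 ≤ E * K ε E := by
    have : 0 ≤ delta ε E * E := by positivity
    have h4 : 420 * delta ε E ≤ E := by nlinarith
    nlinarith [Nat.cast_nonneg (α := ℝ) (K ε E)]
  have h5 : (m : ℝ) ≤ K ε E * ((1 + delta ε E) ^ 2 * E * m + E) := by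
    have hm : (0 : ℝ) ≤ m := Nat.cast_nonneg m
    have h6 : 1 ≤ (1 + delta ε E) ^ 2 := by nlinarith
    have h7 : E * m ≤ (1 + delta ε E) ^ 2 * E * m + E := by
      have : (1 + delta ε E) ^ 2 * E * m = (1 + delta ε E) ^ 2 * (E * m) := by ring
      have : 0 ≤ E * m := by positivity
      nlinarith
    have h8 := mul_le_mul_of_nonneg_left h7 (Nat.cast_nonneg (α := ℝ) (K ε E))
    nlinarith
  linarith [Real.add_one_le_exp (K ε E * ((1 + delta ε E) ^ 2 * E * m + E))]

theorem scale_mono (hε : 0 < ε) (hε1 : ε < 1) {E : ℝ} (hE : 0 < E) (n₀ : ℕ) :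
    Monotone (scale ε E n₀) := monotone_nat_of_le_succ (scale_le_succ hε hε1 hE n₀)

theorem Admissible.le_scale (hf : CStar f) (hε : 0 < ε) (hε1 : ε < 1) (h : Admissible f ε n₀)
    (t : ℕ) : n₀ ≤ scale ε (growthRate f) n₀ t :=
  scale_mono hε hε1 (h.growthRate_pos hf) n₀ (Nat.zero_le t)

theorem Admissible.pos (h : Admissible f ε n₀) : 0 < n₀ := by
  have h1 := h.K_le
  have : 0 < K ε (growthRate f) := Nat.succ_pos _
  omega

theorem Admissible.regime (hf : CStar f) (hε : 0 < ε) (hε1 : ε < 1) (h : Admissible f ε n₀)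
    (t : ℕ) {η : ℝ} (hη : growthRate f / 2 ≤ η) :
    Regime (growthRate f) ε (delta ε (growthRate f)) η (K ε (growthRate f))
      (scale ε (growthRate f) n₀ t) (scale ε (growthRate f) n₀ (t + 1)) := by
  have hE := h.growthRate_pos hf
  have hδ := delta_pos hε hE
  have hle := delta_le hε1 hE
  have hn := h.le_scale hf hε hε1 t
  have hK := K_bounds hε hE
  set E := growthRate f
  set n := scale ε E n₀ t with hndef
  have hn' : (n₀ : ℝ) ≤ n := by exact_mod_cast hn
  exact
    { E_pos := hE
      δ_pos := hδ
      εE := delta_mul hE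
      δ_le := by
        have : 210 * delta ε E * E ≤ 1 * E := by nlinarith
        exact le_of_mul_le_mul_right this hE
      δK_ge := hK.1
      δK_le := hK.2
      EK := by
        have h1 : 420 * delta ε E ≤ E := by
          have : 0 ≤ delta ε E * E := by positivity
          nlinarith
        nlinarith [Nat.cast_nonneg (α := ℝ) (K ε E)]
      K_le := h.K_le.trans hn
      quad := by
        have h1 := h.bound_le.trans hn'
        rw [div_le_iff₀ (by positivity)] at h1
        linarith
      M_ge := by
        rw [scale, ← hndef]; exact Nat.le_ceil _
      M_le := by
        rw [scale, ← hndef]; exact (Nat.ceil_lt_add_one (Real.exp_pos _).le).le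
      h_ge := hη }

end Scales

/-! ### The language of a set of words of length `N` -/

section Blocks

variable {q N : ℕ}

/-- The factors of the words of `Y`, as lists. -/
def lang (Y : Set (Fin N → Fin q)) : Set (List (Fin q)) := {v | ∃ y ∈ Y, v <:+: List.ofFn y}

theorem lang_closed (Y : Set (Fin N → Fin q)) : FactorClosed (lang Y) := by
  rintro u v ⟨y, hy, hv⟩ huv
  exact ⟨y, hy, huv.trans hv⟩

theorem ncard_level_lang (Y : Set (Fin N → Fin q)) (n : ℕ) :
    (level (lang Y) n).ncard = (blockFactors Y n).ncard := by
  rw [← Set.InjOn.ncard_image (f := fun u : Fin n → Fin q => List.ofFn u)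
    (List.ofFn_injective.injOn) (s := blockFactors Y n)]
  congr 1
  ext v
  constructor
  · rintro ⟨⟨y, hy, a, b, hab⟩, hl⟩
    have hlen : a.length + n + b.length = N := by
      have := congrArg List.length hab
      simpa [hl, add_assoc] using this
    refine ⟨fun j => v[j], ⟨y, hy, a.length, by omega, fun j => ?_⟩, ?_⟩
    · have h1 : (a ++ v ++ b)[a.length + (j : ℕ)]'(by simp; omega) = v[(j : ℕ)] := by
        rw [List.getElem_append_left (by simp; omega), List.getElem_append_right (by omega)]
        simp
      change v[(j : ℕ)] = _
      rw [← h1]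
      simp [hab]
    · exact List.ext_getElem (by simp [hl]) fun j _ _ => by simp
  · rintro ⟨u, ⟨y, hy, i, hi, hu⟩, rfl⟩
    refine ⟨⟨y, hy, ?_⟩, by simp⟩
    have : List.ofFn u = ((List.ofFn y).drop i).take n := by
      refine List.ext_getElem (by simp; omega) fun j _ _ => ?_
      simp [hu]
    simp only [this]
    exact drop_take_infix _ _ _

theorem blockFactors_nonempty {Y : Set (Fin N → Fin q)} (hY : Y.Nonempty) {n : ℕ} (hn : n ≤ N) :
    (blockFactors Y n).Nonempty := by
  obtain ⟨y, hy⟩ := hY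
  exact ⟨fun j => y ⟨0 + j, by omega⟩, y, hy, 0, by omega, fun j => rfl⟩

theorem ncard_blockFactors_pos {Y : Set (Fin N → Fin q)} (hY : Y.Nonempty) {n : ℕ} (hn : n ≤ N) :
    0 < (blockFactors Y n).ncard :=
  (Set.ncard_pos (Set.toFinite _)).2 (blockFactors_nonempty hY hn)

theorem blockFactors_factors (w : ℕ → Fin q) {n : ℕ} (hn : n ≤ N) :
    blockFactors (factors w N) n = factors w n := by
  ext u
  constructor
  · rintro ⟨y, ⟨a, ha⟩, i, h, hu⟩
    refine ⟨a + i, fun j => ?_⟩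
    rw [hu, ha]
    simp [add_assoc]
  · rintro ⟨a, ha⟩
    exact ⟨fun j => w (a + j), ⟨a, fun _ => rfl⟩, 0, by omega, fun j => by rw [ha]; simp⟩

theorem minRate_le_rate (Y : Set (Fin N → Fin q)) {n : ℕ} (hn : n ∈ Set.Icc 1 N) :
    minRate Y ≤ rate Y n :=
  csInf_le ((Set.finite_Icc 1 N).image _).bddBelow ⟨n, hn, rfl⟩

theorem le_minRate (hN : 1 ≤ N) {Y : Set (Fin N → Fin q)} {c : ℝ}
    (h : ∀ n ∈ Set.Icc 1 N, c ≤ rate Y n) : c ≤ minRate Y := by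
  refine le_csInf ((Set.nonempty_Icc.2 hN).image _) ?_
  rintro _ ⟨n, hn, rfl⟩
  exact h n hn

theorem entropy_le_log_complexity_div (w : ℕ → Fin q) {n : ℕ} (hn : 1 ≤ n) :
    entropy w ≤ Real.log (complexity w n) / n := by
  have hs : Subadditive fun n : ℕ => Real.log (complexity w n) := by
    intro m n
    have hm : (complexity w m : ℝ) ≠ 0 := by exact_mod_cast (complexity_pos w m).ne'
    have hn : (complexity w n : ℝ) ≠ 0 := by exact_mod_cast (complexity_pos w n).ne'
    rw [← Real.log_mul hm hn]
    refine Real.log_le_log (by exact_mod_cast complexity_pos w (m + n)) ?_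
    exact_mod_cast complexity_add_le w m n
  have hb : BddBelow (Set.range fun n : ℕ => Real.log (complexity w n) / n) := by
    refine ⟨0, ?_⟩
    rintro _ ⟨n, rfl⟩
    exact div_nonneg (Real.log_natCast_nonneg _) n.cast_nonneg
  rw [tendsto_nhds_unique (entropy_tendsto w) (hs.tendsto_lim hb)]
  exact hs.lim_le_div hb (by omega)

variable {f : ℕ → ℝ}

theorem feasible_factors {w : ℕ → Fin q} (hw : w ∈ wordsBelow q f) :
    Feasible f (factors w N) := by
  refine ⟨⟨fun j => w (0 + j), 0, fun _ => rfl⟩, fun n hn => ?_⟩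
  rw [blockFactors_factors w hn.2]
  exact hw n

theorem entropy_le_minRate (hN : 1 ≤ N) (w : ℕ → Fin q) : entropy w ≤ minRate (factors w N) := by
  refine le_minRate hN fun n hn => ?_
  unfold rate
  rw [blockFactors_factors w hn.2]
  exact entropy_le_log_complexity_div w hn.1

/-- The factors of length `N` of an infinite word are themselves a competing set. -/
theorem Optimal.entropy_le {Y : Set (Fin N → Fin q)} (hY : Optimal f Y) (hN : 1 ≤ N)
    {w : ℕ → Fin q} (hw : w ∈ wordsBelow q f) : entropy w ≤ minRate Y :=
  (entropy_le_minRate hN w).trans (hY.2 _ (feasible_factors hw))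

theorem wordsBelow_nonempty (hq : 2 ≤ q) (hf : CStar f) : (wordsBelow q f).Nonempty := by
  refine ⟨fun _ => ⟨0, by omega⟩, fun n => ?_⟩
  have h1 : complexity (fun _ => (⟨0, by omega⟩ : Fin q)) n ≤ 1 := by
    refine (Set.ncard_le_one (Set.toFinite _)).2 ?_
    rintro u ⟨i, hi⟩ v ⟨j, hj⟩
    funext k
    rw [hi, hj]
  exact le_trans (by exact_mod_cast h1) (hf.one_le n)

theorem Optimal.wordEntropy_le (hq : 2 ≤ q) (hf : CStar f) {Y : Set (Fin N → Fin q)}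
    (hY : Optimal f Y) {n : ℕ} (hn : n ∈ Set.Icc 1 N) : wordEntropy q f ≤ rate Y n := by
  refine (csSup_le ((wordsBelow_nonempty hq hf).image _) ?_).trans (minRate_le_rate Y hn)
  rintro _ ⟨w, hw, rfl⟩
  exact hY.entropy_le (hn.1.trans hn.2) hw

theorem le_wordEntropy {w : ℕ → Fin q} (hw : w ∈ wordsBelow q f) : entropy w ≤ wordEntropy q f := by
  -- A real supremum needs an upper bound; `log p_w(1)` bounds the entropy, and it is at most the
  -- logarithm of the number of words of length `1`.
  refine le_csSup ⟨Real.log (Nat.card (Fin 1 → Fin q)), ?_⟩ ⟨w, hw, rfl⟩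
  rintro _ ⟨v, -, rfl⟩
  refine (entropy_le_log_complexity_div v le_rfl).trans ?_
  rw [Nat.cast_one, div_one]
  refine Real.log_le_log (by exact_mod_cast complexity_pos v 1) ?_
  rw [← Set.ncard_univ]
  exact_mod_cast Set.ncard_le_ncard (Set.subset_univ _) Set.finite_univ

theorem exists_optimal (hq : 2 ≤ q) (hf : CStar f) (N : ℕ) :
    ∃ Y : Set (Fin N → Fin q), Optimal f Y := by
  obtain ⟨w, hw⟩ := wordsBelow_nonempty hq hf
  obtain ⟨Y, hY, hmax⟩ := Set.exists_max_image {Y : Set (Fin N → Fin q) | Feasible f Y} minRate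
    (Set.toFinite _) ⟨_, feasible_factors hw⟩
  exact ⟨Y, hY, hmax⟩

/-- A solution of the optimization problem is a source for the construction of words. -/
theorem Feasible.source (hf : CStar f) {ε : ℝ} (hε : 0 < ε) (hε1 : ε < 1) {n₀ r : ℕ}
    (h : Admissible f ε n₀) {Y : Set (Fin (horizon ε (growthRate f) n₀) → Fin q)}
    (hY : Feasible f Y) (hr : Suitable ε (growthRate f) n₀ Y r) :
    Source f (lang Y) (growthRate f) (delta ε (growthRate f))
      (rate Y (scale ε (growthRate f) n₀ r)) (scale ε (growthRate f) n₀ r)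
      (scale ε (growthRate f) n₀ (r + 1)) := by
  have hE := h.growthRate_pos hf
  have hδ := delta_pos hε hE
  have hmono := scale_mono hε hε1 hE n₀
  have hMN : scale ε (growthRate f) n₀ (r + 1) ≤ horizon ε (growthRate f) n₀ :=
    hmono (Nat.succ_le_of_lt hr.1)
  have hnM := scale_le_succ hε hε1 hE n₀ r
  have hn₀ := h.pos
  have hnn₀ := h.le_scale hf hε hε1 r
  have hlt := (hf.log_div_lt_iff hn₀ _).1 h.log_lt
  have hratepos : ∀ m, 1 ≤ m → m ≤ horizon ε (growthRate f) n₀ →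
      ((blockFactors Y m).ncard : ℝ) = Real.exp (rate Y m * m) := by
    intro m hm hmN
    have h1 : (0 : ℝ) < m := by exact_mod_cast hm
    have h2 : (0 : ℝ) < (blockFactors Y m).ncard := by
      exact_mod_cast ncard_blockFactors_pos hY.1 hmN
    unfold rate
    rw [div_mul_cancel₀ _ h1.ne', Real.exp_log h2]
  have hle : ∀ m ≥ n₀, f m ≤ Real.exp ((1 + delta ε (growthRate f) / 2) * growthRate f * m) := by
    intro m hm
    have h1 := hlt m hm
    rw [div_lt_iff₀ (by exact_mod_cast (by omega : 0 < m))] at h1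
    exact (Real.log_le_iff_le_exp (hf.pos m)).1 h1.le
  refine ⟨lang_closed Y, hf.exp_le, fun m hm => ?_, fun m hm => hle m (hnn₀.trans hm),
    fun m hm => (hf.mono hm).trans (hle _ hnn₀), ?_, ?_⟩
  -- Feasibility says nothing about length `0`, where the empty word is the only one.
  · rcases Nat.eq_zero_or_pos m with rfl | hm0
    · refine le_trans ?_ (hf.one_le 0)
      have : level (lang Y) 0 ⊆ {[]} := fun v hv => List.length_eq_zero_iff.1 hv.2
      exact_mod_cast (Set.ncard_le_ncard this).trans (by simp)
    · rw [ncard_level_lang]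
      exact hY.2 m ⟨hm0, hm.trans hMN⟩
  · rw [ncard_level_lang]
    exact hratepos _ (by omega) (by omega)
  · rw [ncard_level_lang, hratepos _ (by omega) hMN]
    refine Real.exp_lt_exp.2 ?_
    have hM : (0 : ℝ) < scale ε (growthRate f) n₀ (r + 1) := by
      exact_mod_cast (by omega : 0 < scale ε (growthRate f) n₀ (r + 1))
    rw [div_lt_iff₀ (by linarith)]
    calc _ < (1 + delta ε (growthRate f)) * rate Y (scale ε (growthRate f) n₀ (r + 1)) *
          scale ε (growthRate f) n₀ (r + 1) := mul_lt_mul_of_pos_right hr.2 hM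
      _ = _ := by ring

end Blocks

/-! ### Binary words with sparse letters `1` -/

/-- The binary words in which the distance of any two letters `1` is at least `G`. -/
def gapLang (G : ℕ) : Set (List Bool) :=
  {v | ∀ i j, i < j → v[i]? = some true → v[j]? = some true → i + G ≤ j}

theorem gapLang_closed (G : ℕ) : FactorClosed (gapLang G) := by
  rintro u v hv ⟨a, b, rfl⟩ i j hij hi hj
  have key : ∀ i, u[i]? = some true → (a ++ u ++ b)[a.length + i]? = some true := by
    intro i hi
    have hlt : i < u.length := (List.getElem?_eq_some_iff.1 hi).1
    rw [List.append_assoc, List.getElem?_append_right (by omega), Nat.add_sub_cancel_left,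
      List.getElem?_append_left hlt, hi]
  have := hv (a.length + i) (a.length + j) (by omega) (key i hi) (key j hj)
  omega

theorem gapLang_append_false {G : ℕ} {v : List Bool} (hv : v ∈ gapLang G) (m : ℕ) :
    v ++ List.replicate m false ∈ gapLang G := by
  have key : ∀ i : ℕ, (v ++ List.replicate m false)[i]? = some true → v[i]? = some true := by
    intro i hi
    rcases lt_or_ge i v.length with h | h
    · rwa [List.getElem?_append_left h] at hi
    · rw [List.getElem?_append_right h, List.getElem?_replicate] at hi
      split_ifs at hi
      simp at hi
  exact fun i j hij hi hj => hv i j hij (key i hi) (key j hj)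

theorem false_cons_mem_gapLang {G : ℕ} {v : List Bool} :
    false :: v ∈ gapLang G ↔ v ∈ gapLang G := by
  constructor
  · exact fun h => gapLang_closed G h (List.suffix_cons false v).isInfix
  · intro h i j hij hi hj
    cases i with
    | zero => simp at hi
    | succ i =>
      cases j with
      | zero => simp at hj
      | succ j =>
        rw [List.getElem?_cons_succ] at hi hj
        have := h i j (by omega) hi hj
        omega

/-- The prefix of length `m` of the word `10…0` of length `G`. -/
def gapBlock (G m : ℕ) : List Bool := (true :: List.replicate (G - 1) false).take m

theorem length_gapBlock {G : ℕ} (hG : 1 ≤ G) (m : ℕ) : (gapBlock G m).length = min m G := by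
  simp [gapBlock]; omega

theorem gapBlock_getElem {G m i : ℕ} (h : (gapBlock G m)[i]? = some true) : i = 0 := by
  cases i with
  | zero => rfl
  | succ i =>
    rw [gapBlock, List.getElem?_take] at h
    split_ifs at h
    rw [List.getElem?_cons_succ, List.getElem?_replicate] at h
    split_ifs at h
    simp at h

theorem gapBlock_append_mem {G m : ℕ} (hG : 1 ≤ G) {w : List Bool} (hw : w ∈ gapLang G)
    (hl : w.length = m - G) : gapBlock G m ++ w ∈ gapLang G := by
  intro i j hij hi hj
  have hb := length_gapBlock hG m
  rcases lt_or_ge j (min m G) with h | h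
  · rw [List.getElem?_append_left (by omega)] at hj
    have := gapBlock_getElem hj
    omega
  · rw [List.getElem?_append_right (by omega), hb] at hj
    have hjl := (List.getElem?_eq_some_iff.1 hj).1
    rcases lt_or_ge i (min m G) with h' | h'
    · rw [List.getElem?_append_left (by omega)] at hi
      have := gapBlock_getElem hi
      omega
    · rw [List.getElem?_append_right (by omega), hb] at hi
      have := hw _ _ (by omega) hi hj
      omega

theorem eq_gapBlock_append {G m : ℕ} (hG : 1 ≤ G) {v : List Bool} (hv : v ∈ gapLang G)
    (hl : v.length = m) (hm : 1 ≤ m) (h0 : v[0]? = some true) :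
    v = gapBlock G m ++ v.drop G := by
  conv_lhs => rw [← List.take_append_drop G v]
  congr 1
  have hb := length_gapBlock hG m
  refine List.ext_getElem (by simp [hl, hb, min_comm]) fun i h1 h2 => ?_
  rw [List.getElem_take]
  rcases Nat.eq_zero_or_pos i with rfl | hi
  · have h3 : v[0]'(by omega) = true := (List.getElem?_eq_some_iff.1 h0).2
    rw [h3]; simp [gapBlock]
  · have h3 : v[i]'(by simp at h1; omega) ≠ true := by
      intro h
      have := hv 0 i hi h0 (List.getElem?_eq_some_iff.2 ⟨_, h⟩)
      simp at h1
      omega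
    have h4 : (gapBlock G m)[i] ≠ true := fun h => by
      have := gapBlock_getElem (List.getElem?_eq_some_iff.2 ⟨h2, h⟩)
      omega
    rw [Bool.eq_false_iff.2 h3, Bool.eq_false_iff.2 h4]

theorem ncard_gapLang_zero (G : ℕ) : (level (gapLang G) 0).ncard = 1 := by
  have : level (gapLang G) 0 = {[]} := by
    ext v
    constructor
    · exact fun h => List.length_eq_zero_iff.1 h.2
    · rintro rfl
      exact ⟨by intro i j _ hi; simp at hi, rfl⟩
  rw [this, Set.ncard_singleton]

/-- A word starts with `0`, or with `1` followed by `G - 1` letters `0` as far as its length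
permits. In the second case `n + 1 - G` is truncated at `0`, which accounts for the single word
`10…0` when `n + 1 < G`. -/
theorem ncard_gapLang_succ {G : ℕ} (hG : 1 ≤ G) (n : ℕ) :
    (level (gapLang G) (n + 1)).ncard =
      (level (gapLang G) n).ncard + (level (gapLang G) (n + 1 - G)).ncard := by
  have hsplit : level (gapLang G) (n + 1) = (false :: ·) '' level (gapLang G) n ∪
      (gapBlock G (n + 1) ++ ·) '' level (gapLang G) (n + 1 - G) := by
    ext v
    constructor
    · rintro ⟨hv, hl⟩
      cases v with
      | nil => simp at hl
      | cons b v =>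
        cases b with
        | false =>
          left
          exact ⟨v, ⟨false_cons_mem_gapLang.1 hv, by simpa using hl⟩, rfl⟩
        | true =>
          right
          refine ⟨(true :: v).drop G, ⟨gapLang_closed G hv (List.drop_suffix _ _).isInfix, ?_⟩, ?_⟩
          · rw [List.length_drop, hl]
          · exact (eq_gapBlock_append hG hv hl (by omega) rfl).symm
    · rintro (⟨w, ⟨hw, hl⟩, rfl⟩ | ⟨w, ⟨hw, hl⟩, rfl⟩)
      · exact ⟨false_cons_mem_gapLang.2 hw, by simp [hl]⟩
      · refine ⟨gapBlock_append_mem hG hw hl, ?_⟩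
        simp only [List.length_append, length_gapBlock hG, hl]
        omega
  rw [hsplit, Set.ncard_union_eq ?_ ((level_finite _ _).image _) ((level_finite _ _).image _),
    Set.ncard_image_of_injective _ (List.cons_injective),
    Set.ncard_image_of_injective _ (List.append_right_injective _)]
  rw [Set.disjoint_left]
  rintro _ ⟨w, -, rfl⟩ ⟨w', -, h⟩
  simp [gapBlock] at h

section Recursion

variable {a : ℕ → ℕ} {G : ℕ}

theorem gap_eq_of_le (h0 : a 0 = 1) (hs : ∀ n, a (n + 1) = a n + a (n + 1 - G)) {n : ℕ}
    (hn : n ≤ G) : a n = n + 1 := by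
  induction n with
  | zero => exact h0
  | succ n ih => rw [hs, ih (by omega), show n + 1 - G = 0 by omega, h0]

/-- The condition on `x` says that `exp (x n)` satisfies the recursion with `≤`. -/
theorem exp_le_gap (h0 : a 0 = 1) (hs : ∀ n, a (n + 1) = a n + a (n + 1 - G)) {x : ℝ}
    (hx : 0 ≤ x) (hG : 1 ≤ G) (h : 1 ≤ Real.exp (-x) + Real.exp (-(G * x))) (n : ℕ) :
    Real.exp (x * n) ≤ a n := by
  induction n using Nat.strong_induction_on with
  | _ n ih =>
    cases n with
    | zero => simp [h0]
    | succ n =>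
      have h1 := ih n (by omega)
      have h2 := ih (n + 1 - G) (by omega)
      have h3 : Real.exp (x * (n + 1) - G * x) ≤ Real.exp (x * (n + 1 - G : ℕ)) := by
        refine Real.exp_le_exp.2 ?_
        have : (n : ℝ) + 1 ≤ (n + 1 - G : ℕ) + G := by exact_mod_cast (by omega)
        nlinarith
      rw [hs]
      push_cast
      calc Real.exp (x * (n + 1)) ≤ Real.exp (x * (n + 1)) *
            (Real.exp (-x) + Real.exp (-(G * x))) := le_mul_of_one_le_right (Real.exp_pos _).le h
        _ = Real.exp (x * n) + Real.exp (x * (n + 1) - G * x) := by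
            rw [mul_add, ← Real.exp_add, ← Real.exp_add]; ring_nf
        _ ≤ _ := by linarith

/-- Below `G` the values `j + 1` may exceed `exp (E j)`. By `hB` they are at most `exp (E G) (1 -
exp (-E))` times as large, and this is exactly the factor for which the second term of the recursion
equals `exp (E (n + 1)) - exp (E n)`. -/
theorem gap_le_exp (h0 : a 0 = 1) (hs : ∀ n, a (n + 1) = a n + a (n + 1 - G)) {E : ℝ}
    (hG : 1 ≤ G) (hb : (G : ℝ) + 1 ≤ Real.exp (E * G))
    (hB : ∀ j : ℕ, (j : ℝ) + 1 ≤ Real.exp (E * G) * (1 - Real.exp (-E)) * Real.exp (E * j)) {n : ℕ}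
    (hn : G ≤ n) : (a n : ℝ) ≤ Real.exp (E * n) := by
  have hB1 : 1 ≤ Real.exp (E * G) * (1 - Real.exp (-E)) := by simpa using hB 0
  induction n using Nat.strong_induction_on with
  | _ n ih =>
    rcases hn.lt_or_eq with h | rfl
    · cases n with
      | zero => omega
      | succ n =>
        have h1 := ih n (by omega) (by omega)
        have h2 : (a (n + 1 - G) : ℝ) ≤ Real.exp (E * G) * (1 - Real.exp (-E)) *
            Real.exp (E * (n + 1 - G : ℕ)) := by
          rcases le_total (n + 1 - G) G with h3 | h3
          · rw [gap_eq_of_le h0 hs h3]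
            exact_mod_cast hB (n + 1 - G)
          · exact (ih _ (by omega) h3).trans (le_mul_of_one_le_left (Real.exp_pos _).le hB1)
        rw [hs]
        push_cast
        refine (add_le_add h1 h2).trans (le_of_eq ?_)
        rw [Nat.cast_sub (by omega)]
        have h4 : Real.exp (E * G) * (1 - Real.exp (-E)) * Real.exp (E * (((n + 1 : ℕ) : ℝ) - G)) =
            Real.exp (E * (n + 1)) - Real.exp (E * n) := by
          calc _ = (Real.exp (E * G) * Real.exp (E * (((n + 1 : ℕ) : ℝ) - G))) *
                (1 - Real.exp (-E)) := by ring
            _ = Real.exp (E * (n + 1)) * (1 - Real.exp (-E)) := by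
                rw [← Real.exp_add]; push_cast; ring_nf
            _ = _ := by rw [mul_sub, mul_one, ← Real.exp_add]; ring_nf
        rw [h4]
        ring
    · rw [gap_eq_of_le h0 hs le_rfl]
      exact_mod_cast hb

end Recursion

/-- A suitable distance `G` for given growth rate `E`. -/
theorem exists_gap {E : ℝ} (hE : 0 < E) (hE2 : E < Real.log 2) :
    ∃ G : ℕ, 1 ≤ G ∧ 1 ≤ Real.exp (-(E / 2)) + Real.exp (-(G * (E / 2))) ∧
      (G : ℝ) + 1 ≤ Real.exp (E * G) ∧
      ∀ j : ℕ, (j : ℝ) + 1 ≤ Real.exp (E * G) * (1 - Real.exp (-E)) * Real.exp (E * j) := by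
  set x := E / 2 with hx
  have hx0 : 0 < x := by positivity
  have hE1 : Real.exp E < 2 := by rwa [← Real.lt_log_iff_exp_lt two_pos]
  have hu : 1 / 2 < Real.exp (-E) := by
    rw [Real.exp_neg, ← one_div]
    exact one_div_lt_one_div_of_lt (Real.exp_pos E) hE1
  have hux : 1 / 2 < Real.exp (-x) := hu.trans_le (Real.exp_le_exp.2 (by linarith))
  have hx1 : Real.exp (-x) < 1 := Real.exp_lt_one_iff.2 (by linarith)
  -- `c` is the real solution of `exp (-x) + exp (-(c * x)) = 1`, and rounding it down keeps the
  -- inequality `≥ 1`. As `E < log 2`, it is at least `1`.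
  set c := -Real.log (1 - Real.exp (-x)) / x with hc
  have hcx : c * x = -Real.log (1 - Real.exp (-x)) := by rw [hc]; field_simp
  have hexp : Real.exp (-(c * x)) = 1 - Real.exp (-x) := by
    rw [hcx, neg_neg, Real.exp_log (by linarith)]
  have hc1 : 1 ≤ c := by
    by_contra! hlt
    have h1 : Real.exp (-x) < Real.exp (-(c * x)) := Real.exp_lt_exp.2 (by nlinarith)
    linarith
  refine ⟨⌊c⌋₊, Nat.one_le_floor_iff _ |>.2 hc1, ?_, ?_⟩
  · have h1 : Real.exp (-(c * x)) ≤ Real.exp (-(⌊c⌋₊ * x)) := by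
      refine Real.exp_le_exp.2 (neg_le_neg ?_)
      have := Nat.floor_le (by linarith : 0 ≤ c)
      gcongr
    linarith
  · set G := ⌊c⌋₊
    -- `W ≥ exp (c x) = 1 / (1 - exp (-x)) ≥ 1 / x`, because `G + 1` exceeds `c`. Moreover `E G = 2
    -- (G + 1) x - E`, so `exp (E G)` is `W²` up to the bounded factor `exp (-E)`.
    set W := Real.exp ((G + 1) * x) with hW
    have hW0 : 0 < W := Real.exp_pos _
    have hWx : 1 ≤ W * x := by
      have h1 : Real.exp (c * x) ≤ W := by
        refine Real.exp_le_exp.2 ?_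
        have := (Nat.lt_floor_add_one c).le
        gcongr
      have h2 : 1 - Real.exp (-x) ≤ x := by linarith [Real.add_one_le_exp (-x)]
      have h3 : Real.exp (c * x) * (1 - Real.exp (-x)) = 1 := by
        rw [← hexp, ← Real.exp_add, add_neg_cancel, Real.exp_zero]
      calc (1 : ℝ) = Real.exp (c * x) * (1 - Real.exp (-x)) := h3.symm
        _ ≤ W * x := mul_le_mul h1 h2 (by linarith) hW0.le
    have hEG : Real.exp (E * G) = W ^ 2 * Real.exp (-E) := by
      rw [hW, ← Real.exp_nat_mul, ← Real.exp_add, hx]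
      push_cast
      ring_nf
    have he : 2 ≤ Real.exp 1 := by linarith [Real.add_one_le_exp 1]
    have hline : ∀ t : ℝ, 2 * t ≤ Real.exp t := by
      intro t
      have h1 := Real.add_one_le_exp (t - 1)
      rw [Real.exp_sub, le_div_iff₀ (by linarith)] at h1
      rcases le_total t 0 with h | h
      · linarith [Real.exp_pos t]
      · nlinarith
    refine ⟨?_, fun j => ?_⟩
    · have h1 := hline ((G + 1) * x)
      rw [← hW] at h1
      rw [hEG]
      have h2 : (G : ℝ) + 1 ≤ W * (W * x) * ((G + 1) / W) := by
        rw [show W * (W * x) * (((G : ℝ) + 1) / W) = (G + 1) * (W * x) by field_simp]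
        exact le_mul_of_one_le_right (by positivity) hWx
      have h3 : W * (W * x) * (((G : ℝ) + 1) / W) = W * ((G + 1) * x) := by field_simp
      rw [h3] at h2
      nlinarith
    · have h1 := hline (E * (j + 1))
      have h2 : Real.exp (E * (j + 1)) = Real.exp (E * j) * Real.exp E := by
        rw [← Real.exp_add]; ring_nf
      have h3 : E / 2 ≤ 1 - Real.exp (-E) := by
        have h4 : Real.exp (-E) * Real.exp E = 1 := by
          rw [← Real.exp_add, neg_add_cancel, Real.exp_zero]
        have h5 := Real.add_one_le_exp E
        nlinarith
      have hEj : 0 < Real.exp (E * j) := Real.exp_pos _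
      have hWE : 2 ≤ W * E := by rw [hx] at hWx; linarith
      have h6 : 4 ≤ (W * E) ^ 2 := by nlinarith
      have h7 : 1 ≤ W ^ 2 * Real.exp (-E) * (1 - Real.exp (-E)) * E := by
        calc (1 : ℝ) ≤ (W * E) ^ 2 * (1 / 2 * (1 / 2)) := by linarith
          _ = W ^ 2 * (1 / 2) * (E / 2) * E := by ring
          _ ≤ W ^ 2 * Real.exp (-E) * (1 - Real.exp (-E)) * E := by gcongr
      have h8 : ((j : ℝ) + 1) * E ≤ Real.exp (E * j) := by nlinarith
      rw [hEG]
      refine le_of_mul_le_mul_right ?_ hE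
      calc ((j : ℝ) + 1) * E ≤ Real.exp (E * j) := h8
        _ ≤ (W ^ 2 * Real.exp (-E) * (1 - Real.exp (-E)) * E) * Real.exp (E * j) :=
            le_mul_of_one_le_left hEj.le h7
        _ = _ := by ring

/-! ### Competing sets with a large minimal rate -/

section Competitors

variable {q N : ℕ} {f : ℕ → ℝ}

/-- Extendability makes each word of length `n` of the language a factor of one of length `N`; the
injection `c` renames the letters. -/
theorem ncard_blockFactors_of_extendable {A : Type*} [Finite A] {c : A → Fin q}
    (hc : Function.Injective c) {Λ : Set (List A)} (hΛ : FactorClosed Λ)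
    (hext : ∀ v ∈ Λ, v.length ≤ N → ∃ t : List A, v ++ t ∈ Λ ∧ (v ++ t).length = N) {n : ℕ}
    (hn : n ≤ N) :
    (blockFactors {y : Fin N → Fin q | List.ofFn y ∈ List.map c '' Λ} n).ncard =
      (level Λ n).ncard := by
  rw [← ncard_level_lang, ← Set.ncard_image_of_injective (level Λ n) (List.map_injective_iff.2 hc)]
  congr 1
  ext v
  constructor
  · rintro ⟨⟨y, ⟨x, hx, hxy⟩, hv⟩, hl⟩
    rw [← hxy] at hv
    obtain ⟨a, b, hab⟩ := hv
    have h1 : v = (x.drop a.length |>.take v.length).map c := by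
      rw [List.map_take, List.map_drop, ← hab, List.append_assoc, List.drop_left, List.take_left]
    refine ⟨(x.drop a.length).take v.length, ⟨hΛ hx (drop_take_infix _ _ _), ?_⟩, h1.symm⟩
    have := congrArg List.length h1
    rw [List.length_map] at this
    omega
  · rintro ⟨x, ⟨hx, hl⟩, rfl⟩
    obtain ⟨t, ht, htl⟩ := hext x hx (by omega)
    refine ⟨⟨fun i => c ((x ++ t)[i]), ?_, ?_⟩, by simp [hl]⟩
    · refine ⟨x ++ t, ht, List.ext_getElem (by simp [← htl]) fun i _ _ => by
        simp [-List.map_append]⟩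
    · have : List.ofFn (fun i : Fin N => c ((x ++ t)[i])) = (x ++ t).map c :=
        List.ext_getElem (by simp [← htl]) fun i _ _ => by simp [-List.map_append]
      rw [this, List.map_append]
      exact (List.prefix_append _ _).isInfix

/-- The full shift over `j` letters. -/
theorem exists_feasible_full (hN : 1 ≤ N) {j : ℕ} (hj : 1 ≤ j) (hjq : j ≤ q)
    (hf : ∀ n, (j : ℝ) ^ n ≤ f n) :
    ∃ Y : Set (Fin N → Fin q), Feasible f Y ∧ Real.log j ≤ minRate Y := by
  have hcount : ∀ n ≤ N, (blockFactors {y : Fin N → Fin q | List.ofFn y ∈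
      List.map (Fin.castLE hjq) '' (Set.univ : Set (List (Fin j)))} n).ncard = j ^ n := by
    intro n hn
    rw [ncard_blockFactors_of_extendable (Fin.castLE_injective hjq) (Λ := Set.univ)
      (fun _ _ _ _ => Set.mem_univ _)
      (fun v _ hv => ⟨List.replicate (N - v.length) ⟨0, hj⟩, Set.mem_univ _, by simp; omega⟩) hn]
    have h1 : level (Set.univ : Set (List (Fin j))) n =
        (fun u : Fin n → Fin j => List.ofFn u) '' Set.univ := by
      ext v
      constructor
      · rintro ⟨-, rfl⟩
        exact ⟨v.get, Set.mem_univ _, List.ofFn_get v⟩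
      · rintro ⟨u, -, rfl⟩
        exact ⟨Set.mem_univ _, by simp⟩
    rw [h1, Set.ncard_image_of_injective _ List.ofFn_injective, Set.ncard_univ]
    simp
  refine ⟨{y | List.ofFn y ∈ List.map (Fin.castLE hjq) '' (Set.univ : Set (List (Fin j)))},
     ⟨?_, fun n hn => ?_⟩, le_minRate hN fun n hn => ?_⟩
  · exact ⟨fun _ => Fin.castLE hjq ⟨0, hj⟩, List.replicate N ⟨0, hj⟩, Set.mem_univ _, by simp⟩
  · rw [hcount n hn.2]
    push_cast
    exact hf n
  · have : (n : ℝ) ≠ 0 := by have := hn.1; positivity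
    rw [rate, hcount n hn.2]
    push_cast
    rw [Real.log_pow, mul_div_cancel_left₀ _ this]

/-- For `E ≥ log 2` the full shift over `⌊exp E⌋` letters does it. For smaller `E` this would be a
single letter, and sparse binary words take its place: up to length `G` there are only `n + 1 ≤
f(n)` of them, beyond it at most `exp (E n)`. -/
theorem exists_feasible_half (hf : CStar f) (hN : 1 ≤ N) (hq : 2 ≤ q) (hE : 0 < growthRate f)
    (hEq : growthRate f < Real.log q) :
    ∃ Y : Set (Fin N → Fin q), Feasible f Y ∧ growthRate f / 2 ≤ minRate Y := by
  set E := growthRate f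
  have hq0 : (0 : ℝ) < q := by exact_mod_cast (by omega : 0 < q)
  rcases le_or_gt (Real.log 2) E with h2 | h2
  · set j := ⌊Real.exp E⌋₊ with hj
    have hj2 : 2 ≤ j := Nat.le_floor (by
      push_cast
      exact (Real.log_le_iff_le_exp two_pos).1 h2)
    have hjE : (j : ℝ) ≤ Real.exp E := Nat.floor_le (Real.exp_pos _).le
    have hjE' : Real.exp E < j + 1 := Nat.lt_floor_add_one _
    have hjq : j ≤ q := by
      have h1 : Real.exp E < q := (Real.lt_log_iff_exp_lt hq0).1 hEq
      exact_mod_cast (hjE.trans h1.le)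
    obtain ⟨Y, hY, hYr⟩ := exists_feasible_full (f := f) hN (by omega) hjq (fun n => by
      refine le_trans ?_ (hf.exp_le n)
      rw [mul_comm, Real.exp_nat_mul]
      gcongr)
    refine ⟨Y, hY, le_trans ?_ hYr⟩
    have hj2' : (2 : ℝ) ≤ j := by exact_mod_cast hj2
    -- As `j ≥ 2`, `exp E < j + 1 ≤ j²`.
    have h3 : E < 2 * Real.log j := by
      rw [← Real.log_exp E, show (2 : ℝ) = (2 : ℕ) by norm_num, ← Real.log_pow]
      refine Real.log_lt_log (Real.exp_pos _) (hjE'.trans_le ?_)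
      nlinarith
    linarith
  · obtain ⟨G, hG, h1, hb, hB⟩ := exists_gap hE h2
    have h0 := ncard_gapLang_zero G
    have hs := ncard_gapLang_succ hG
    let c : Bool → Fin q := fun b => if b then ⟨1, by omega⟩ else ⟨0, by omega⟩
    have hc : Function.Injective c := by
      intro a b
      cases a <;> cases b <;> simp [c]
    have hcount : ∀ n ≤ N, (blockFactors {y : Fin N → Fin q | List.ofFn y ∈
        List.map c '' gapLang G} n).ncard = (level (gapLang G) n).ncard := fun n hn =>
      ncard_blockFactors_of_extendable hc (gapLang_closed G) (fun v hv hl =>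
        ⟨List.replicate (N - v.length) false, gapLang_append_false hv _, by simp; omega⟩) hn
    refine ⟨{y | List.ofFn y ∈ List.map c '' gapLang G}, ⟨?_, fun n hn => ?_⟩, le_minRate hN fun n hn => ?_⟩
    · refine ⟨fun _ => c false, List.replicate N false, ?_, by simp⟩
      have := gapLang_append_false (G := G) (v := []) (by intro i j _ hi; simp at hi) N
      simpa using this
    · rw [hcount n hn.2]
      rcases le_total n G with h | h
      · rw [gap_eq_of_le (a := fun n => (level (gapLang G) n).ncard) h0 hs h]
        exact_mod_cast hf.succ_le n
      · exact (gap_le_exp (a := fun n => (level (gapLang G) n).ncard) h0 hs hG hb hB h).trans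
          (hf.exp_le n)
    · have hn0 : (0 : ℝ) < n := by exact_mod_cast hn.1
      have h3 := exp_le_gap (a := fun n => (level (gapLang G) n).ncard) h0 hs
        (by positivity : 0 ≤ E / 2) hG h1 n
      rw [rate, hcount n hn.2, le_div_iff₀ hn0,
        Real.le_log_iff_exp_le ((Real.exp_pos _).trans_le h3)]
      exact h3

end Competitors

/-! ### The solutions of the optimization problem -/

section Solutions

variable {q : ℕ} {f : ℕ → ℝ} {ε : ℝ} {n₀ : ℕ}

theorem scale_mem_Icc (hf : CStar f) (hε : 0 < ε) (hε1 : ε < 1) (h : Admissible f ε n₀) {t : ℕ}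
    (ht : t ≤ K ε (growthRate f)) :
    scale ε (growthRate f) n₀ t ∈ Set.Icc 1 (horizon ε (growthRate f) n₀) :=
  ⟨h.pos.trans_le (h.le_scale hf hε hε1 t),
    scale_mono hε hε1 (h.growthRate_pos hf) n₀ ht⟩

theorem rate_lt (hf : CStar f) (hε : 0 < ε) (hε1 : ε < 1) (h : Admissible f ε n₀)
    {Y : Set (Fin (horizon ε (growthRate f) n₀) → Fin q)} (hY : Feasible f Y) {t : ℕ}
    (ht : t ≤ K ε (growthRate f)) :
    rate Y (scale ε (growthRate f) n₀ t) <
      (1 + delta ε (growthRate f) / 2) * growthRate f := by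
  have hmem := scale_mem_Icc hf hε hε1 h ht
  refine lt_of_le_of_lt ?_ ((hf.log_div_lt_iff h.pos _).1 h.log_lt _ (h.le_scale hf hε hε1 t))
  unfold rate
  have h1 : (0 : ℝ) < (blockFactors Y (scale ε (growthRate f) n₀ t)).ncard := by
    exact_mod_cast ncard_blockFactors_pos hY.1 hmem.2
  have h2 := hY.2 _ hmem
  gcongr

/-- If the rate dropped by a factor `1 + δ` at each of the `K` steps, the first rate would be at
least `e` times the last one, hence at least `e E / 2 > (1 + δ / 2) E`, against admissibility. -/
theorem exists_suitable_of_half (hf : CStar f) (hε : 0 < ε) (hε1 : ε < 1)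
    (h : Admissible f ε n₀) {Y : Set (Fin (horizon ε (growthRate f) n₀) → Fin q)}
    (hY : Feasible f Y) (hhalf : growthRate f / 2 ≤ minRate Y) :
    ∃ r, Suitable ε (growthRate f) n₀ Y r := by
  by_contra! hno
  have hE := h.growthRate_pos hf
  have hδ := delta_pos hε hE
  have hle := delta_le hε1 hE
  have hδK := (K_bounds hε hE).1
  generalize hd : delta ε (growthRate f) = δ at hδ hle hδK
  have hstep : ∀ t ≤ K ε (growthRate f), (1 + δ) ^ t * rate Y (scale ε (growthRate f) n₀ t) ≤ rate Y (scale ε (growthRate f) n₀ 0) := by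
    intro t
    induction t with
    | zero => intro _; simp
    | succ t ih =>
      intro ht
      refine le_trans ?_ (ih (by omega))
      have h1 : ¬ (rate Y (scale ε (growthRate f) n₀ t) < (1 + δ) * rate Y (scale ε (growthRate f) n₀ (t + 1))) :=
        fun h' => hno t ⟨by omega, hd ▸ h'⟩
      rw [pow_succ, mul_assoc]
      exact mul_le_mul_of_nonneg_left (not_lt.1 h1) (by positivity)
  have h1 := hstep _ le_rfl
  have h2 := rate_lt hf hε hε1 h hY (Nat.zero_le _)
  have h3 := hhalf.trans (minRate_le_rate Y (scale_mem_Icc hf hε hε1 h le_rfl))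
  -- `log (1 + δ) ≥ δ / (1 + δ)` and `δ K ≥ 1 + δ`; the latter is the reason for the `+ 1` in `K`.
  have h4 : Real.exp 1 ≤ (1 + δ) ^ K ε (growthRate f) := by
    have h5 : Real.exp (δ / (1 + δ)) ≤ 1 + δ := by
      rw [← Real.le_log_iff_exp_le (by linarith)]
      have := Real.one_sub_inv_le_log_of_pos (x := 1 + δ) (by linarith)
      refine le_trans (le_of_eq ?_) this
      field_simp
      ring
    calc Real.exp 1 ≤ Real.exp (δ / (1 + δ)) ^ K ε (growthRate f) := by
          rw [← Real.exp_nat_mul]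
          refine Real.exp_le_exp.2 ?_
          rw [mul_div_assoc', le_div_iff₀ (by linarith)]
          linarith
      _ ≤ _ := by gcongr
  have h5 : 2.7 < Real.exp 1 := by linarith [Real.exp_one_gt_d9]
  have h6 : Real.exp 1 * (growthRate f / 2) ≤ (1 + δ) ^ K ε (growthRate f) * rate Y (scale ε (growthRate f) n₀ (K ε (growthRate f))) := by
    gcongr
  have h7 : 210 * δ ≤ 1 := by
    have : 210 * δ * growthRate f ≤ 1 * growthRate f := by nlinarith
    exact le_of_mul_le_mul_right this hE
  have h8 : rate Y (scale ε (growthRate f) n₀ 0) < (1 + δ / 2) * growthRate f := hd ▸ h2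
  nlinarith

theorem rate_le_log {N : ℕ} (Y : Set (Fin N → Fin q)) {n : ℕ} (hn : 1 ≤ n) :
    rate Y n ≤ Real.log q := by
  have hn0 : (0 : ℝ) < n := by exact_mod_cast hn
  unfold rate
  rw [div_le_iff₀ hn0]
  rcases Nat.eq_zero_or_pos (blockFactors Y n).ncard with h | h
  · rw [h]
    simpa using mul_nonneg (Real.log_natCast_nonneg q) hn0.le
  · rw [mul_comm, ← Real.log_pow]
    refine Real.log_le_log (by exact_mod_cast h) ?_
    have h1 := Set.ncard_le_ncard (Set.subset_univ (blockFactors Y n)) Set.finite_univ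
    rw [Set.ncard_univ, Nat.card_fun, Nat.card_fin, Nat.card_fin] at h1
    exact_mod_cast h1

theorem log_le_wordEntropy (hq : 2 ≤ q) (hf : ∀ n, (q : ℝ) ^ n ≤ f n) :
    Real.log q ≤ wordEntropy q f := by
  have : Inhabited (Fin q) := ⟨⟨0, by omega⟩⟩
  set S : Set (List (Fin q)) := Set.range fun a => [a] with hS
  have hSc : S.ncard = q := by
    rw [hS, ← Set.image_univ, Set.ncard_image_of_injective _ List.singleton_injective,
      Set.ncard_univ, Nat.card_fin]
  obtain ⟨σ, hσ, hpow⟩ := exists_concat_complexity (T := 1) one_pos (S := S)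
    (Set.range_nonempty _) (by rintro _ ⟨a, rfl⟩; rfl)
  have hw : concat 1 σ ∈ wordsBelow q f := by
    intro n
    refine le_trans ?_ (hf n)
    have h1 := Set.ncard_le_ncard (Set.subset_univ (factors (concat 1 σ) n)) Set.finite_univ
    rw [Set.ncard_univ, Nat.card_fun, Nat.card_fin, Nat.card_fin] at h1
    exact_mod_cast h1
  refine le_trans ?_ (le_wordEntropy hw)
  have := le_entropy_of_pow_le (concat 1 σ) one_pos (a := q)
    (by exact_mod_cast (by omega : 0 < q)) (fun k => by
      have := hpow k
      rw [hSc] at this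
      exact_mod_cast this)
  simpa using this

/-- Every solution of the optimization problem has a suitable index, and each suitable index
gives an approximation of the word entropy. -/
theorem Optimal.suitable (hq : 2 ≤ q) (hf : CStar f) (hε : 0 < ε) (hε1 : ε < 1)
    (h : Admissible f ε n₀) {Y : Set (Fin (horizon ε (growthRate f) n₀) → Fin q)}
    (hY : Optimal f Y) :
    (∃ r, Suitable ε (growthRate f) n₀ Y r) ∧
    ∀ r, Suitable ε (growthRate f) n₀ Y r →
      (1 - ε) * rate Y (scale ε (growthRate f) n₀ r) ≤ wordEntropy q f ∧
      wordEntropy q f ≤ rate Y (scale ε (growthRate f) n₀ r) := by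
  have hE := h.growthRate_pos hf
  have hδ := delta_pos hε hE
  have hN : 1 ≤ horizon ε (growthRate f) n₀ := (scale_mem_Icc hf hε hε1 h le_rfl).1
  have hup : ∀ r, Suitable ε (growthRate f) n₀ Y r →
      wordEntropy q f ≤ rate Y (scale ε (growthRate f) n₀ r) := fun r hr =>
    hY.wordEntropy_le hq hf (scale_mem_Icc hf hε hε1 h hr.1.le)
  rcases lt_or_ge (growthRate f) (Real.log q) with hlt | hge
  · obtain ⟨Y', hY', hr'⟩ := exists_feasible_half hf hN hq hE hlt
    have hhalf := hr'.trans (hY.2 Y' hY')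
    refine ⟨exists_suitable_of_half hf hε hε1 h hY.1 hhalf, fun r hr => ⟨?_, hup r hr⟩⟩
    have : Inhabited (Fin q) := ⟨⟨0, by omega⟩⟩
    have hmem := scale_mem_Icc hf hε hε1 h hr.1.le
    have hreg := h.regime hf hε hε1 r (hhalf.trans (minRate_le_rate Y hmem))
    obtain ⟨w, hw, hent⟩ := (hY.1.source hf hε hε1 h hr).exists_word hreg
    exact hent.trans (le_wordEntropy hw)
  -- Now the full shift is allowed, so all rates of an optimal `Y` and the word entropy equal `log
  -- q`, and every index is suitable.
  · have hq0 : (0 : ℝ) < q := by exact_mod_cast (by omega : 0 < q)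
    have hqf : ∀ n, (q : ℝ) ^ n ≤ f n := fun n => by
      refine le_trans ?_ (hf.exp_le n)
      rw [mul_comm, Real.exp_nat_mul]
      have := (Real.log_le_iff_le_exp hq0).1 hge
      gcongr
    have hlog : 0 < Real.log q := Real.log_pos (by exact_mod_cast (by omega : 1 < q))
    obtain ⟨Y', hY', hr'⟩ := exists_feasible_full (f := f) hN (by omega) le_rfl hqf
    have hrate : ∀ t ≤ K ε (growthRate f), rate Y (scale ε (growthRate f) n₀ t) = Real.log q := by
      intro t ht
      have hmem := scale_mem_Icc hf hε hε1 h ht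
      exact le_antisymm (rate_le_log Y hmem.1)
        (hr'.trans ((hY.2 Y' hY').trans (minRate_le_rate Y hmem)))
    have hK : 0 < K ε (growthRate f) := Nat.succ_pos _
    refine ⟨⟨0, hK, ?_⟩, fun r hr => ⟨?_, hup r hr⟩⟩
    · rw [hrate 0 (by omega), hrate (0 + 1) (by omega)]
      nlinarith
    · rw [hrate r hr.1.le]
      refine le_trans ?_ (log_le_wordEntropy hq hqf)
      nlinarith

end Solutions

/-! ### Programs -/

namespace ExactComputable

variable {α β γ δ : Type}

theorem ofFst {f : α → γ} (hf : ExactComputable f) : ExactComputable fun p : α × β => f p.1 :=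
  hf.comp fst

theorem ofSnd {f : β → γ} (hf : ExactComputable f) : ExactComputable fun p : α × β => f p.2 :=
  hf.comp snd

theorem const (n : ℕ) : ExactComputable fun _ : α => n := by
  induction n with
  | zero => exact zero
  | succ n ih => exact succ.comp ih

theorem cast {f : α → ℕ} (hf : ExactComputable f) : ExactComputable fun a => (f a : ℝ) :=
  natCast.comp hf

theorem const_real (n : ℕ) : ExactComputable fun _ : α => (n : ℝ) := (const n).cast

section Real

variable {f g : α → ℝ}

theorem real_add (hf : ExactComputable f) (hg : ExactComputable g) :
    ExactComputable fun a => f a + g a := add.comp (hf.pair hg)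

theorem real_sub (hf : ExactComputable f) (hg : ExactComputable g) :
    ExactComputable fun a => f a - g a := sub.comp (hf.pair hg)

theorem real_mul (hf : ExactComputable f) (hg : ExactComputable g) :
    ExactComputable fun a => f a * g a := mul.comp (hf.pair hg)

theorem real_div (hf : ExactComputable f) (hg : ExactComputable g) :
    ExactComputable fun a => f a / g a := div.comp (hf.pair hg)

end Real

theorem natRec {n : α → ℕ} {f : α → β} {g : α → ℕ → β → β} (hn : ExactComputable n)
    (hf : ExactComputable f) (hg : ExactComputable fun p : α × ℕ × β => g p.1 p.2.1 p.2.2) :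
    ExactComputable fun a => Nat.rec (motive := fun _ => β) (f a) (fun k b => g a k b) (n a) :=
  (natLoop hf hg).comp (id.pair hn)

section Nat

variable {f g : α → ℕ}

/-- Sums and products are formed in `ℝ`; rounding up does not change a natural number. For
differences it also turns negative values into `0`, as truncated subtraction does. -/
theorem nat_add (hf : ExactComputable f) (hg : ExactComputable g) :
    ExactComputable fun a => f a + g a := by
  have := ceil.comp (hf.cast.real_add hg.cast)
  simpa only [← Nat.cast_add, Nat.ceil_natCast] using this

theorem nat_mul (hf : ExactComputable f) (hg : ExactComputable g) :
    ExactComputable fun a => f a * g a := by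
  have := ceil.comp (hf.cast.real_mul hg.cast)
  simpa only [← Nat.cast_mul, Nat.ceil_natCast] using this

theorem nat_sub (hf : ExactComputable f) (hg : ExactComputable g) :
    ExactComputable fun a => f a - g a := by
  have := ceil.comp (hf.cast.real_sub hg.cast)
  convert this using 2 with a
  rw [Nat.ceil_sub_natCast, Nat.ceil_natCast]

/-- The available rounding is upwards, and `⌊f / g⌋ = ⌈(f + 1 - g) / g⌉`. For `g = 0` both sides are
`0` by the convention on division. -/
theorem nat_div (hf : ExactComputable f) (hg : ExactComputable g) :
    ExactComputable fun a => f a / g a := by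
  have := ceil.comp ((((hf.cast.real_add (const_real 1)).real_sub hg.cast)).real_div hg.cast)
  convert this using 2 with a
  rcases Nat.eq_zero_or_pos (g a) with h | h
  · simp [h]
  · have hg0 : (0 : ℝ) < g a := by exact_mod_cast h
    symm
    apply le_antisymm
    · rw [Nat.ceil_le, div_le_iff₀ hg0]
      have := Nat.lt_div_mul_add (a := f a) h
      have h2 : ((f a + 1 : ℕ) : ℝ) ≤ ((f a / g a * g a + g a : ℕ) : ℝ) := by exact_mod_cast this
      push_cast at h2 ⊢
      linarith
    · rcases Nat.eq_zero_or_pos (f a / g a) with h0 | h0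
      · omega
      · refine Nat.le_of_pred_lt ?_
        rw [Nat.lt_ceil, lt_div_iff₀ hg0]
        have h1 := Nat.div_mul_le_self (f a) (g a)
        have h2 : ((f a / g a * g a : ℕ) : ℝ) ≤ f a := by exact_mod_cast h1
        have h3 : (((f a / g a).pred : ℕ) : ℝ) = ((f a / g a : ℕ) : ℝ) - 1 := by
          rw [Nat.pred_eq_sub_one, Nat.cast_sub h0, Nat.cast_one]
        rw [h3]
        push_cast at h2 ⊢
        linarith

theorem nat_mod (hf : ExactComputable f) (hg : ExactComputable g) :
    ExactComputable fun a => f a % g a := by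
  simpa only [Nat.mod_eq_sub] using hf.nat_sub (hg.nat_mul (hf.nat_div hg))

theorem nat_pow (hf : ExactComputable f) (hg : ExactComputable g) :
    ExactComputable fun a => f a ^ g a := by
  have := natRec (g := fun a _ b => b * f a) hg (const 1) (snd.ofSnd.nat_mul hf.ofFst)
  convert this using 2 with a
  induction g a with
  | zero => simp
  | succ n ih => rw [pow_succ, ih]

end Nat

theorem headD_drop {l : α → List ℝ} {n : α → ℕ} (hl : ExactComputable l)
    (hn : ExactComputable n) : ExactComputable fun a => ((l a).drop (n a)).headD 0 := by
  have hhead : ExactComputable fun l : List ℝ => l.headD 0 := by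
    have := (listLoop (α := ℕ) (f := fun _ => (0 : ℝ)) (g := fun p : ℕ × ℝ × ℝ => p.2.1)
      (by simpa using const_real 0) fst.ofSnd).comp (zero.pair id)
    convert this using 2 with l
    cases l <;> rfl
  have htail : ExactComputable fun l : List ℝ => l.tail := by
    -- As for the predecessor of a natural number, the loop carries the pair of the tail and the
    -- list.
    have := fst.comp ((listLoop (α := ℕ) (f := fun _ => (([] : List ℝ), ([] : List ℝ)))
      (g := fun p : ℕ × ℝ × List ℝ × List ℝ => (p.2.2.2, p.2.1 :: p.2.2.2))
      (nil.pair nil) (snd.ofSnd.ofSnd.pair (cons.comp (fst.ofSnd.pair snd.ofSnd.ofSnd)))).comp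
        (zero.pair id))
    convert this using 2 with l
    have h : ∀ l : List ℝ, l.foldr (fun c b => (b.2, c :: b.2)) (([] : List ℝ), ([] : List ℝ)) =
        (l.tail, l) := by
      intro l
      induction l with
      | nil => rfl
      | cons c l ih => rw [List.foldr_cons, ih]; rfl
    exact (congrArg Prod.fst (h l)).symm
  have := natRec (g := fun _ _ b => b.tail) hn hl (htail.comp snd.ofSnd)
  refine hhead.comp ?_
  convert this using 2 with a
  induction n a with
  | zero => rfl
  | succ n ih => rw [← List.tail_drop, ih]

end ExactComputable

open Classical in
/-- The predicates decided by a program. -/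
def ExactDecidable {α : Type} (P : α → Prop) : Prop :=
  ExactComputable fun a => if P a then 1 else 0

namespace ExactDecidable

open ExactComputable

variable {α β : Type} {P Q : α → Prop}

open Classical in
theorem ite {f g : α → β} (hP : ExactDecidable P) (hf : ExactComputable f)
    (hg : ExactComputable g) : ExactComputable fun a => if P a then f a else g a := by
  have := ifLt (const_real 0) hP.cast hf hg
  convert this using 3 with a
  by_cases h : P a <;> simp [h]

open Classical in
theorem of_ite {f g : α → ℕ} (hf : ExactComputable f) (hg : ExactComputable g)
    (h : ∀ a, P a ↔ f a < g a) : ExactDecidable P := by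
  have := ifLt hf.cast hg.cast (const 1) (const 0)
  unfold ExactDecidable
  convert this using 3 with a
  rw [h, Nat.cast_lt]

theorem real_lt {f g : α → ℝ} (hf : ExactComputable f) (hg : ExactComputable g) :
    ExactDecidable fun a => f a < g a := by
  unfold ExactDecidable
  convert ifLt hf hg (const 1) (const 0)

theorem nat_eq {f g : α → ℕ} (hf : ExactComputable f) (hg : ExactComputable g) :
    ExactDecidable fun a => f a = g a :=
  of_ite ((hf.nat_sub hg).nat_add (hg.nat_sub hf)) (const 1) fun a => by omega

theorem not (hP : ExactDecidable P) : ExactDecidable fun a => ¬ P a := by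
  unfold ExactDecidable
  convert hP.ite (const 0) (const 1) using 2 with a
  by_cases h : P a <;> simp [h]

theorem and (hP : ExactDecidable P) (hQ : ExactDecidable Q) :
    ExactDecidable fun a => P a ∧ Q a := by
  unfold ExactDecidable
  convert hP.ite hQ (const 0) using 2 with a
  by_cases h : P a <;> by_cases h' : Q a <;> simp [h, h']

theorem imp (hP : ExactDecidable P) (hQ : ExactDecidable Q) :
    ExactDecidable fun a => P a → Q a := by
  unfold ExactDecidable
  convert hP.ite hQ (const 1) using 2 with a
  by_cases h : P a <;> by_cases h' : Q a <;> simp [h, h']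

variable {n : α → ℕ} {R : α → ℕ → Prop}

theorem card_filter [∀ a, DecidablePred (R a)] (hn : ExactComputable n)
    (hR : ExactDecidable fun p : α × ℕ => R p.1 p.2) :
    ExactComputable fun a => ((Finset.range (n a)).filter (R a)).card := by
  have hbit : ExactComputable fun p : α × ℕ => if R p.1 p.2 then 1 else 0 := by
    unfold ExactDecidable at hR
    convert hR
  have := natRec (g := fun a k b => b + if R a k then 1 else 0) hn (const 0)
    (snd.ofSnd.nat_add (ExactComputable.comp hbit (fst.pair fst.ofSnd)))
  convert this using 2 with a
  induction n a with
  | zero => rfl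
  | succ n ih =>
    rw [Finset.range_add_one, Finset.filter_insert]
    split_ifs with h
    · rw [Finset.card_insert_of_notMem (by simp), ih]
      simp [h]
    · rw [ih]
      simp [h]

theorem exists_lt (hn : ExactComputable n) (hR : ExactDecidable fun p : α × ℕ => R p.1 p.2) :
    ExactDecidable fun a => ∃ i < n a, R a i := by
  classical
  refine of_ite (const 0) (card_filter hn hR) fun a => ?_
  simp [Finset.card_pos, Finset.Nonempty]

theorem forall_lt (hn : ExactComputable n) (hR : ExactDecidable fun p : α × ℕ => R p.1 p.2) :
    ExactDecidable fun a => ∀ i < n a, R a i := by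
  simpa using (exists_lt (R := fun a i => ¬ R a i) hn hR.not).not

end ExactDecidable

open Classical in
/-- The largest `i < n` with `P i`, and `0` if there is none. -/
def search (P : ℕ → Prop) (n : ℕ) : ℕ :=
  Nat.rec (motive := fun _ => ℕ) 0 (fun k b => if P k then k else b) n

theorem search_spec {P : ℕ → Prop} {n : ℕ} (h : ∃ i < n, P i) :
    search P n < n ∧ P (search P n) := by
  induction n with
  | zero => obtain ⟨i, hi, -⟩ := h; omega
  | succ n ih =>
    by_cases hP : P n
    · have : search P (n + 1) = n := if_pos hP
      rw [this]
      exact ⟨n.lt_succ_self, hP⟩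
    · have : search P (n + 1) = search P n := if_neg hP
      rw [this]
      obtain ⟨i, hi, hPi⟩ := h
      have hin : i ≠ n := by rintro rfl; exact hP hPi
      have := ih ⟨i, by omega, hPi⟩
      exact ⟨by omega, this.2⟩

theorem ExactComputable.search {α : Type} {n : α → ℕ} {R : α → ℕ → Prop} (hn : ExactComputable n)
    (hR : ExactDecidable fun p : α × ℕ => R p.1 p.2) :
    ExactComputable fun a => WordEntropy.search (R a) (n a) := by
  classical
  refine .natRec (g := fun a k b => if R a k then k else b) hn .zero ?_
  exact ExactDecidable.ite (P := fun p : α × ℕ × ℕ => R p.1 p.2.1)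
    (ExactComputable.comp hR (.pair .fst (.ofSnd .fst))) (.ofSnd .fst) (.ofSnd .snd)

/-! ### The parameters are computable -/

section Parameters

variable {α : Type} {ε E : α → ℝ} {n₀ t : α → ℕ}

theorem exactComputable_delta (hε : ExactComputable ε) (hE : ExactComputable E) :
    ExactComputable fun a => delta (ε a) (E a) := by
  have := (hE.real_mul hε).real_div ((ExactComputable.const_real 105).real_mul
    ((ExactComputable.const_real 4).real_add ((ExactComputable.const_real 2).real_mul hE)))
  simpa only [delta, Nat.cast_ofNat] using this

theorem exactComputable_K (hε : ExactComputable ε) (hE : ExactComputable E) :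
    ExactComputable fun a => K (ε a) (E a) := by
  have := (ExactComputable.ceil.comp ((ExactComputable.const_real 1).real_div
    (exactComputable_delta hε hE))).nat_add (.const 1)
  simpa only [K, Nat.cast_one, one_div] using this

theorem exactComputable_scale (hε : ExactComputable ε) (hE : ExactComputable E)
    (hn : ExactComputable n₀) (ht : ExactComputable t) :
    ExactComputable fun a => scale (ε a) (E a) (n₀ a) (t a) := by
  have hd := (ExactComputable.const_real 1).real_add (exactComputable_delta hε hE)
  have hstep : ExactComputable fun p : α × ℕ × ℕ =>
      ⌈Real.exp ((K (ε p.1) (E p.1) : ℝ) * (((1 : ℕ) + delta (ε p.1) (E p.1)) *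
        ((1 : ℕ) + delta (ε p.1) (E p.1)) * E p.1 * (p.2.2 : ℝ) + E p.1))⌉₊ :=
    .comp .ceil (.comp .exp ((exactComputable_K hε hE).cast.ofFst.real_mul
      ((((hd.real_mul hd).real_mul hE).ofFst.real_mul (ExactComputable.cast (.ofSnd .snd))).real_add
        hE.ofFst)))
  have := ExactComputable.natRec (g := fun a _ b => ⌈Real.exp ((K (ε a) (E a) : ℝ) *
    (((1 : ℕ) + delta (ε a) (E a)) * ((1 : ℕ) + delta (ε a) (E a)) * E a * (b : ℝ) + E a))⌉₊)
    ht hn hstep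
  convert this using 2 with a
  induction t a with
  | zero => rfl
  | succ k ih => rw [scale, ih, Nat.cast_one, ← sq]

theorem exactComputable_horizon (hε : ExactComputable ε) (hE : ExactComputable E)
    (hn : ExactComputable n₀) : ExactComputable fun a => horizon (ε a) (E a) (n₀ a) :=
  exactComputable_scale hε hE hn (exactComputable_K hε hE)

end Parameters

/-! ### Coding sets of words by natural numbers -/

/-- The set of words of length `N` with code `c`. -/
def codeSet (q N c : ℕ) : Set (Fin N → Fin q) :=
  {y | c / 2 ^ (finFunctionFinEquiv y : ℕ) % 2 = 1}

open Classical in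
/-- The number of factors of length `n` of the set of words with code `c`. -/
def codeCount (q N c n : ℕ) : ℕ :=
  ((Finset.range (q ^ n)).filter fun v => ∃ y < q ^ N, ∃ i < N + 1 - n,
    c / 2 ^ y % 2 = 1 ∧ y / q ^ i % q ^ n = v).card

theorem finFunctionFinEquiv_digit {q n : ℕ} (y : Fin n → Fin q) (j : Fin n) :
    (finFunctionFinEquiv y : ℕ) / q ^ (j : ℕ) % q = y j := by
  conv_rhs => rw [← finFunctionFinEquiv.symm_apply_apply y]
  rfl

theorem exists_codeSet {q N : ℕ} (Y : Set (Fin N → Fin q)) :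
    ∃ c < 2 ^ q ^ N, codeSet q N c = Y := by
  classical
  let g : Fin (q ^ N) → Fin 2 := fun k => if finFunctionFinEquiv.symm k ∈ Y then 1 else 0
  refine ⟨finFunctionFinEquiv g, (finFunctionFinEquiv g).2, ?_⟩
  ext y
  rw [codeSet, Set.mem_ofPred_eq, finFunctionFinEquiv_digit]
  by_cases h : y ∈ Y <;> simp [g, h]

/-- The code of a word is a number in base `q` whose lowest digit is the first letter, so a factor
is cut out by a division and a remainder. -/
theorem finFunctionFinEquiv_factor {q N n : ℕ} (y : Fin N → Fin q) {i : ℕ} (h : i + n ≤ N)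
    {u : Fin n → Fin q} :
    (finFunctionFinEquiv y : ℕ) / q ^ i % q ^ n = finFunctionFinEquiv u ↔
      ∀ j : Fin n, u j = y ⟨i + j, by omega⟩ := by
  have hdigit : ∀ j : Fin n, (finFunctionFinEquiv y : ℕ) / q ^ i % q ^ n / q ^ (j : ℕ) % q =
      y ⟨i + j, by omega⟩ := by
    intro j
    have hn : q ^ n = q ^ (j : ℕ) * q ^ (n - j) := by rw [← pow_add, Nat.add_sub_cancel' j.2.le]
    rw [← finFunctionFinEquiv_digit y, hn, Nat.mod_mul_right_div_self, Nat.mod_mod_of_dvd _ (dvd_pow_self q (by omega)),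
      Nat.div_div_eq_div_mul, ← pow_add]
  constructor
  · intro hu j
    rw [Fin.ext_iff, ← hdigit, hu, finFunctionFinEquiv_digit]
  · intro hu
    -- For `n = 0` the alphabet may be empty; otherwise a letter of `u` shows `0 < q`.
    rcases Nat.eq_zero_or_pos n with rfl | hn
    · have := (finFunctionFinEquiv u).2
      have h1 : q ^ 0 = 1 := pow_zero q
      have h2 : (finFunctionFinEquiv y : ℕ) / q ^ i % q ^ 0 = 0 := by rw [h1, Nat.mod_one]
      omega
    have hq : 0 < q := (u ⟨0, hn⟩).pos
    have hlt := Nat.mod_lt ((finFunctionFinEquiv y : ℕ) / q ^ i) (pow_pos hq n)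
    have : (⟨_, hlt⟩ : Fin (q ^ n)) = finFunctionFinEquiv u := by
      rw [← Equiv.symm_apply_eq]
      funext j
      rw [hu j, Fin.ext_iff, ← hdigit]
      rfl
    exact congrArg Fin.val this

theorem ncard_blockFactors_codeSet {q N : ℕ} (c : ℕ) {n : ℕ} (hn : n ≤ N) :
    (blockFactors (codeSet q N c) n).ncard = codeCount q N c n := by
  classical
  have hinj : Function.Injective fun u : Fin n → Fin q => (finFunctionFinEquiv u : ℕ) :=
    Fin.val_injective.comp finFunctionFinEquiv.injective
  rw [codeCount, ← Set.ncard_coe_finset, ← Set.ncard_image_of_injective _ hinj]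
  congr 1
  ext v
  simp only [Finset.coe_filter, Finset.mem_range]
  constructor
  · rintro ⟨u, ⟨y, hy, i, h, hu⟩, rfl⟩
    exact ⟨(finFunctionFinEquiv u).2, _, (finFunctionFinEquiv y).2, i, by omega, hy,
      (finFunctionFinEquiv_factor y h).2 hu⟩
  · rintro ⟨hv, y, hy, i, hi, hc, hyv⟩
    obtain ⟨y, rfl⟩ : ∃ z : Fin N → Fin q, (finFunctionFinEquiv z : ℕ) = y :=
      ⟨finFunctionFinEquiv.symm ⟨y, hy⟩, by simp⟩
    obtain ⟨u, rfl⟩ : ∃ z : Fin n → Fin q, (finFunctionFinEquiv z : ℕ) = v :=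
      ⟨finFunctionFinEquiv.symm ⟨v, hv⟩, by simp⟩
    exact ⟨u, ⟨y, hc, i, by omega, (finFunctionFinEquiv_factor y (by omega)).1 hyv⟩, rfl⟩

/-- The number `(log q_n) / n` of the set of words with code `c`. -/
def codeRate (q N c n : ℕ) : ℝ := Real.log (codeCount q N c n) / n

theorem rate_codeSet {q N : ℕ} (c : ℕ) {n : ℕ} (hn : n ≤ N) :
    rate (codeSet q N c) n = codeRate q N c n := by
  rw [rate, ncard_blockFactors_codeSet c hn, codeRate]

/-- The code `c` belongs to a competing set, for the bounds `f 1, …, f N` in the list `l`. -/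
def CodeFeasible (q N : ℕ) (l : List ℝ) (c : ℕ) : Prop :=
  (∃ y < q ^ N, c / 2 ^ y % 2 = 1) ∧
    ∀ m < N, ¬ (l.drop m).headD 0 < (codeCount q N c (m + 1) : ℝ)

/-- The code `c` belongs to a solution of the optimization problem. -/
def CodeOptimal (q N : ℕ) (l : List ℝ) (c : ℕ) : Prop :=
  CodeFeasible q N l c ∧ ∀ c' < 2 ^ q ^ N, CodeFeasible q N l c' →
    ∀ n < N, ∃ m < N, ¬ codeRate q N c (n + 1) < codeRate q N c' (m + 1)

theorem feasible_codeSet_iff {q N : ℕ} {f : ℕ → ℝ} {c : ℕ} :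
    Feasible f (codeSet q N c) ↔
      CodeFeasible q N (List.ofFn fun i : Fin N => f (i + 1)) c := by
  refine and_congr ?_ ?_
  · constructor
    · rintro ⟨y, hy⟩
      exact ⟨_, (finFunctionFinEquiv y).2, hy⟩
    · rintro ⟨y, hy, hc⟩
      exact ⟨finFunctionFinEquiv.symm ⟨y, hy⟩, by
        rw [codeSet, Set.mem_ofPred_eq, Equiv.apply_symm_apply]; exact hc⟩
  · have hget : ∀ m, m < N →
        ((List.ofFn fun i : Fin N => f (i + 1)).drop m).headD 0 = f (m + 1) := by
      intro m hm
      rw [List.headD_eq_head?_getD, List.head?_drop]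
      simp [hm]
    constructor
    · intro h m hm
      rw [hget m hm, not_lt, ← ncard_blockFactors_codeSet c hm]
      exact h _ ⟨by omega, hm⟩
    · rintro h n ⟨hn1, hn⟩
      obtain ⟨m, rfl⟩ := Nat.exists_eq_add_of_le' hn1
      have := h m hn
      rwa [hget m hn, not_lt, ← ncard_blockFactors_codeSet c hn] at this

/-- The infima are over finite sets, so their comparison becomes a bounded search among comparisons
of single rates and no minimum has to be computed. -/
theorem minRate_le_minRate_iff {q N : ℕ} (hN : 1 ≤ N) {Y Y' : Set (Fin N → Fin q)} :
    minRate Y' ≤ minRate Y ↔ ∀ n < N, ∃ m < N, rate Y' (m + 1) ≤ rate Y (n + 1) := by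
  constructor
  · intro h n hn
    obtain ⟨m, hm, hmr⟩ := ((Set.nonempty_Icc.2 hN).image (rate Y')).csInf_mem
      ((Set.finite_Icc 1 N).image _)
    obtain ⟨k, rfl⟩ := Nat.exists_eq_add_of_le' hm.1
    exact ⟨k, hm.2, hmr.le.trans (h.trans (minRate_le_rate Y ⟨by omega, hn⟩))⟩
  · intro h
    refine le_minRate hN fun n hn => ?_
    obtain ⟨k, rfl⟩ := Nat.exists_eq_add_of_le' hn.1
    obtain ⟨m, hm, hle⟩ := h k hn.2
    exact (minRate_le_rate Y' ⟨by omega, hm⟩).trans hle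

theorem optimal_codeSet_iff {q N : ℕ} (hN : 1 ≤ N) {f : ℕ → ℝ} {c : ℕ} :
    Optimal f (codeSet q N c) ↔
      CodeOptimal q N (List.ofFn fun i : Fin N => f (i + 1)) c := by
  have hcmp : ∀ c' : ℕ, minRate (codeSet q N c') ≤ minRate (codeSet q N c) ↔
      ∀ n < N, ∃ m < N, ¬ codeRate q N c (n + 1) < codeRate q N c' (m + 1) := by
    intro c'
    rw [minRate_le_minRate_iff hN]
    refine forall₂_congr fun n hn => exists_congr fun m => and_congr_right fun hm => ?_
    rw [rate_codeSet c' hm, rate_codeSet c hn, not_lt]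
  refine and_congr feasible_codeSet_iff ?_
  constructor
  · intro h c' _ hc'
    exact (hcmp c').1 (h _ (feasible_codeSet_iff.2 hc'))
  · intro h Y' hY'
    obtain ⟨c', hc', rfl⟩ := exists_codeSet Y'
    exact (hcmp c').2 (h c' hc' (feasible_codeSet_iff.1 hY'))

/-! ### The algorithm -/

section Computable

variable {α : Type} {q N c n y : α → ℕ} {l : α → List ℝ}

open ExactComputable

theorem exactDecidable_bit (hc : ExactComputable c) (hy : ExactComputable y) :
    ExactDecidable fun a => c a / 2 ^ y a % 2 = 1 :=
  .nat_eq ((hc.nat_div ((const 2).nat_pow hy)).nat_mod (const 2)) (const 1)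

theorem exactComputable_codeCount (hq : ExactComputable q) (hN : ExactComputable N)
    (hc : ExactComputable c) (hn : ExactComputable n) :
    ExactComputable fun a => codeCount (q a) (N a) (c a) (n a) := by
  refine ExactDecidable.card_filter (hq.nat_pow hn) ?_
  refine ExactDecidable.exists_lt (hq.nat_pow hN).ofFst ?_
  refine ExactDecidable.exists_lt ((hN.nat_add (const 1)).nat_sub hn).ofFst.ofFst ?_
  exact (exactDecidable_bit hc.ofFst.ofFst.ofFst snd.ofFst).and
    (.nat_eq ((ExactComputable.nat_div snd.ofFst (hq.ofFst.ofFst.ofFst.nat_pow snd)).nat_mod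
      (hq.nat_pow hn).ofFst.ofFst.ofFst) snd.ofFst.ofFst)

theorem exactComputable_codeRate (hq : ExactComputable q) (hN : ExactComputable N)
    (hc : ExactComputable c) (hn : ExactComputable n) :
    ExactComputable fun a => codeRate (q a) (N a) (c a) (n a) :=
  (ExactComputable.log.comp (exactComputable_codeCount hq hN hc hn).cast).real_div hn.cast

theorem exactDecidable_codeFeasible (hq : ExactComputable q) (hN : ExactComputable N)
    (hl : ExactComputable l) (hc : ExactComputable c) :
    ExactDecidable fun a => CodeFeasible (q a) (N a) (l a) (c a) := by
  refine .and (.exists_lt (hq.nat_pow hN) (exactDecidable_bit hc.ofFst snd))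
    (.forall_lt hN ?_)
  exact (ExactDecidable.real_lt (headD_drop hl.ofFst snd) (exactComputable_codeCount hq.ofFst
    hN.ofFst hc.ofFst (snd.nat_add (const 1))).cast).not

theorem exactDecidable_codeOptimal (hq : ExactComputable q) (hN : ExactComputable N)
    (hl : ExactComputable l) (hc : ExactComputable c) :
    ExactDecidable fun a => CodeOptimal (q a) (N a) (l a) (c a) := by
  refine .and (exactDecidable_codeFeasible hq hN hl hc) (.forall_lt
    ((const 2).nat_pow (hq.nat_pow hN)) (.imp
      (exactDecidable_codeFeasible hq.ofFst hN.ofFst hl.ofFst snd)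
      (.forall_lt hN.ofFst (.exists_lt hN.ofFst.ofFst ?_))))
  exact (ExactDecidable.real_lt
    (exactComputable_codeRate hq.ofFst.ofFst.ofFst hN.ofFst.ofFst.ofFst hc.ofFst.ofFst.ofFst
      (snd.ofFst.nat_add (const 1)))
    (exactComputable_codeRate hq.ofFst.ofFst.ofFst hN.ofFst.ofFst.ofFst snd.ofFst.ofFst
      (snd.nat_add (const 1)))).not

end Computable

/-- The code of a solution of the optimization problem. -/
def solutionCode (q N : ℕ) (l : List ℝ) : ℕ := search (CodeOptimal q N l) (2 ^ q ^ N)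

/-- An index `r < K` that is suitable for the set of words with code `c`. -/
def suitableIndex (ε E : ℝ) (n₀ q c : ℕ) : ℕ :=
  search (fun r => codeRate q (horizon ε E n₀) c (scale ε E n₀ r) <
    ((1 : ℕ) + delta ε E) * codeRate q (horizon ε E n₀) c (scale ε E n₀ (r + 1))) (K ε E)

/-- The approximation of the word entropy that is computed from `q`, `ε`, `E_0(f)`, `n_0` and
the list `f(1), …, f(N)`. -/
def approximation (q : ℕ) (ε E : ℝ) (n₀ : ℕ) (l : List ℝ) : ℝ :=
  codeRate q (horizon ε E n₀) (solutionCode q (horizon ε E n₀) l)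
    (scale ε E n₀ (suitableIndex ε E n₀ q (solutionCode q (horizon ε E n₀) l)))

theorem exactComputable_approximation :
    ExactComputable fun p : ℕ × ℝ × ℝ × ℕ × List ℝ =>
      approximation p.1 p.2.1 p.2.2.1 p.2.2.2.1 p.2.2.2.2 := by
  have hq : ExactComputable fun p : ℕ × ℝ × ℝ × ℕ × List ℝ => p.1 := .fst
  have hε : ExactComputable fun p : ℕ × ℝ × ℝ × ℕ × List ℝ => p.2.1 := .ofSnd .fst
  have hE : ExactComputable fun p : ℕ × ℝ × ℝ × ℕ × List ℝ => p.2.2.1 := .ofSnd (.ofSnd .fst)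
  have hn : ExactComputable fun p : ℕ × ℝ × ℝ × ℕ × List ℝ => p.2.2.2.1 :=
    .ofSnd (.ofSnd (.ofSnd .fst))
  have hl : ExactComputable fun p : ℕ × ℝ × ℝ × ℕ × List ℝ => p.2.2.2.2 :=
    .ofSnd (.ofSnd (.ofSnd .snd))
  have hN := exactComputable_horizon hε hE hn
  have hc : ExactComputable fun p : ℕ × ℝ × ℝ × ℕ × List ℝ =>
      solutionCode p.1 (horizon p.2.1 p.2.2.1 p.2.2.2.1) p.2.2.2.2 :=
    .search ((ExactComputable.const 2).nat_pow (hq.nat_pow hN))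
      (exactDecidable_codeOptimal hq.ofFst hN.ofFst hl.ofFst .snd)
  refine exactComputable_codeRate hq hN hc (exactComputable_scale hε hE hn ?_)
  refine .search (exactComputable_K hε hE) (.real_lt ?_ (.real_mul ?_ ?_))
  · exact exactComputable_codeRate hq.ofFst hN.ofFst hc.ofFst
      (exactComputable_scale hε.ofFst hE.ofFst hn.ofFst .snd)
  · exact (ExactComputable.const_real 1).real_add (exactComputable_delta hε hE).ofFst
  · exact exactComputable_codeRate hq.ofFst hN.ofFst hc.ofFst
      (exactComputable_scale hε.ofFst hE.ofFst hn.ofFst (.nat_add .snd (.const 1)))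

theorem approximation_spec {q : ℕ} (hq : 2 ≤ q) {f : ℕ → ℝ} (hf : CStar f) {ε : ℝ} (hε : 0 < ε)
    (hε1 : ε < 1) {n₀ : ℕ} (h : Admissible f ε n₀) :
    ∃ (Y : Set (Fin (horizon ε (growthRate f) n₀) → Fin q)) (r : ℕ),
      Optimal f Y ∧ Suitable ε (growthRate f) n₀ Y r ∧
      approximation q ε (growthRate f) n₀
        (List.ofFn fun i : Fin (horizon ε (growthRate f) n₀) => f (i + 1)) =
        rate Y (scale ε (growthRate f) n₀ r) := by
  have hN : 1 ≤ horizon ε (growthRate f) n₀ := (scale_mem_Icc hf hε hε1 h le_rfl).1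
  obtain ⟨Y, hY⟩ := exists_optimal hq hf (horizon ε (growthRate f) n₀)
  obtain ⟨c₀, hc₀, rfl⟩ := exists_codeSet Y
  obtain ⟨-, hc⟩ := search_spec (P := CodeOptimal q _ _) ⟨c₀, hc₀, (optimal_codeSet_iff hN).1 hY⟩
  rw [← optimal_codeSet_iff hN] at hc
  set c := solutionCode q (horizon ε (growthRate f) n₀)
    (List.ofFn fun i : Fin (horizon ε (growthRate f) n₀) => f (i + 1)) with hcdef
  have hsuit : ∀ r, Suitable ε (growthRate f) n₀ (codeSet q (horizon ε (growthRate f) n₀) c) r ↔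
      r < K ε (growthRate f) ∧ codeRate q (horizon ε (growthRate f) n₀) c
        (scale ε (growthRate f) n₀ r) < ((1 : ℕ) + delta ε (growthRate f)) *
        codeRate q (horizon ε (growthRate f) n₀) c (scale ε (growthRate f) n₀ (r + 1)) := by
    intro r
    refine and_congr_right fun hr => ?_
    rw [rate_codeSet c (scale_mem_Icc hf hε hε1 h hr.le).2,
      rate_codeSet c (scale_mem_Icc hf hε hε1 h hr).2, Nat.cast_one]
  obtain ⟨r, hr⟩ := (Optimal.suitable hq hf hε hε1 h hc).1
  have hs := search_spec (P := fun r => codeRate q (horizon ε (growthRate f) n₀) c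
    (scale ε (growthRate f) n₀ r) < ((1 : ℕ) + delta ε (growthRate f)) *
    codeRate q (horizon ε (growthRate f) n₀) c (scale ε (growthRate f) n₀ (r + 1))) ⟨r, (hsuit r).1 hr⟩
  refine ⟨codeSet q (horizon ε (growthRate f) n₀) c, suitableIndex ε (growthRate f) n₀ q c, hc, (hsuit _).2 hs, ?_⟩
  exact (rate_codeSet c (scale_mem_Icc hf hε hε1 h hs.1.le).2).symm

end WordEntropy

end

open WordEntropy in
theorem theorem4p1 :
    -- `N` is computed from `ε`, `E_0(f)` and `n_0`
    ExactComputable (fun p : ℝ × ℝ × ℕ => horizon p.1 p.2.1 p.2.2) ∧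
    -- one algorithm, with input `q`, `ε`, `E_0(f)`, `n_0` and the list `f(1), …, f(N)`
    ∃ alg : ℕ × ℝ × ℝ × ℕ × List ℝ → ℝ, ExactComputable alg ∧
      ∀ (q : ℕ), 2 ≤ q → ∀ (f : ℕ → ℝ), CStar f → ∀ (ε : ℝ), 0 < ε → ε < 1 →
        -- the growth condition can be checked on `[n_0, 2 n_0 - 1]`
        (∀ n₀ : ℕ, 1 ≤ n₀ →
          ((∀ n ∈ Set.Icc n₀ (2 * n₀ - 1),
              Real.log (f n) / n < (1 + delta ε (growthRate f) / 2) * growthRate f) ↔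
            ∀ n ≥ n₀,
              Real.log (f n) / n < (1 + delta ε (growthRate f) / 2) * growthRate f)) ∧
        -- all large `n_0` can be used
        (0 < growthRate f → ∀ᶠ n₀ : ℕ in atTop, Admissible f ε n₀) ∧
        ∀ n₀ : ℕ, Admissible f ε n₀ →
          -- the optimization problem has a solution
          (∃ Y : Set (Fin (horizon ε (growthRate f) n₀) → Fin q), Optimal f Y) ∧
          -- every solution has a suitable index, and each of them gives a correct value
          (∀ Y : Set (Fin (horizon ε (growthRate f) n₀) → Fin q), Optimal f Y →
            (∃ r, Suitable ε (growthRate f) n₀ Y r) ∧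
            ∀ r, Suitable ε (growthRate f) n₀ Y r →
              (1 - ε) * rate Y (scale ε (growthRate f) n₀ r) ≤ wordEntropy q f ∧
              wordEntropy q f ≤ rate Y (scale ε (growthRate f) n₀ r)) ∧
          -- the algorithm returns one of these values, which lies in the required range
          ∃ h : ℝ,
            h = alg (q, ε, growthRate f, n₀,
              List.ofFn fun i : Fin (horizon ε (growthRate f) n₀) => f (i + 1)) ∧
            (∃ (Y : Set (Fin (horizon ε (growthRate f) n₀) → Fin q)) (r : ℕ),
              Optimal f Y ∧ Suitable ε (growthRate f) n₀ Y r ∧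
              h = rate Y (scale ε (growthRate f) n₀ r)) ∧
            (1 - ε) * h ≤ wordEntropy q f ∧ wordEntropy q f ≤ h := by
  refine ⟨exactComputable_horizon .fst (.ofSnd .fst) (.ofSnd .snd), _,
    exactComputable_approximation, fun q hq f hf ε hε hε1 => ⟨fun n₀ hn₀ => hf.log_div_lt_iff hn₀ _,
      fun hE => eventually_admissible hf hε hE, fun n₀ h => ⟨exists_optimal hq hf _,
        fun Y hY => hY.suitable hq hf hε hε1 h, _, rfl, ?_⟩⟩⟩
  obtain ⟨Y, r, hY, hr, heq⟩ := approximation_spec hq hf hε hε1 h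
  refine ⟨⟨Y, r, hY, hr, heq⟩, ?_⟩
  have := (hY.suitable hq hf hε hε1 h).2 r hr
  rwa [← heq] at this
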